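/- For $\tau$ in the upper half-plane put $q=e^{2\pi i\tau}$ and $\Lambda_\tau=2\pi i\,\mathbb Z+2\pi i\tau\,\mathbb Z$, let $\theta(z)=\vartheta(z)/\vartheta'(0)$ with $\vartheta(z)=\sum_{k\in\mathbb Z}(-1)^{k+\frac12}q^{\frac12(k+\frac12)^2}e^{(k+\frac12)z}$ be the odd Jacobi theta function with $\theta'(0)=1$, and let $$\mathbb G_a=\tfrac12(a-1)!\sum^{e}_{\lambda\in\Lambda_\tau\setminus\{0\}}\lambda^{-a}\ (a\ge 2\text{ even}),\qquad \mathbb G_a=0\ (a\text{ odd}),\qquad \mathcal E^*_m=(\ln\theta)^{(m)}+2\mathbb G_m\ (m\ge1),$$ where $\sum^e$ means summing over the $2\pi i$ direction first and then over the $2\pi i\tau$ direction. For $m\ge1$ let $T_m^{\Omega_{GW}}(z_1,\dots,z_m)$ be the ordered $A$-cycle integral $$\Big(\frac1{2\pi i}\Big)^{m}\int \frac{dv_1}{v_1}\cdots\frac{dv_m}{v_m}\;\theta\Big(\sum_k z_k\Big)\,\frac{\prod_{i<j}\theta(P_i-P_j)\,\theta(Q_i-Q_j)}{\prod_i\theta(P_i-Q_i)\prod_{i<j}\theta(P_i-Q_j)\,\theta(Q_i-P_j)},\qquad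 P_i=z_i+\log v_i,\quad Q_i=\log v_i,$$ over a torus $|v_j|=\text{const}$ with, for $u_j=e^{z_j}$, $|u_1v_1|>|v_1|>|u_2v_2|>|v_2|>\cdots>|u_mv_m|>|v_m|>|q|\,|u_1v_1|$. This is independent of the torus, and it continues analytically in $z$, for each $\tau$, to all $z\in\mathbb C^m$ such that $z_I:=\sum_{i\in I}z_i\notin\Lambda_\tau$ for every nonempty $I\subseteq[m]$; $T_m^{\Omega_{GW}}$ also denotes this continuation. Let $n\ge 1$, and let $\mathcal Q_n$ be the $\mathbb C$-algebra of functions of $(z,\tau)$, with $z=(z_1,\dots,z_n)$ and $z_I\notin\Lambda_\tau$ for all nonempty $I\subseteq[n]$, generated by $z_1,\dots,z_n$, $\mathbb G_2$ and all $\mathcal E^*_m(z_I)$ with $m\ge1$ and $\emptyset\ne I\subseteq[n]$. There is exactly one $\mathbb C$-linear derivation $\partial_{\mathbb G_2}$ of $\mathcal Q_n$ such that, for all $i$ and all nonempty $I\subseteq[n]$, $$\partial_{\mathbb G_2}z_i=0,\quad \partial_{\mathbb G_2}\mathbb G_2=1,\quad \partial_{\mathbb G_2}\mathcal E^*_1(z_I)=-2z_I,\quad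 \partial_{\mathbb G_2}\mathcal E^*_m(z_I)=0\ (m\ge2).$$ Moreover $T_n^{\Omega_{GW}}\in\mathcal Q_n$, and $$\partial_{\mathbb G_2}T_n^{\Omega_{GW}}(z_1,\dots,z_n)=-2\sum_{1\le i<j\le n}(z_i+z_j)\,T_{n-1}^{\Omega_{GW}}(z_i+z_j,z_1,\dots,\check z_i,\dots,\check z_j,\dots,z_n),$$ where $\check z_i,\check z_j$ means that these arguments are omitted (for $n=1$ the sum is empty and the right-hand side is $0$). -/

import Mathlib

open scoped UpperHalfPlane

noncomputable section

namespace EllipticGW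

/-! ### Theta function, Eisenstein series and Eisenstein-Kronecker series

The elliptic curve is `ℂ / Λ_τ` with `Λ_τ = 2πi ℤ + 2πi τ ℤ`, and `q = exp (2πiτ)`. -/

/-- The lattice `Λ_τ = 2πi ℤ + 2πi τ ℤ`. -/
def periodLattice (τ : ℍ) : Set ℂ :=
  {x | ∃ a b : ℤ, x = 2 * Real.pi * Complex.I * a + 2 * Real.pi * Complex.I * τ * b}

/-- The theta series `∑_{k ∈ ℤ} (-1)^{k+1/2} q^{(k+1/2)^2/2} e^{(k+1/2) z}`. -/
def thetaSeries (τ : ℍ) (z : ℂ) : ℂ :=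
  ∑' k : ℤ, Complex.exp (Real.pi * Complex.I * (k + 1 / 2)) *
    Complex.exp (Real.pi * Complex.I * τ * (k + 1 / 2) ^ 2 + (k + 1 / 2) * z)

/-- The odd Jacobi theta function, normalised by `θ'(0) = 1`. -/
def theta (τ : ℍ) (z : ℂ) : ℂ :=
  thetaSeries τ z / deriv (thetaSeries τ) 0

/-- The Eisenstein series `𝔾_a = (1/2) (a-1)! ∑ᵉ_{λ ∈ Λ_τ, λ ≠ 0} λ^{-a}` for even `a ≥ 2`, and `0`
for odd `a`. The Eisenstein summation sums over the `2πi` direction first (inner sum), then over the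
`2πiτ` direction (outer sum). -/
def eisG (a : ℕ) (τ : ℍ) : ℂ :=
  if Even a then
    1 / 2 * (Nat.factorial (a - 1) : ℂ) * ∑' d : ℤ, ∑' c : ℤ,
      if c = 0 ∧ d = 0 then 0 else
        1 / (2 * Real.pi * Complex.I * c + 2 * Real.pi * Complex.I * τ * d) ^ a
  else 0

/-- The Eisenstein-Kronecker series `ℰ*_m = (ln θ)^{(m)} + 2 𝔾_m`, for `m ≥ 1`. -/
def eStar (m : ℕ) (τ : ℍ) (z : ℂ) : ℂ :=
  iteratedDeriv (m - 1) (logDeriv (theta τ)) z + 2 * eisG m τ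

/-! ### The ordered `A`-cycle integral `T_n^{Ω_GW}` -/

/-- `Θ_{2n}(P, Q) = ∏_{i<j} θ(P_i - P_j) θ(Q_i - Q_j) /
  (∏_i θ(P_i - Q_i) ∏_{i<j} θ(P_i - Q_j) θ(Q_i - P_j))`. -/
def bigTheta {n : ℕ} (τ : ℍ) (P Q : Fin n → ℂ) : ℂ :=
  (∏ i, ∏ j ∈ Finset.Ioi i, theta τ (P i - P j) * theta τ (Q i - Q j)) /
    ((∏ i, theta τ (P i - Q i)) *
      ∏ i, ∏ j ∈ Finset.Ioi i, theta τ (P i - Q j) * theta τ (Q i - P j))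

/-- The integrand `θ(∏ u_k) Θ_{2n}` in additive coordinates `z_k = log u_k`, `w_k = log v_k`, with
`P_i = z_i + w_i` and `Q_j = w_j`. -/
def cycleIntegrand {n : ℕ} (τ : ℍ) (z w : Fin n → ℂ) : ℂ :=
  theta τ (∑ k, z k) * bigTheta τ (fun i => z i + w i) w

/-- `(2πi)^{-n} ∫ θ(∏ u_k) Θ_{2n} dv_1/v_1 ⋯ dv_n/v_n` over the torus `|v_j| = exp (r j)`,
parametrised by `v_j = exp (r j + i t_j)`, `0 ≤ t_j ≤ 2π`, so that `dv_j / v_j = i dt_j`. -/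
def cycleIntegral {n : ℕ} (τ : ℍ) (z : Fin n → ℂ) (r : Fin n → ℝ) : ℂ :=
  (1 / (2 * Real.pi * Complex.I)) ^ n *
    ∫ t in Set.Icc (0 : Fin n → ℝ) (fun _ => 2 * Real.pi),
      Complex.I ^ n * cycleIntegrand τ z (fun j => (r j : ℂ) + Complex.I * (t j : ℂ))

/-- With `|u_i| = exp (Re z_i)` and `|v_i| = exp (r i)`, the ordering
`|u_1 v_1| > |v_1| > |u_2 v_2| > |v_2| > ⋯ > |u_n v_n| > |v_n|`, all these moduli lying in a common
fundamental annulus (the ratio of any two is less than `|q|⁻¹ = exp (2π Im τ)`), which is the domain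
of the Fourier development. -/
def InOmegaGW {n : ℕ} (τ : ℍ) (z : Fin n → ℂ) (r : Fin n → ℝ) : Prop :=
  (∀ i, r i < (z i).re + r i) ∧
  (∀ i j, i < j → (z j).re + r j < r i) ∧
  (∀ i j, (z i).re + r i - r j < 2 * Real.pi * τ.im)

/-- The points `z ∈ ℂⁿ` with `∑_{i ∈ I} z_i ∉ Λ_τ` for every nonempty `I ⊆ [n]`. -/
def regularLocus (n : ℕ) (τ : ℍ) : Set (Fin n → ℂ) :=
  {z | ∀ I : Finset (Fin n), I.Nonempty → ∑ i ∈ I, z i ∉ periodLattice τ}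

/-- `F` is the analytic continuation in `z` (for each `τ`) of the ordered `A`-cycle integral for the
ordering `Ω_GW`. -/
def IsCycleContinuation (n : ℕ) (F : (Fin n → ℂ) → ℍ → ℂ) : Prop :=
  ∀ τ : ℍ, AnalyticOnNhd ℂ (fun z => F z τ) (regularLocus n τ) ∧
    ∀ (z : Fin n → ℂ) (r : Fin n → ℝ), InOmegaGW τ z r → F z τ = cycleIntegral τ z r

/-- `T_n^{Ω_GW}(z_1, …, z_n)` as a function of `z` and `τ`: the analytic continuation of the ordered
`A`-cycle integral. -/
def TGW (n : ℕ) : (Fin n → ℂ) → ℍ → ℂ :=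
  Classical.epsilon (IsCycleContinuation n)

/-- The tuple `(z_i + z_j, z_1, …, ž_i, …, ž_j, …, z_n)` of length `n - 1`, for `i ≠ j`. -/
def mergeTuple {n : ℕ} (z : Fin n → ℂ) (i j : Fin n) : Fin (n - 1) → ℂ :=
  fun k => ((z i + z j) ::
    ((List.finRange n).filter (fun l => l ≠ i ∧ l ≠ j)).map z).getD k 0

/-! ### The derivation `∂_{𝔾_2}` -/

/-- The pairs `(z, τ)` with `z` in the regular locus of `τ`. -/
abbrev Locus (n : ℕ) : Type :=
  {p : (Fin n → ℂ) × ℍ // p.1 ∈ regularLocus n p.2}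

/-- The coordinate function `z_i`. -/
def zFun {n : ℕ} (i : Fin n) : Locus n → ℂ := fun p => p.1.1 i

/-- The function `𝔾_2`. -/
def g2Fun (n : ℕ) : Locus n → ℂ := fun p => eisG 2 p.1.2

/-- The function `ℰ*_m(∑_{i ∈ I} z_i)`. -/
def eFun {n : ℕ} (m : ℕ) (I : Finset (Fin n)) : Locus n → ℂ :=
  fun p => eStar m p.1.2 (∑ i ∈ I, p.1.1 i)

/-- The function `T_n^{Ω_GW}`. -/
def tFun (n : ℕ) : Locus n → ℂ := fun p => TGW n p.1.1 p.1.2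

/-- The algebra of functions of `(z, τ)` generated over `ℂ` by the `z_i`, by `𝔾_2` and by all
`ℰ*_m(z_I)`, where `m ≥ 1`, `∅ ≠ I ⊆ [n]` and `z_I = ∑_{i ∈ I} z_i`. -/
def qeRing (n : ℕ) : Subalgebra ℂ (Locus n → ℂ) :=
  Algebra.adjoin ℂ (Set.range zFun ∪ {g2Fun n} ∪
    {f | ∃ (m : ℕ) (I : Finset (Fin n)), 1 ≤ m ∧ I.Nonempty ∧ f = eFun m I})

/-- The rule `∂ z_i = 0`, `∂ 𝔾_2 = 1`, `∂ ℰ*_1(z_I) = -2 z_I`, `∂ ℰ*_m(z_I) = 0` for `m ≥ 2`. -/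
structure IsG2Derivation {n : ℕ} (D : Derivation ℂ (qeRing n) (qeRing n)) : Prop where
  map_z : ∀ (f : qeRing n) (i : Fin n), (f : Locus n → ℂ) = zFun i → D f = 0
  map_g2 : ∀ f : qeRing n, (f : Locus n → ℂ) = g2Fun n → D f = 1
  map_e_one : ∀ (f : qeRing n) (I : Finset (Fin n)), I.Nonempty →
    (f : Locus n → ℂ) = eFun 1 I →
      ((D f : qeRing n) : Locus n → ℂ) = fun p => -2 * ∑ i ∈ I, p.1.1 i
  map_e : ∀ (f : qeRing n) (m : ℕ) (I : Finset (Fin n)), 2 ≤ m → I.Nonempty →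
    (f : Locus n → ℂ) = eFun m I → D f = 0

end EllipticGW

end

noncomputable section

namespace EllipticGW

open Complex Filter Topology Set
open scoped Real

lemma hasSum_iff_of_eq {ι : Type*} {f g : ι → ℂ} {a : ℂ} (h : ∀ k, f k = g k) :
    HasSum f a ↔ HasSum g a := by rw [funext h]

lemma thetaSeries_eq_jacobiTheta₂ (τ : ℍ) (z : ℂ) :
    thetaSeries τ z = cexp (π * I / 2 + π * I * τ / 4 + z / 2) *
      jacobiTheta₂ ((1 + τ) / 2 + z / (2 * π * I)) τ := by
  rw [thetaSeries, jacobiTheta₂, ← tsum_mul_left]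
  refine tsum_congr fun k => ?_
  rw [jacobiTheta₂_term, ← Complex.exp_add, ← Complex.exp_add]
  congr 1
  have : (π : ℂ) ≠ 0 := by exact_mod_cast Real.pi_ne_zero
  field_simp
  ring

lemma hasSum_thetaSeries (τ : ℍ) (z : ℂ) :
    HasSum (fun k : ℤ => cexp (π * I * (k + 1 / 2)) *
      cexp (π * I * τ * (k + 1 / 2) ^ 2 + (k + 1 / 2) * z)) (thetaSeries τ z) := by
  rw [thetaSeries_eq_jacobiTheta₂]
  refine (hasSum_iff_of_eq fun k => ?_).mp
    ((hasSum_jacobiTheta₂_term ((1 + τ) / 2 + z / (2 * π * I)) τ.im_pos).mul_left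
    (cexp (π * I / 2 + π * I * τ / 4 + z / 2)))
  rw [jacobiTheta₂_term, ← Complex.exp_add, ← Complex.exp_add]
  congr 1
  have : (π : ℂ) ≠ 0 := by exact_mod_cast Real.pi_ne_zero
  field_simp
  ring

lemma differentiable_thetaSeries (τ : ℍ) : Differentiable ℂ (thetaSeries τ) := by
  have : thetaSeries τ = fun z => cexp (π * I / 2 + π * I * τ / 4 + z / 2) *
      jacobiTheta₂ ((1 + τ) / 2 + z / (2 * π * I)) τ := funext (thetaSeries_eq_jacobiTheta₂ τ)
  rw [this]
  intro z
  refine DifferentiableAt.mul (by fun_prop) ?_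
  exact (differentiableAt_jacobiTheta₂_fst _ τ.im_pos).comp z (f := fun z : ℂ =>
    (1 + (τ : ℂ)) / 2 + z / (2 * π * I)) (by fun_prop)

lemma thetaSeries_neg (τ : ℍ) (z : ℂ) : thetaSeries τ (-z) = -thetaSeries τ z := by
  rw [thetaSeries, thetaSeries, ← tsum_neg,
    ← (Equiv.subLeft (-1 : ℤ)).tsum_eq (fun k : ℤ => cexp (π * I * (k + 1 / 2)) *
      cexp (π * I * τ * (k + 1 / 2) ^ 2 + (k + 1 / 2) * -z))]
  refine tsum_congr fun k => ?_
  have h1 : cexp (π * I * (((Equiv.subLeft (-1 : ℤ)) k : ℤ) + 1 / 2)) =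
      -cexp (π * I * (k + 1 / 2)) := by
    have : (π * I * (((Equiv.subLeft (-1 : ℤ)) k : ℤ) + 1 / 2) : ℂ) =
      π * I * (k + 1 / 2) + π * I + ((-k - 1 : ℤ) : ℂ) * (2 * π * I) := by
      simp only [Equiv.subLeft_apply]; push_cast; ring
    rw [this, Complex.exp_add, Complex.exp_int_mul_two_pi_mul_I, Complex.exp_add,
      Complex.exp_pi_mul_I]
    ring
  rw [h1, neg_mul]
  congr 3
  simp only [Equiv.subLeft_apply]; push_cast; ring

lemma thetaSeries_zero (τ : ℍ) : thetaSeries τ 0 = 0 := by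
  have := thetaSeries_neg τ 0
  rw [neg_zero] at this
  linear_combination this / 2

lemma thetaSeries_add_two_pi_I (τ : ℍ) (z : ℂ) :
    thetaSeries τ (z + 2 * π * I) = -thetaSeries τ z := by
  rw [thetaSeries, thetaSeries, ← tsum_neg]
  refine tsum_congr fun k => ?_
  have : (π * I * τ * (k + 1 / 2) ^ 2 + (k + 1 / 2) * (z + 2 * π * I) : ℂ) =
    (π * I * τ * (k + 1 / 2) ^ 2 + (k + 1 / 2) * z) + π * I + (k : ℂ) * (2 * π * I) := by ring
  rw [this, Complex.exp_add (_ + _), Complex.exp_int_mul_two_pi_mul_I, Complex.exp_add _ (π * I),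
      Complex.exp_pi_mul_I]
  ring

lemma thetaSeries_add_tau (τ : ℍ) (z : ℂ) :
    thetaSeries τ (z + 2 * π * I * τ) = -cexp (-π * I * τ - z) * thetaSeries τ z := by
  rw [thetaSeries, thetaSeries, ← tsum_mul_left,
    ← (Equiv.addRight (1 : ℤ)).tsum_eq (fun k : ℤ => -cexp (-π * I * τ - z) *
      (cexp (π * I * (k + 1 / 2)) * cexp (π * I * τ * (k + 1 / 2) ^ 2 + (k + 1 / 2) * z)))]
  refine tsum_congr fun k => ?_
  have h1 : cexp (π * I * (((Equiv.addRight (1 : ℤ)) k : ℤ) + 1 / 2)) =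
      -cexp (π * I * (k + 1 / 2)) := by
    have : (π * I * (((Equiv.addRight (1 : ℤ)) k : ℤ) + 1 / 2) : ℂ) =
      π * I * (k + 1 / 2) + π * I := by
      simp only [Equiv.coe_addRight]; push_cast; ring
    rw [this, Complex.exp_add, Complex.exp_pi_mul_I]
    ring
  have h2 : ∀ a b c : ℂ, -a * (-b * c) = b * (c * a) := fun a b c => by ring
  rw [h1, h2]
  congr 1
  rw [← Complex.exp_add]
  congr 1
  simp only [Equiv.coe_addRight]; push_cast; ring

lemma thetaSeries_tau_add_one {τ τ' : ℍ} (h : (τ' : ℂ) = τ + 1) (z : ℂ) :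
    thetaSeries τ' z = cexp (π * I / 4) * thetaSeries τ z := by
  rw [thetaSeries, thetaSeries, ← tsum_mul_left]
  refine tsum_congr fun k => ?_
  obtain ⟨j, hj⟩ := Int.even_mul_succ_self k
  have hj' : ((k : ℂ) * (k + 1)) = 2 * j := by
    have : ((k * (k + 1) : ℤ) : ℂ) = ((j + j : ℤ) : ℂ) := by rw [hj]
    push_cast at this
    linear_combination this
  have : (π * I * τ' * (k + 1 / 2) ^ 2 + (k + 1 / 2) * z : ℂ) =
    (π * I * τ * (k + 1 / 2) ^ 2 + (k + 1 / 2) * z) + π * I / 4 + (j : ℂ) * (2 * π * I) := by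
    rw [h]; linear_combination π * I * hj'
  rw [this, Complex.exp_add (_ + _), Complex.exp_int_mul_two_pi_mul_I, Complex.exp_add _ (π * I / 4)]
  ring

lemma exists_thetaSeries_inv {τ τ' : ℍ} (h : (τ' : ℂ) = -1 / τ) :
    ∃ c : ℂ, c ≠ 0 ∧ ∀ w : ℂ, thetaSeries τ' w =
      c * cexp (τ * w ^ 2 / (4 * π * I)) * thetaSeries τ (τ * w) := by
  have hτ : (τ : ℂ) ≠ 0 := τ.ne_zero
  have hpi : (π : ℂ) ≠ 0 := by exact_mod_cast Real.pi_ne_zero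
  have hd : (-I * (τ : ℂ)) ^ (1 / 2 : ℂ) ≠ 0 := by
    rw [Complex.cpow_ne_zero_iff_of_exponent_ne_zero (by norm_num)]
    simp [hτ]
  refine ⟨cexp (-π * I / 2) * (-I * (τ : ℂ)) ^ (1 / 2 : ℂ), mul_ne_zero (exp_ne_zero _) hd, fun w => ?_⟩
  rw [thetaSeries_eq_jacobiTheta₂, thetaSeries_eq_jacobiTheta₂, jacobiTheta₂_functional_equation _ τ,
    h]
  have h2 : ((1 + (τ : ℂ)) / 2 + τ * w / (2 * π * I)) / τ =
    ((1 + -1 / (τ : ℂ)) / 2 + w / (2 * π * I)) - (-1 / τ) := by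
    field_simp; ring
  rw [h2]
  have h3 := jacobiTheta₂_add_left' (((1 + -1 / (τ : ℂ)) / 2 + w / (2 * π * I)) - (-1 / τ)) (-1 / τ)
  rw [sub_add_cancel] at h3
  rw [h3]
  have key : ∀ a b c d e f J : ℂ, ∀ x : ℂ, x ≠ 0 → cexp a * cexp b = cexp c * cexp d * cexp e * cexp f →
      cexp a * (cexp b * J) = cexp c * x * cexp d * (cexp e * (1 / x * cexp f * J)) := by
    intro a b c d e f J x hx hh
    field_simp
    linear_combination J * hh
  refine key _ _ _ _ _ _ _ _ hd ?_
  simp only [← Complex.exp_add]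
  rw [Complex.exp_eq_exp_iff_exists_int]
  refine ⟨0, ?_⟩
  field_simp
  ring

/-- The term `e^{πiτ m²/2 + m x}` of the theta functions of modulus `τ / 2`. -/
def halfThetaTerm (τ : ℍ) (x : ℂ) (m : ℤ) : ℂ := cexp (π * I * τ * m ^ 2 / 2 + m * x)

lemma summable_halfThetaTerm (τ : ℍ) (x : ℂ) : Summable fun m => ‖halfThetaTerm τ x m‖ := by
  have hpi : (π : ℂ) ≠ 0 := by exact_mod_cast Real.pi_ne_zero
  have h : 0 < ((τ : ℂ) / 2).im := by
    have := τ.im_pos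
    simp only [Complex.div_ofNat_im]
    exact half_pos this
  refine Summable.norm (((hasSum_jacobiTheta₂_term (x / (2 * π * I)) h).summable).congr fun m => ?_)
  rw [jacobiTheta₂_term, halfThetaTerm]
  congr 1
  field_simp
  ring

/-- The change of variables `(s, t) ↦ (s + t, s - t - 1)`, `(s, t) ↦ (s + t, s - t)`. -/
def sumDiffEquiv : (ℤ × ℤ) ⊕ (ℤ × ℤ) ≃ ℤ × ℤ :=
  Equiv.ofBijective (Sum.elim (fun p => (p.1 + p.2, p.1 - p.2 - 1)) fun p => (p.1 + p.2, p.1 - p.2))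
    ⟨by
      rintro (⟨a, b⟩ | ⟨a, b⟩) (⟨c, d⟩ | ⟨c, d⟩) h <;>
        simp only [Sum.elim_inl, Sum.elim_inr, Prod.mk.injEq] at h <;>
        first
          | omega
          | (congr 2 <;> omega),
    by
      rintro ⟨k, l⟩
      rcases Int.even_or_odd (k + l) with ⟨s, hs⟩ | ⟨s, hs⟩
      · exact ⟨Sum.inr (s, k - s), by simp; omega⟩
      · exact ⟨Sum.inl (s + 1, k - s - 1), by simp; omega⟩⟩

lemma sumDiffEquiv_inl (s t : ℤ) : sumDiffEquiv (Sum.inl (s, t)) = (s + t, s - t - 1) := rfl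

lemma sumDiffEquiv_inr (s t : ℤ) : sumDiffEquiv (Sum.inr (s, t)) = (s + t, s - t) := rfl

lemma thetaSeries_mul (τ : ℍ) (x y : ℂ) :
    thetaSeries τ (x + y) * thetaSeries τ (x - y) =
      (∑' s : ℤ, halfThetaTerm τ x (2 * s)) * (∑' s : ℤ, halfThetaTerm τ y (2 * s + 1)) -
      (∑' s : ℤ, halfThetaTerm τ x (2 * s + 1)) * (∑' s : ℤ, halfThetaTerm τ y (2 * s)) := by
  have he : ∀ x, Summable fun s : ℤ => ‖halfThetaTerm τ x (2 * s)‖ := fun x =>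
    (summable_halfThetaTerm τ x).comp_injective (i := fun s : ℤ => 2 * s) fun a b h => by
      simpa using h
  have ho : ∀ x, Summable fun s : ℤ => ‖halfThetaTerm τ x (2 * s + 1)‖ := fun x =>
    (summable_halfThetaTerm τ x).comp_injective (i := fun s : ℤ => 2 * s + 1) fun a b h => by
      simpa using h
  have hprod : ∀ {f g : ℤ → ℂ}, (Summable fun s => ‖f s‖) → (Summable fun s => ‖g s‖) →
      HasSum (fun p : ℤ × ℤ => f p.1 * g p.2) ((∑' s, f s) * ∑' s, g s) := fun {f g} hf hg => by
    rw [tsum_mul_tsum_of_summable_norm hf hg]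
    exact (summable_mul_of_summable_norm hf hg).hasSum
  have h1 := hprod (hasSum_thetaSeries τ (x + y)).summable.norm
    (hasSum_thetaSeries τ (x - y)).summable.norm
  rw [(hasSum_thetaSeries τ (x + y)).tsum_eq, (hasSum_thetaSeries τ (x - y)).tsum_eq] at h1
  rw [← sumDiffEquiv.hasSum_iff] at h1
  refine h1.unique ?_
  rw [sub_eq_add_neg]
  refine HasSum.sum ((hasSum_iff_of_eq fun p => ?_).mp (hprod (he x) (ho y)))
    ((hasSum_iff_of_eq fun p => ?_).mp (hprod (ho x) (he y)).neg)
  · obtain ⟨s, t⟩ := p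
    simp only [Function.comp_apply, sumDiffEquiv_inl, halfThetaTerm, ← Complex.exp_add]
    rw [Complex.exp_eq_exp_iff_exists_int]
    exact ⟨-s, by push_cast; ring⟩
  · obtain ⟨s, t⟩ := p
    simp only [Function.comp_apply, sumDiffEquiv_inr, halfThetaTerm, ← Complex.exp_add]
    rw [neg_eq_neg_one_mul, ← Complex.exp_pi_mul_I, ← Complex.exp_add,
      Complex.exp_eq_exp_iff_exists_int]
    exact ⟨-s, by push_cast; ring⟩

lemma thetaSeries_three_term (τ : ℍ) (a b c d : ℂ) :
    thetaSeries τ (a + b) * thetaSeries τ (a - b) * (thetaSeries τ (c + d) * thetaSeries τ (c - d)) -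
    thetaSeries τ (a + c) * thetaSeries τ (a - c) * (thetaSeries τ (b + d) * thetaSeries τ (b - d)) +
    thetaSeries τ (a + d) * thetaSeries τ (a - d) * (thetaSeries τ (b + c) * thetaSeries τ (b - c)) =
      0 := by
  simp only [thetaSeries_mul]
  ring

/-! ### The normalised theta function -/

lemma theta_zero (τ : ℍ) : theta τ 0 = 0 := by rw [theta, thetaSeries_zero, zero_div]

lemma theta_neg (τ : ℍ) (z : ℂ) : theta τ (-z) = -theta τ z := by
  rw [theta, thetaSeries_neg, neg_div, theta]

lemma theta_add_two_pi_I (τ : ℍ) (z : ℂ) : theta τ (z + 2 * π * I) = -theta τ z := by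
  rw [theta, thetaSeries_add_two_pi_I, neg_div, theta]

lemma theta_add_tau (τ : ℍ) (z : ℂ) :
    theta τ (z + 2 * π * I * τ) = -cexp (-π * I * τ - z) * theta τ z := by
  rw [theta, thetaSeries_add_tau, theta, mul_div_assoc]

lemma differentiable_theta (τ : ℍ) : Differentiable ℂ (theta τ) :=
  (differentiable_thetaSeries τ).div_const _

lemma theta_tau_add_one {τ τ' : ℍ} (h : (τ' : ℂ) = τ + 1) (z : ℂ) : theta τ' z = theta τ z := by
  have : thetaSeries τ' = fun z => cexp (π * I / 4) * thetaSeries τ z :=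
    funext (thetaSeries_tau_add_one h)
  rw [theta, theta, this, deriv_const_mul _ (differentiable_thetaSeries τ 0)]
  exact mul_div_mul_left _ _ (Complex.exp_ne_zero _)

lemma theta_inv {τ τ' : ℍ} (h : (τ' : ℂ) = -1 / τ) (w : ℂ) :
    theta τ' w = cexp (τ * w ^ 2 / (4 * π * I)) * theta τ (τ * w) / τ := by
  obtain ⟨c, hc, hw⟩ := exists_thetaSeries_inv h
  have h2 : HasDerivAt (fun w : ℂ => thetaSeries τ (τ * w)) (deriv (thetaSeries τ) 0 * τ) 0 := by
    have h3 : HasDerivAt (thetaSeries τ) (deriv (thetaSeries τ) 0) ((τ : ℂ) * 0) := by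
      rw [mul_zero]; exact (differentiable_thetaSeries τ 0).hasDerivAt
    have h4 : HasDerivAt (fun w : ℂ => (τ : ℂ) * w) (τ : ℂ) 0 := by
      simpa using (hasDerivAt_id (0 : ℂ)).const_mul (τ : ℂ)
    exact h3.comp (0 : ℂ) h4
  have h3 : HasDerivAt (fun w : ℂ => c * cexp (τ * w ^ 2 / (4 * π * I)))
      (deriv (fun w : ℂ => c * cexp (τ * w ^ 2 / (4 * π * I))) 0) 0 :=
    DifferentiableAt.hasDerivAt (by fun_prop)
  have h1 : deriv (thetaSeries τ') 0 = c * τ * deriv (thetaSeries τ) 0 := by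
    rw [funext hw, (h3.fun_mul h2).deriv]
    simp only [mul_zero, thetaSeries_zero]
    simp
    ring
  rw [theta, theta, hw, h1]
  have hτ : (τ : ℂ) ≠ 0 := τ.ne_zero
  by_cases hd : deriv (thetaSeries τ) 0 = 0
  · simp [hd]
  · field_simp

lemma theta_three_term (τ : ℍ) (a b c d : ℂ) :
    theta τ (a + b) * theta τ (a - b) * (theta τ (c + d) * theta τ (c - d)) -
    theta τ (a + c) * theta τ (a - c) * (theta τ (b + d) * theta τ (b - d)) +
    theta τ (a + d) * theta τ (a - d) * (theta τ (b + c) * theta τ (b - c)) = 0 := by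
  have := thetaSeries_three_term τ a b c d
  simp only [theta]
  linear_combination (deriv (thetaSeries τ) 0)⁻¹ ^ 4 * this

/-! ### The lattice -/

/-- The real period `2π Im τ` of the real part of `Λ_τ`. -/
def imPeriod (τ : ℍ) : ℝ := 2 * π * τ.im

lemma imPeriod_pos (τ : ℍ) : 0 < imPeriod τ := by
  have := τ.im_pos
  unfold imPeriod
  positivity

lemma two_pi_I_tau_re (τ : ℍ) : (2 * π * I * τ : ℂ).re = -imPeriod τ := by
  simp [imPeriod]

/-- The pair of periods `(2πi, 2πiτ)`. -/
def periods (τ : ℍ) : PeriodPair where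
  ω₁ := 2 * π * I
  ω₂ := 2 * π * I * τ
  indep := by
    rw [LinearIndependent.pair_iff]
    intro s t h
    have h1 := congrArg Complex.re h
    have h2 := congrArg Complex.im h
    simp at h1 h2
    have : t = 0 := by
      rcases h1 with h1 | h1
      · exact h1
      · exact absurd h1 τ.im_ne_zero
    subst this
    simpa using h2

lemma mem_lattice_periods {τ : ℍ} {x : ℂ} : x ∈ (periods τ).lattice ↔ x ∈ periodLattice τ := by
  rw [PeriodPair.mem_lattice, periodLattice, mem_ofPred_eq]
  refine exists_congr fun a => exists_congr fun b => ?_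
  simp only [periods]
  constructor
  · intro h; rw [← h]; ring
  · intro h; rw [h]; ring

lemma coe_lattice_periods (τ : ℍ) : ((periods τ).lattice : Set ℂ) = periodLattice τ :=
  Set.ext fun _ => mem_lattice_periods

lemma zero_mem_periodLattice (τ : ℍ) : (0 : ℂ) ∈ periodLattice τ := ⟨0, 0, by simp⟩

lemma add_mem_periodLattice {τ : ℍ} {x y : ℂ} (hx : x ∈ periodLattice τ)
    (hy : y ∈ periodLattice τ) : x + y ∈ periodLattice τ := by
  rw [← mem_lattice_periods] at *
  exact add_mem hx hy

lemma neg_mem_periodLattice {τ : ℍ} {x : ℂ} (hx : x ∈ periodLattice τ) :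
    -x ∈ periodLattice τ := by
  rw [← mem_lattice_periods] at *
  exact neg_mem hx

lemma neg_mem_periodLattice_iff {τ : ℍ} {x : ℂ} : -x ∈ periodLattice τ ↔ x ∈ periodLattice τ :=
  ⟨fun h => by simpa using neg_mem_periodLattice h, neg_mem_periodLattice⟩

lemma two_pi_I_mem_periodLattice (τ : ℍ) : 2 * π * I ∈ periodLattice τ := ⟨1, 0, by simp⟩

lemma two_pi_I_tau_mem_periodLattice (τ : ℍ) : 2 * π * I * τ ∈ periodLattice τ := ⟨0, 1, by simp⟩

lemma add_mem_periodLattice_iff {τ : ℍ} {x y : ℂ} (hy : y ∈ periodLattice τ) :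
    x + y ∈ periodLattice τ ↔ x ∈ periodLattice τ :=
  ⟨fun h => by simpa using add_mem_periodLattice h (neg_mem_periodLattice hy),
    fun h => add_mem_periodLattice h hy⟩

lemma isClosed_periodLattice (τ : ℍ) : IsClosed (periodLattice τ) :=
  coe_lattice_periods τ ▸ (periods τ).isClosed_lattice

lemma isOpen_compl_periodLattice (τ : ℍ) : IsOpen (periodLattice τ)ᶜ :=
  (isClosed_periodLattice τ).isOpen_compl

lemma countable_periodLattice (τ : ℍ) : (periodLattice τ).Countable := by
  have : periodLattice τ ⊆ Set.range (fun p : ℤ × ℤ =>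
      (2 * π * I * p.1 + 2 * π * I * τ * p.2 : ℂ)) := by
    rintro x ⟨a, b, rfl⟩
    exact ⟨(a, b), rfl⟩
  exact (Set.countable_range _).mono this

lemma dense_compl_periodLattice (τ : ℍ) : Dense (periodLattice τ)ᶜ :=
  (countable_periodLattice τ).dense_compl ℂ

lemma eventually_notMem_periodLattice (τ : ℍ) (x : ℂ) : ∀ᶠ y in 𝓝[≠] x, y ∉ periodLattice τ := by
  rw [eventually_nhdsWithin_iff]
  filter_upwards [(periods τ).compl_lattice_sdiff_singleton_mem_nhds x] with y hy hne hmem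
  exact hy ⟨mem_lattice_periods.2 hmem, hne⟩

lemma notMem_periodLattice_of_re {τ : ℍ} {x : ℂ} (h0 : 0 < x.re) (h1 : x.re < imPeriod τ) :
    x ∉ periodLattice τ := by
  rintro ⟨a, b, rfl⟩
  have hre : (2 * π * I * a + 2 * π * I * τ * b : ℂ).re = -(imPeriod τ * b) := by
    simp [imPeriod]
  rw [hre] at h0 h1
  have hT := imPeriod_pos τ
  have hb : (b : ℝ) < 0 := by nlinarith
  have hb' : (-1 : ℝ) < b := by nlinarith
  have h2 : b < 0 := by exact_mod_cast hb
  have h3 : -1 < b := by exact_mod_cast hb'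
  omega

/-! ### Liouville's theorem for functions with multipliers -/

lemma exists_lattice_translate_mem_box (τ : ℍ) (z : ℂ) : ∃ a b : ℤ,
    z + a * (2 * π * I) + b * (2 * π * I * τ) ∈ Icc (-imPeriod τ) 0 ×ℂ Icc 0 (2 * π) := by
  have hT := imPeriod_pos τ
  have hpi := Real.two_pi_pos
  obtain ⟨b, hb⟩ : ∃ b : ℤ, z.re - b * imPeriod τ ∈ Icc (-imPeriod τ) 0 := by
    refine ⟨⌈z.re / imPeriod τ⌉, ?_, ?_⟩
    · have := Int.ceil_lt_add_one (z.re / imPeriod τ)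
      have h2 : ⌈z.re / imPeriod τ⌉ * imPeriod τ ≤ (z.re / imPeriod τ + 1) * imPeriod τ :=
        mul_le_mul_of_nonneg_right this.le hT.le
      rw [add_mul, div_mul_cancel₀ _ hT.ne'] at h2
      linarith
    · have := Int.le_ceil (z.re / imPeriod τ)
      have h2 := mul_le_mul_of_nonneg_right this hT.le
      rw [div_mul_cancel₀ _ hT.ne'] at h2
      linarith
  set y := (z + b * (2 * π * I * τ)).im with hy
  obtain ⟨a, ha⟩ : ∃ a : ℤ, y + a * (2 * π) ∈ Icc 0 (2 * π) := by
    refine ⟨-⌊y / (2 * π)⌋, ?_, ?_⟩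
    · have := Int.floor_le (y / (2 * π))
      have h2 := mul_le_mul_of_nonneg_right this hpi.le
      rw [div_mul_cancel₀ _ hpi.ne'] at h2
      push_cast
      linarith
    · have := Int.lt_floor_add_one (y / (2 * π))
      have h2 := mul_le_mul_of_nonneg_right this.le hpi.le
      rw [div_mul_cancel₀ _ hpi.ne'] at h2
      push_cast
      linarith
  refine ⟨a, b, ?_⟩
  rw [Complex.mem_reProdIm]
  constructor
  · have : (z + a * (2 * π * I) + b * (2 * π * I * τ)).re = z.re - b * imPeriod τ := by
      simp [imPeriod]; ring
    rw [this]; exact hb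
  · have : (z + a * (2 * π * I) + b * (2 * π * I * τ)).im = y + a * (2 * π) := by
      rw [hy]; simp; ring
    rw [this]; exact ha

/-- A function holomorphic off `Λ_τ`, with poles of order zero, and whose absolute value is doubly
periodic, is constant. -/
lemma exists_eq_const_of_norm_periodic {τ : ℍ} {g : ℂ → ℂ}
    (hd : ∀ z ∉ periodLattice τ, DifferentiableAt ℂ g z)
    (h1 : ∀ z ∉ periodLattice τ, ‖g (z + 2 * π * I)‖ = ‖g z‖)
    (h2 : ∀ z ∉ periodLattice τ, ‖g (z + 2 * π * I * τ)‖ = ‖g z‖)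
    (h0 : Tendsto (fun z => z * g z) (𝓝[≠] 0) (𝓝 0)) :
    ∃ C, ∀ z ∉ periodLattice τ, g z = C := by
  classical
  have hper : ∀ (a b : ℤ) (z : ℂ), z ∉ periodLattice τ →
      ‖g (z + a * (2 * π * I) + b * (2 * π * I * τ))‖ = ‖g z‖ := by
    set G : ℂ → ℝ := fun z => if z ∈ periodLattice τ then 0 else ‖g z‖ with hG
    have p1 : Function.Periodic G (2 * π * I) := fun z => by
      simp only [hG, add_mem_periodLattice_iff (two_pi_I_mem_periodLattice τ)]
      split_ifs with hz
      · rfl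
      · exact h1 z hz
    have p2 : Function.Periodic G (2 * π * I * τ) := fun z => by
      simp only [hG, add_mem_periodLattice_iff (two_pi_I_tau_mem_periodLattice τ)]
      split_ifs with hz
      · rfl
      · exact h2 z hz
    intro a b z hz
    have e1 : G (z + a * (2 * π * I) + b * (2 * π * I * τ)) = G z := by
      rw [p2.int_mul b, p1.int_mul a]
    have hz' : z + a * (2 * π * I) + b * (2 * π * I * τ) ∉ periodLattice τ := by
      have : a * (2 * π * I) + b * (2 * π * I * τ) ∈ periodLattice τ := ⟨a, b, by ring⟩
      rwa [add_assoc, add_mem_periodLattice_iff this]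
    simpa [hG, hz, hz'] using e1
  -- removable singularities
  have hlim : ∀ l ∈ periodLattice τ, Tendsto (fun z => (z - l) * g z) (𝓝[≠] l) (𝓝 0) := by
    rintro l ⟨a, b, rfl⟩
    set l : ℂ := 2 * π * I * a + 2 * π * I * τ * b with hl
    rw [tendsto_zero_iff_norm_tendsto_zero] at h0 ⊢
    have ht : Tendsto (fun z : ℂ => z - l) (𝓝[≠] l) (𝓝[≠] 0) := by
      refine tendsto_nhdsWithin_iff.2 ⟨?_, ?_⟩
      · have : Tendsto (fun z : ℂ => z - l) (𝓝 l) (𝓝 (l - l)) :=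
          (continuous_sub_right l).tendsto l
        rw [sub_self] at this
        exact this.mono_left nhdsWithin_le_nhds
      · filter_upwards [self_mem_nhdsWithin] with z hz
        simpa [sub_eq_zero] using hz
    refine (h0.comp ht).congr' ?_
    filter_upwards [ht.eventually (eventually_notMem_periodLattice τ 0)] with z hz
    simp only [Function.comp_apply, norm_mul]
    rw [← hper a b _ hz]
    congr 3
    rw [hl]; ring
  set F : ℂ → ℂ := fun z => if z ∈ periodLattice τ then limUnder (𝓝[≠] z) g else g z with hF
  have hFd : Differentiable ℂ F := by
    intro l
    by_cases hl : l ∈ periodLattice τ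
    · have hs := eventually_nhdsWithin_iff.1 (eventually_notMem_periodLattice τ l)
      have := Complex.differentiableOn_update_limUnder_of_isLittleO (f := g) (c := l)
        (s := {y | y ∈ ({l}ᶜ : Set ℂ) → y ∉ periodLattice τ}) hs
        (fun z hz => (hd z (hz.1 hz.2)).differentiableWithinAt) ?_
      · refine (this.differentiableAt hs).congr_of_eventuallyEq ?_
        filter_upwards [hs] with z hz
        by_cases hzl : z = l
        · subst hzl; simp [hF, hl]
        · simp [hF, hz hzl, Function.update_of_ne hzl]
      · rw [Asymptotics.isLittleO_iff_tendsto']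
        · have e : Tendsto (fun z : ℂ => (z - l) * g l) (𝓝[≠] l) (𝓝 0) := by
            have : Tendsto (fun z : ℂ => (z - l) * g l) (𝓝 l) (𝓝 ((l - l) * g l)) :=
              ((continuous_sub_right l).mul continuous_const).tendsto l
            rw [sub_self, zero_mul] at this
            exact this.mono_left nhdsWithin_le_nhds
          have := (hlim l hl).sub e
          rw [sub_zero] at this
          refine this.congr fun z => ?_
          rw [div_inv_eq_mul]; ring
        · filter_upwards [self_mem_nhdsWithin] with z hz h
          exact absurd (inv_eq_zero.1 h) (sub_ne_zero.2 hz)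
    · refine (hd l hl).congr_of_eventuallyEq ?_
      filter_upwards [(isOpen_compl_periodLattice τ).mem_nhds hl] with z hz
      simp only [hF, if_neg hz]
  have hcpt : IsCompact (Icc (-imPeriod τ) 0 ×ℂ Icc 0 (2 * π)) :=
    isCompact_Icc.reProdIm isCompact_Icc
  obtain ⟨M, hM⟩ := hcpt.exists_bound_of_continuousOn hFd.continuous.continuousOn
  have hb : ∀ z, ‖F z‖ ≤ M := by
    have hcl : IsClosed {z | ‖F z‖ ≤ M} := isClosed_le hFd.continuous.norm continuous_const
    have hsub : (periodLattice τ)ᶜ ⊆ {z | ‖F z‖ ≤ M} := by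
      intro z hz
      obtain ⟨a, b, hab⟩ := exists_lattice_translate_mem_box τ z
      have hz' : z + a * (2 * π * I) + b * (2 * π * I * τ) ∉ periodLattice τ := by
        have : a * (2 * π * I) + b * (2 * π * I * τ) ∈ periodLattice τ := ⟨a, b, by ring⟩
        rwa [add_assoc, add_mem_periodLattice_iff this]
      have := hM _ hab
      simp only [hF, if_neg hz', hper a b z hz] at this
      simpa only [hF, mem_ofPred_eq, if_neg hz] using this
    intro z
    have := hcl.closure_subset_iff.2 hsub
    rw [(dense_compl_periodLattice τ).closure_eq] at this
    exact this (mem_univ z)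
  obtain ⟨C, hC⟩ := hFd.exists_const_forall_eq_of_bounded
    ((Metric.isBounded_closedBall (x := (0 : ℂ)) (r := M)).subset (by
      rintro _ ⟨z, rfl⟩
      simpa using hb z))
  refine ⟨C, fun z hz => ?_⟩
  rw [← hC z]
  simp only [hF, if_neg hz]

/-- A function holomorphic off `Λ_τ` with poles of order zero, with period `2πi` and with
multiplier of absolute value strictly between `|q|` and `1`, vanishes. -/
lemma eq_zero_of_multiplier {τ : ℍ} {f : ℂ → ℂ} {x : ℂ} (hx0 : 0 < x.re) (hx1 : x.re < imPeriod τ)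
    (hd : ∀ z ∉ periodLattice τ, DifferentiableAt ℂ f z)
    (h1 : ∀ z ∉ periodLattice τ, f (z + 2 * π * I) = f z)
    (h2 : ∀ z ∉ periodLattice τ, f (z + 2 * π * I * τ) = cexp (-x) * f z)
    (h0 : Tendsto (fun z => z * f z) (𝓝[≠] 0) (𝓝 0)) (z : ℂ) (hz : z ∉ periodLattice τ) :
    f z = 0 := by
  have hT := imPeriod_pos τ
  set α : ℝ := x.re / imPeriod τ with hα
  have hα0 : 0 < α := div_pos hx0 hT
  have hα1 : α < 1 := (div_lt_one hT).2 hx1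
  obtain ⟨C, hC⟩ := exists_eq_const_of_norm_periodic (τ := τ) (g := fun z => f z * cexp (-α * z))
    (fun z hz => (hd z hz).mul (by fun_prop))
    (fun z hz => by
      rw [norm_mul, norm_mul, h1 z hz, Complex.norm_exp, Complex.norm_exp]
      simp)
    (fun z hz => by
      rw [norm_mul, norm_mul, h2 z hz, norm_mul, Complex.norm_exp, Complex.norm_exp,
        Complex.norm_exp, mul_comm (rexp _), mul_assoc, ← Real.exp_add]
      congr 2
      have e1 : (-(α : ℂ) * (z + 2 * π * I * τ)).re = (-(α : ℂ) * z).re + α * imPeriod τ := by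
        rw [mul_add, Complex.add_re, ← Complex.ofReal_neg, Complex.re_ofReal_mul,
          Complex.re_ofReal_mul, two_pi_I_tau_re]
        ring
      rw [e1, hα, div_mul_cancel₀ _ hT.ne', Complex.neg_re]
      ring)
    (by
      have : Tendsto (fun z : ℂ => z * f z * cexp (-α * z)) (𝓝[≠] 0) (𝓝 (0 * cexp (-α * 0))) :=
        h0.mul ((by fun_prop : Continuous fun z : ℂ => cexp (-α * z)).tendsto 0 |>.mono_left
          nhdsWithin_le_nhds)
      rw [zero_mul] at this
      exact this.congr fun z => by ring)
  have hz' := (add_mem_periodLattice_iff (two_pi_I_mem_periodLattice τ) (x := z)).not.2 hz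
  have e1 := hC _ hz'
  have e2 := hC z hz
  rw [h1 z hz] at e1
  by_contra hne
  have e3 : cexp (-α * (z + 2 * π * I)) = cexp (-α * z) :=
    mul_left_cancel₀ hne (e1.trans e2.symm)
  rw [Complex.exp_eq_exp_iff_exists_int] at e3
  obtain ⟨k, hk⟩ := e3
  have hk' : -(α : ℂ) = k := by
    have : (2 * π * I : ℂ) ≠ 0 := Complex.two_pi_I_ne_zero
    refine mul_right_cancel₀ this ?_
    linear_combination hk
  have hk'' : -α = k := by exact_mod_cast hk'
  have a1 : (k : ℝ) < 0 := by linarith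
  have a2 : (-1 : ℝ) < k := by linarith
  have a3 : k < 0 := by exact_mod_cast a1
  have a4 : -1 < k := by exact_mod_cast a2
  omega

/-! ### The product formula and the zeros of the theta function -/

/-- `q = e^{2πiτ}`. -/
def nome (τ : ℍ) : ℂ := cexp (2 * π * I * τ)

lemma norm_nome (τ : ℍ) : ‖nome τ‖ = rexp (-imPeriod τ) := by
  rw [nome, Complex.norm_exp, two_pi_I_tau_re]

lemma norm_nome_lt_one (τ : ℍ) : ‖nome τ‖ < 1 := by
  rw [norm_nome, Real.exp_lt_one_iff]
  linarith [imPeriod_pos τ]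

/-- The infinite product `∏_{n ≥ 1} (1 - q^n w)`. -/
def nomeProd (τ : ℍ) (w : ℂ) : ℂ := ∏' n : ℕ, (1 + -(nome τ ^ (n + 1) * w))

lemma summable_nome_pow_mul (τ : ℍ) (w : ℂ) : Summable fun n : ℕ => ‖-(nome τ ^ (n + 1) * w)‖ := by
  simp only [norm_neg, norm_mul, norm_pow]
  exact ((summable_nat_add_iff 1).2
    (summable_geometric_of_lt_one (norm_nonneg _) (norm_nome_lt_one τ))).mul_right _

lemma hasProdLocallyUniformlyOn_nomeProd (τ : ℍ) :
    HasProdLocallyUniformlyOn (fun (n : ℕ) w => 1 + -(nome τ ^ (n + 1) * w)) (nomeProd τ) univ := by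
  refine hasProdLocallyUniformlyOn_of_forall_compact isOpen_univ fun K _ hK => ?_
  obtain ⟨M, hM⟩ := hK.exists_bound_of_continuousOn (f := fun w : ℂ => w) continuousOn_id
  refine (((summable_nat_add_iff 1).2 (summable_geometric_of_lt_one (norm_nonneg _)
    (norm_nome_lt_one τ))).mul_right M).hasProdUniformlyOn_nat_one_add hK
      (.of_forall fun n w hw => ?_) fun _ => by fun_prop
  rw [norm_neg, norm_mul, norm_pow]
  exact mul_le_mul_of_nonneg_left (hM w hw) (by positivity)

lemma differentiable_nomeProd (τ : ℍ) : Differentiable ℂ (nomeProd τ) := by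
  rw [← differentiableOn_univ]
  exact (hasProdLocallyUniformlyOn_nomeProd τ).differentiableOn
    (.of_forall fun _ => by
      simpa [Finset.prod_fn] using DifferentiableOn.finsetProd (fun _ _ => by fun_prop)) isOpen_univ

lemma nomeProd_ne_zero {τ : ℍ} {w : ℂ} (h : ∀ n : ℕ, nome τ ^ (n + 1) * w ≠ 1) :
    nomeProd τ w ≠ 0 := by
  refine tprod_one_add_ne_zero_of_summable (fun n hn => h n ?_) (summable_nome_pow_mul τ w)
  linear_combination -hn

lemma nomeProd_eq (τ : ℍ) (w : ℂ) : nomeProd τ w = (1 - nome τ * w) * nomeProd τ (nome τ * w) := by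
  have h : ∀ n : ℕ, (1 + -(nome τ ^ (n + 1 + 1) * w)) = 1 + -(nome τ ^ (n + 1) * (nome τ * w)) :=
    fun n => by ring
  rw [nomeProd, tprod_eq_zero_mul', nomeProd]
  · simp only [h]
    ring
  · simp only [h]
    exact multipliable_one_add_of_summable (summable_nome_pow_mul τ _)

/-- The product `∏_{n ≥ 1} (1 - q^n e^z) (1 - q^n e^{-z})`. -/
def evenProd (τ : ℍ) (z : ℂ) : ℂ := nomeProd τ (cexp z) * nomeProd τ (cexp (-z))

/-- The product form of the theta function. -/
def thetaProd (τ : ℍ) (z : ℂ) : ℂ := (cexp (z / 2) - cexp (-z / 2)) * evenProd τ z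

lemma differentiable_evenProd (τ : ℍ) : Differentiable ℂ (evenProd τ) := by
  have := differentiable_nomeProd τ
  unfold evenProd
  fun_prop

lemma differentiable_thetaProd (τ : ℍ) : Differentiable ℂ (thetaProd τ) := by
  have := differentiable_evenProd τ
  unfold thetaProd
  fun_prop

lemma mem_periodLattice_of_nome_pow_mul_exp {τ : ℍ} {z : ℂ} {n : ℕ}
    (h : nome τ ^ n * cexp z = 1) : z ∈ periodLattice τ := by
  rw [nome, ← Complex.exp_nat_mul, ← Complex.exp_add, Complex.exp_eq_one_iff] at h
  obtain ⟨k, hk⟩ := h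
  exact ⟨k, -n, by push_cast; linear_combination hk⟩

lemma nomeProd_exp_ne_zero {τ : ℍ} {z : ℂ} (hz : z ∉ periodLattice τ) :
    nomeProd τ (cexp z) ≠ 0 :=
  nomeProd_ne_zero fun _ h => hz (mem_periodLattice_of_nome_pow_mul_exp h)

lemma evenProd_zero_ne_zero (τ : ℍ) : evenProd τ 0 ≠ 0 := by
  have : nomeProd τ 1 ≠ 0 := nomeProd_ne_zero fun n h => by
    have h2 := congrArg norm h
    rw [mul_one, norm_pow, norm_one] at h2
    exact (pow_lt_one₀ (norm_nonneg _) (norm_nome_lt_one τ) n.succ_ne_zero).ne h2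
  simp [evenProd, this]

lemma thetaProd_ne_zero {τ : ℍ} {z : ℂ} (hz : z ∉ periodLattice τ) : thetaProd τ z ≠ 0 := by
  refine mul_ne_zero (fun h => hz ?_) (mul_ne_zero (nomeProd_exp_ne_zero hz)
    (nomeProd_exp_ne_zero (neg_mem_periodLattice_iff.not.2 hz)))
  refine mem_periodLattice_of_nome_pow_mul_exp (n := 0) ?_
  rw [sub_eq_zero, Complex.exp_eq_exp_iff_exists_int] at h
  obtain ⟨k, hk⟩ := h
  rw [pow_zero, one_mul, Complex.exp_eq_one_iff]
  exact ⟨k, by linear_combination hk⟩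

lemma thetaProd_add_two_pi_I (τ : ℍ) (z : ℂ) : thetaProd τ (z + 2 * π * I) = -thetaProd τ z := by
  have h1 : cexp ((z + 2 * π * I) / 2) = -cexp (z / 2) := by
    rw [show (z + 2 * π * I) / 2 = z / 2 + π * I by ring, Complex.exp_add, Complex.exp_pi_mul_I]
    ring
  have h2 : cexp (-(z + 2 * π * I) / 2) = -cexp (-z / 2) := by
    rw [show -(z + 2 * π * I) / 2 = -z / 2 - π * I by ring, Complex.exp_sub, Complex.exp_pi_mul_I]
    ring
  have h3 : cexp (-(z + 2 * π * I)) = cexp (-z) := by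
    rw [neg_add, ← sub_eq_add_neg, Complex.exp_sub, Complex.exp_two_pi_mul_I, div_one]
  rw [thetaProd, thetaProd, evenProd, evenProd, h1, h2, h3, Complex.exp_add,
    Complex.exp_two_pi_mul_I, mul_one]
  ring

lemma thetaProd_add_tau {τ : ℍ} {z : ℂ} (hz : z ∉ periodLattice τ) :
    thetaProd τ (z + 2 * π * I * τ) = -cexp (-π * I * τ - z) * thetaProd τ z := by
  have hq : cexp (z + 2 * π * I * τ) = nome τ * cexp z := by
    rw [Complex.exp_add, nome, mul_comm]
  have hne : 1 - nome τ * cexp z ≠ 0 := fun h => hz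
    (mem_periodLattice_of_nome_pow_mul_exp (n := 1) (by rw [pow_one]; linear_combination -h))
  have e1 := nomeProd_eq τ (cexp z)
  have e2 := nomeProd_eq τ (cexp (-(z + 2 * π * I * τ)))
  have e3 : nome τ * cexp (-(z + 2 * π * I * τ)) = cexp (-z) := by
    rw [nome, ← Complex.exp_add]; congr 1; ring
  rw [e3] at e2
  rw [thetaProd, thetaProd, evenProd, evenProd, e2, hq, e1]
  have key : (cexp ((z + 2 * π * I * τ) / 2) - cexp (-(z + 2 * π * I * τ) / 2)) * (1 - cexp (-z)) =
      -cexp (-π * I * τ - z) * (cexp (z / 2) - cexp (-z / 2)) * (1 - nome τ * cexp z) := by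
    have a1 : cexp ((z + 2 * π * I * τ) / 2) = cexp (z / 2) * cexp (π * I * τ) := by
      rw [← Complex.exp_add]; congr 1; ring
    have a2 : cexp (-(z + 2 * π * I * τ) / 2) = (cexp (z / 2))⁻¹ * (cexp (π * I * τ))⁻¹ := by
      rw [← Complex.exp_neg, ← Complex.exp_neg, ← Complex.exp_add]; congr 1; ring
    have a3 : cexp (-z) = (cexp (z / 2))⁻¹ ^ 2 := by
      rw [← Complex.exp_neg, ← Complex.exp_nat_mul]; congr 1; push_cast; ring
    have a4 : cexp (-π * I * τ - z) = (cexp (π * I * τ))⁻¹ * (cexp (z / 2))⁻¹ ^ 2 := by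
      rw [← Complex.exp_neg, ← Complex.exp_neg, ← Complex.exp_nat_mul, ← Complex.exp_add]
      congr 1; push_cast; ring
    have a5 : cexp (-z / 2) = (cexp (z / 2))⁻¹ := by
      rw [← Complex.exp_neg]; congr 1; ring
    have a6 : nome τ = cexp (π * I * τ) ^ 2 := by
      rw [nome, ← Complex.exp_nat_mul]; congr 1; push_cast; ring
    have a7 : cexp z = cexp (z / 2) ^ 2 := by
      rw [← Complex.exp_nat_mul]; congr 1; push_cast; ring
    have n1 := Complex.exp_ne_zero (z / 2)
    have n2 := Complex.exp_ne_zero (π * I * τ)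
    rw [a1, a2, a3, a4, a5, a6, a7]
    field_simp
    ring
  linear_combination nomeProd τ (nome τ * cexp z) * nomeProd τ (cexp (-z)) * key

lemma hasDerivAt_thetaProd_zero (τ : ℍ) : HasDerivAt (thetaProd τ) (evenProd τ 0) 0 := by
  have h1 : HasDerivAt (fun z : ℂ => cexp (z / 2) - cexp (-z / 2)) 1 0 := by
    have := (((hasDerivAt_id (0 : ℂ)).div_const 2).cexp).sub
      (((hasDerivAt_id (0 : ℂ)).neg.div_const 2).cexp)
    convert! this using 1
    simp
    norm_num
  have := h1.mul (differentiable_evenProd τ 0).hasDerivAt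
  convert! this using 1
  simp

lemma exists_thetaSeries_ne_zero (τ : ℍ) : ∃ z ∉ periodLattice τ, thetaSeries τ z ≠ 0 := by
  by_contra! h
  have hz : ∀ z, thetaSeries τ z = 0 := by
    have hcl : IsClosed {z | thetaSeries τ z = 0} :=
      isClosed_eq (differentiable_thetaSeries τ).continuous continuous_const
    intro z
    have := hcl.closure_subset_iff.2 (fun z (hz : z ∈ (periodLattice τ)ᶜ) => h z hz)
    rw [(dense_compl_periodLattice τ).closure_eq] at this
    exact this (mem_univ z)
  set c : ℤ → ℂ := fun k => cexp (π * I * (k + 1 / 2)) * cexp (π * I * τ * (k + 1 / 2) ^ 2) with hc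
  have hsum : ∀ t : ℝ, HasSum (fun k : ℤ => c k * cexp (k * I * t)) 0 := by
    intro t
    have := (hasSum_thetaSeries τ (I * t)).mul_right (cexp (-(I * t / 2)))
    rw [hz, zero_mul] at this
    refine (hasSum_iff_of_eq fun k => ?_).1 this
    rw [hc]
    simp only [mul_assoc]
    congr 1
    rw [← Complex.exp_add, ← Complex.exp_add]
    congr 1
    ring
  have hn : ∀ (k : ℤ) (t : ℝ), ‖c k * cexp (k * I * t)‖ = ‖c k‖ := fun k t => by
    rw [norm_mul, Complex.norm_exp]
    simp
  have hcs : Summable fun k => ‖c k‖ := (hsum 0).summable.norm.congr fun k => hn k 0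
  have := intervalIntegral.hasSum_integral_of_dominated_convergence (a := 0) (b := 2 * π)
    (μ := MeasureTheory.volume) (F := fun (k : ℤ) (t : ℝ) => c k * cexp (k * I * t))
    (f := fun _ => 0) (fun k _ => ‖c k‖)
    (fun k => (by fun_prop : Continuous fun t : ℝ => c k * cexp (k * I * t)).aestronglyMeasurable)
    (fun k => .of_forall fun t _ => (hn k t).le) (.of_forall fun _ _ => hcs)
    (by simp) (.of_forall fun t _ => hsum t)
  have h2 := this.unique (hasSum_single 0 fun k hk => ?_)
  · simp [hc, Complex.exp_ne_zero] at h2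
  · have hk' : (k * I : ℂ) ≠ 0 := mul_ne_zero (by exact_mod_cast hk) I_ne_zero
    rw [intervalIntegral.integral_const_mul, integral_exp_mul_complex hk']
    have : cexp (k * I * (2 * π : ℝ)) = 1 := by
      rw [Complex.exp_eq_one_iff]; exact ⟨k, by push_cast; ring⟩
    rw [this]
    simp

lemma exists_thetaSeries_eq_thetaProd (τ : ℍ) :
    ∃ C : ℂ, C ≠ 0 ∧ ∀ z, thetaSeries τ z = C * thetaProd τ z := by
  obtain ⟨C, hC⟩ := exists_eq_const_of_norm_periodic (τ := τ)
    (g := fun z => thetaSeries τ z / thetaProd τ z)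
    (fun z hz => (differentiable_thetaSeries τ z).div (differentiable_thetaProd τ z)
      (thetaProd_ne_zero hz))
    (fun z _ => by rw [thetaSeries_add_two_pi_I, thetaProd_add_two_pi_I, neg_div_neg_eq])
    (fun z hz => by
      rw [thetaSeries_add_tau, thetaProd_add_tau hz,
        mul_div_mul_left _ _ (neg_ne_zero.2 (Complex.exp_ne_zero _))])
    (by
      have h1 : Tendsto (fun z => z⁻¹ * thetaProd τ z) (𝓝[≠] 0) (𝓝 (evenProd τ 0)) := by
        have := (hasDerivAt_iff_tendsto_slope_zero.1 (hasDerivAt_thetaProd_zero τ))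
        simpa [thetaProd] using this
      have h2 : Tendsto (thetaSeries τ) (𝓝[≠] 0) (𝓝 0) := by
        have := (differentiable_thetaSeries τ).continuous.tendsto 0
        rw [thetaSeries_zero] at this
        exact this.mono_left nhdsWithin_le_nhds
      have h3 := h2.div h1 (evenProd_zero_ne_zero τ)
      rw [zero_div] at h3
      refine h3.congr fun z => ?_
      simp only [Pi.div_apply]
      rw [mul_div_assoc', mul_comm, div_eq_mul_inv, mul_inv, inv_inv, div_eq_mul_inv]
      ring)
  have hC' : ∀ z ∉ periodLattice τ, thetaSeries τ z = C * thetaProd τ z := fun z hz => by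
    rw [← hC z hz, div_mul_cancel₀ _ (thetaProd_ne_zero hz)]
  refine ⟨C, ?_, ?_⟩
  · rintro rfl
    obtain ⟨z, hz, hne⟩ := exists_thetaSeries_ne_zero τ
    exact hne (by rw [hC' z hz, zero_mul])
  · have hcl : IsClosed {z | thetaSeries τ z = C * thetaProd τ z} :=
      isClosed_eq (differentiable_thetaSeries τ).continuous
        ((differentiable_thetaProd τ).continuous.const_mul C)
    intro z
    have := hcl.closure_subset_iff.2 (fun z (hz : z ∈ (periodLattice τ)ᶜ) => hC' z hz)
    rw [(dense_compl_periodLattice τ).closure_eq] at this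
    exact this (mem_univ z)

lemma deriv_thetaSeries_ne_zero (τ : ℍ) : deriv (thetaSeries τ) 0 ≠ 0 := by
  obtain ⟨C, hC, h⟩ := exists_thetaSeries_eq_thetaProd τ
  rw [funext h, ((hasDerivAt_thetaProd_zero τ).const_mul C).deriv]
  exact mul_ne_zero hC (evenProd_zero_ne_zero τ)

lemma theta_eq_thetaProd (τ : ℍ) (z : ℂ) : theta τ z = thetaProd τ z / evenProd τ 0 := by
  obtain ⟨C, hC, h⟩ := exists_thetaSeries_eq_thetaProd τ
  rw [theta, funext h, ((hasDerivAt_thetaProd_zero τ).const_mul C).deriv,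
    mul_div_mul_left _ _ hC]

lemma hasDerivAt_theta_zero (τ : ℍ) : HasDerivAt (theta τ) 1 0 := by
  have := (differentiable_thetaSeries τ 0).hasDerivAt.div_const (deriv (thetaSeries τ) 0)
  rwa [div_self (deriv_thetaSeries_ne_zero τ)] at this

lemma theta_ne_zero {τ : ℍ} {z : ℂ} (hz : z ∉ periodLattice τ) : theta τ z ≠ 0 := by
  rw [theta_eq_thetaProd]
  exact div_ne_zero (thetaProd_ne_zero hz) (evenProd_zero_ne_zero τ)

/-! ### The regular part of the logarithmic derivative of the theta function -/

/-- The entire function `θ(z) / z`. -/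
def thetaReg (τ : ℍ) : ℂ → ℂ := dslope (theta τ) 0

lemma thetaReg_zero (τ : ℍ) : thetaReg τ 0 = 1 := by
  rw [thetaReg, dslope_same, (hasDerivAt_theta_zero τ).deriv]

lemma thetaReg_of_ne {τ : ℍ} {z : ℂ} (hz : z ≠ 0) : thetaReg τ z = theta τ z / z := by
  rw [thetaReg, dslope_of_ne _ hz, slope_def_field, theta_zero, sub_zero, sub_zero]

lemma theta_eq_mul_thetaReg (τ : ℍ) (z : ℂ) : theta τ z = z * thetaReg τ z := by
  rcases eq_or_ne z 0 with rfl | hz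
  · rw [theta_zero, zero_mul]
  · rw [thetaReg_of_ne hz, mul_div_cancel₀ _ hz]

lemma differentiable_thetaReg (τ : ℍ) : Differentiable ℂ (thetaReg τ) := by
  rw [← differentiableOn_univ, thetaReg, Complex.differentiableOn_dslope univ_mem,
    differentiableOn_univ]
  exact differentiable_theta τ

lemma thetaReg_neg (τ : ℍ) (z : ℂ) : thetaReg τ (-z) = thetaReg τ z := by
  rcases eq_or_ne z 0 with rfl | hz
  · rw [neg_zero]
  · rw [thetaReg_of_ne hz, thetaReg_of_ne (neg_ne_zero.2 hz), theta_neg, neg_div_neg_eq]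

lemma thetaReg_ne_zero {τ : ℍ} {z : ℂ} (hz : z ∉ periodLattice τ) : thetaReg τ z ≠ 0 := fun h =>
  theta_ne_zero hz (by rw [theta_eq_mul_thetaReg, h, mul_zero])

/-- `1 / z - θ'(z) / θ(z)`, extended to `z = 0`. -/
def psi (τ : ℍ) (z : ℂ) : ℂ := -logDeriv (thetaReg τ) z

lemma analyticAt_psi (τ : ℍ) : AnalyticAt ℂ (psi τ) 0 := by
  have h : AnalyticAt ℂ (thetaReg τ) 0 := (differentiable_thetaReg τ).analyticAt 0
  exact (h.deriv.div h (by rw [thetaReg_zero]; exact one_ne_zero)).neg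

lemma logDeriv_theta {τ : ℍ} {z : ℂ} (hz : z ∉ periodLattice τ) :
    logDeriv (theta τ) z = 1 / z - psi τ z := by
  have hz0 : z ≠ 0 := fun h => hz (h ▸ zero_mem_periodLattice τ)
  rw [funext (theta_eq_mul_thetaReg τ), logDeriv_mul z hz0 (thetaReg_ne_zero hz) (by fun_prop)
    (differentiable_thetaReg τ z), psi]
  simp [logDeriv_apply]

lemma analyticAt_logDeriv_theta {τ : ℍ} {z : ℂ} (hz : z ∉ periodLattice τ) :
    AnalyticAt ℂ (logDeriv (theta τ)) z := by
  have h : AnalyticAt ℂ (theta τ) z := (differentiable_theta τ).analyticAt z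
  exact h.deriv.div h (theta_ne_zero hz)

lemma psi_neg (τ : ℍ) (z : ℂ) : psi τ (-z) = -psi τ z := by
  have : deriv (thetaReg τ) z = -deriv (thetaReg τ) (-z) := by
    have := deriv_comp_neg (f := thetaReg τ) (x := z)
    rw [← this]
    exact congrArg (fun f => deriv f z) (funext fun w => (thetaReg_neg τ w).symm)
  rw [psi, psi, logDeriv_apply, logDeriv_apply, this, thetaReg_neg]
  ring

lemma iteratedDeriv_psi_zero_of_even {τ : ℍ} {m : ℕ} (hm : Even m) :
    iteratedDeriv m (psi τ) 0 = 0 := by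
  have h := iteratedDeriv_comp_neg m (psi τ) 0
  rw [funext (psi_neg τ), hm.neg_one_pow, one_smul, neg_zero] at h
  have h2 : iteratedDeriv m (fun z => -psi τ z) 0 = -iteratedDeriv m (psi τ) 0 := by
    exact iteratedDeriv_fun_neg m (psi τ) 0
  rw [h2] at h
  linear_combination -h / 2

lemma logDeriv_theta_add_two_pi_I (τ : ℍ) (z : ℂ) :
    logDeriv (theta τ) (z + 2 * π * I) = logDeriv (theta τ) z := by
  have := deriv_comp_add_const (theta τ) (2 * π * I) z
  rw [logDeriv_apply, ← this, funext (theta_add_two_pi_I τ), theta_add_two_pi_I, deriv.fun_neg,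
    neg_div_neg_eq, logDeriv_apply]

lemma logDeriv_theta_add_tau {τ : ℍ} {z : ℂ} (hz : z ∉ periodLattice τ) :
    logDeriv (theta τ) (z + 2 * π * I * τ) = logDeriv (theta τ) z - 1 := by
  have := deriv_comp_add_const (theta τ) (2 * π * I * τ) z
  have h1 : HasDerivAt (fun z : ℂ => -cexp (-π * I * τ - z)) (cexp (-π * I * τ - z)) z := by
    have := ((hasDerivAt_id z).const_sub (-π * I * τ : ℂ)).cexp.neg
    convert! this using 1
    simp
  have hne := theta_ne_zero hz
  have he := Complex.exp_ne_zero (-π * I * τ - z)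
  rw [logDeriv_apply, ← this, funext (theta_add_tau τ), theta_add_tau,
    (h1.fun_mul (differentiable_theta τ z).hasDerivAt).deriv, logDeriv_apply]
  field_simp
  ring

open PeriodPair in
lemma exists_deriv_psi_eventuallyEq (τ : ℍ) :
    ∃ C, deriv (psi τ) =ᶠ[𝓝 0] fun z => weierstrassPExcept (periods τ) 0 z + C := by
  set L := periods τ with hL
  have hmem : ∀ {z}, z ∉ periodLattice τ → z ∈ ((L.lattice : Set ℂ))ᶜ := fun hz => by
    rw [hL, coe_lattice_periods]; exact hz
  have hopen : IsOpen ((L.lattice : Set ℂ))ᶜ := L.isClosed_lattice.isOpen_compl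
  have hnear : ∀ᶠ z in 𝓝[≠] (0 : ℂ), deriv (logDeriv (theta τ)) z = -1 / z ^ 2 - deriv (psi τ) z := by
    have h1 := (analyticAt_psi τ).eventually_analyticAt.filter_mono
      (nhdsWithin_le_nhds (s := ({0}ᶜ : Set ℂ)))
    filter_upwards [h1, eventually_notMem_periodLattice τ 0, self_mem_nhdsWithin] with z hz1 hz2 hz3
    have he : logDeriv (theta τ) =ᶠ[𝓝 z] fun w => w⁻¹ - psi τ w := by
      filter_upwards [(isOpen_compl_periodLattice τ).mem_nhds hz2] with w hw
      rw [logDeriv_theta hw, one_div]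
    rw [he.deriv_eq, ((hasDerivAt_inv hz3).fun_sub hz1.differentiableAt.hasDerivAt).deriv]
    ring
  have hP : ∀ z : ℂ, weierstrassP L z = weierstrassPExcept L 0 z + 1 / z ^ 2 := fun z => by
    have := L.weierstrassPExcept_add 0 z
    rw [← this]
    simp
  obtain ⟨C, hC⟩ := exists_eq_const_of_norm_periodic (τ := τ)
    (g := fun z => deriv (logDeriv (theta τ)) z + weierstrassP L z)
    (fun z hz => ((analyticAt_logDeriv_theta hz).deriv.differentiableAt).add
      (L.differentiableOn_weierstrassP.differentiableAt (hopen.mem_nhds (hmem hz))))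
    (fun z hz => by
      have h1 := L.weierstrassP_add_coe z ⟨L.ω₁, L.ω₁_mem_lattice⟩
      have h2 := deriv_comp_add_const (logDeriv (theta τ)) (2 * π * I) z
      rw [funext (logDeriv_theta_add_two_pi_I τ)] at h2
      rw [← h2]
      congr 2)
    (fun z hz => by
      have h1 := L.weierstrassP_add_coe z ⟨L.ω₂, L.ω₂_mem_lattice⟩
      have h2 := deriv_comp_add_const (logDeriv (theta τ)) (2 * π * I * τ) z
      have h3 : (fun w => logDeriv (theta τ) (w + 2 * π * I * τ)) =ᶠ[𝓝 z]
          fun w => logDeriv (theta τ) w - 1 := by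
        filter_upwards [(isOpen_compl_periodLattice τ).mem_nhds hz] with w hw
        exact logDeriv_theta_add_tau hw
      rw [h3.deriv_eq, deriv_sub_const] at h2
      rw [← h2]
      congr 2)
    (by
      have h1 : Tendsto (fun z => z * (weierstrassPExcept L 0 z - deriv (psi τ) z)) (𝓝[≠] 0)
          (𝓝 (0 * (weierstrassPExcept L 0 0 - deriv (psi τ) 0))) := by
        have : ContinuousAt (fun z => z * (weierstrassPExcept L 0 z - deriv (psi τ) z)) 0 :=
          continuousAt_id.mul ((L.analyticAt_weierstrassPExcept 0).continuousAt.sub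
            (analyticAt_psi τ).deriv.continuousAt)
        exact this.tendsto.mono_left nhdsWithin_le_nhds
      rw [zero_mul] at h1
      refine h1.congr' ?_
      filter_upwards [hnear] with z hz
      rw [hz, hP]
      ring)
  refine ⟨-C, ?_⟩
  have ha : AnalyticAt ℂ (fun z => weierstrassPExcept L 0 z + -C) 0 :=
    (L.analyticAt_weierstrassPExcept 0).add analyticAt_const
  refine ((analyticAt_psi τ).deriv.frequently_eq_iff_eventually_eq ha).1 (Eventually.frequently ?_)
  filter_upwards [hnear, eventually_notMem_periodLattice τ 0] with z hz hz2
  have := hC z hz2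
  rw [hz, hP] at this
  linear_combination -this

lemma tsum_tsum_inv_pow {τ : ℍ} {m : ℕ} (hm : 2 < m) :
    (∑' d : ℤ, ∑' c : ℤ, if c = 0 ∧ d = 0 then (0 : ℂ) else
      1 / (2 * π * I * c + 2 * π * I * τ * d) ^ m) = (periods τ).G m := by
  set L := periods τ
  have h := L.hasSum_sumInvPow 0 hm
  rw [L.sumInvPow_zero] at h
  rw [← (L.latticeEquivProd.symm.toEquiv).hasSum_iff, ← (Equiv.prodComm ℤ ℤ).hasSum_iff] at h
  rw [← h.tsum_eq, h.summable.tsum_prod]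
  refine tsum_congr fun d => tsum_congr fun c => ?_
  simp only [Function.comp_apply, Equiv.prodComm_apply, Prod.swap_prod_mk,
    LinearEquiv.coe_toEquiv, L.latticeEquiv_symm_apply, sub_zero]
  have e : (c : ℂ) * L.ω₁ + d * L.ω₂ = 2 * π * I * c + 2 * π * I * τ * d := by
    simp only [L, periods]; ring
  rw [e]
  split_ifs with h0
  · simp [h0, show m ≠ 0 by omega]
  · rw [one_div]

lemma iteratedDeriv_psi_zero_of_two_lt {τ : ℍ} {m : ℕ} (hm : 2 < m) :
    iteratedDeriv (m - 1) (psi τ) 0 = 2 * eisG m τ := by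
  rcases Nat.even_or_odd m with he | ho
  · obtain ⟨C, hC⟩ := exists_deriv_psi_eventuallyEq τ
    obtain ⟨k, rfl⟩ : ∃ k, m = k + 2 := ⟨m - 2, by omega⟩
    have hk : k ≠ 0 := by omega
    rw [show k + 2 - 1 = k + 1 by omega, iteratedDeriv_succ', hC.iteratedDeriv_eq,
      iteratedDeriv_fun_add (n := k)]
    · rw [(periods τ).iteratedDeriv_weierstrassPExcept_self, if_neg hk, iteratedDeriv_const, if_neg hk,
        eisG, if_pos he, tsum_tsum_inv_pow hm, (periods τ).sumInvPow_zero,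
        show k + 2 - 1 = k + 1 by omega]
      ring
    · exact ((periods τ).analyticAt_weierstrassPExcept 0).contDiffAt
    · exact contDiffAt_const
  · rw [iteratedDeriv_psi_zero_of_even, eisG, if_neg (Nat.not_even_iff_odd.2 ho), mul_zero]
    exact Nat.Odd.sub_odd ho odd_one

/-! ### The weight two Eisenstein series -/

/-- `2 sinh (z / 2) / z`. -/
def sinhReg : ℂ → ℂ := dslope (fun z => cexp (z / 2) - cexp (-z / 2)) 0

lemma hasDerivAt_sinh (z : ℂ) : HasDerivAt (fun z : ℂ => cexp (z / 2) - cexp (-z / 2))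
    ((cexp (z / 2) + cexp (-z / 2)) / 2) z := by
  have := (((hasDerivAt_id z).div_const 2).cexp).sub
    (((hasDerivAt_id z).neg.div_const 2).cexp)
  convert! this using 1
  simp
  ring

lemma hasDerivAt_cosh (z : ℂ) : HasDerivAt (fun z : ℂ => (cexp (z / 2) + cexp (-z / 2)) / 2)
    ((cexp (z / 2) - cexp (-z / 2)) / 4) z := by
  have := ((((hasDerivAt_id z).div_const 2).cexp).add
    (((hasDerivAt_id z).neg.div_const 2).cexp)).div_const 2
  convert! this using 1
  simp
  ring

lemma differentiable_sinhReg : Differentiable ℂ sinhReg := by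
  rw [← differentiableOn_univ, sinhReg, Complex.differentiableOn_dslope univ_mem,
    differentiableOn_univ]
  fun_prop

lemma sinhReg_zero : sinhReg 0 = 1 := by
  rw [sinhReg, dslope_same, (hasDerivAt_sinh 0).deriv]
  simp

lemma sinhReg_of_ne {z : ℂ} (hz : z ≠ 0) :
    sinhReg z = (cexp (z / 2) - cexp (-z / 2)) / z := by
  rw [sinhReg, dslope_of_ne _ hz, slope_def_field]
  simp

lemma mul_sinhReg (z : ℂ) : z * sinhReg z = cexp (z / 2) - cexp (-z / 2) := by
  rcases eq_or_ne z 0 with rfl | hz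
  · simp
  · rw [sinhReg_of_ne hz, mul_div_cancel₀ _ hz]

lemma deriv_logDeriv_sinhReg_zero : deriv (logDeriv sinhReg) 0 = 1 / 12 := by
  have d0 := differentiable_sinhReg
  have d1 : Differentiable ℂ (deriv sinhReg) := fun z => (d0.analyticAt z).deriv.differentiableAt
  have d2 : Differentiable ℂ (deriv (deriv sinhReg)) := fun z =>
    (d1.analyticAt z).deriv.differentiableAt
  have e1 : ∀ z, sinhReg z + z * deriv sinhReg z = (cexp (z / 2) + cexp (-z / 2)) / 2 := fun z => by
    have := (hasDerivAt_id' z).fun_mul (d0 z).hasDerivAt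
    rw [funext mul_sinhReg] at this
    rw [← this.unique (hasDerivAt_sinh z)]
    ring
  have e2 : ∀ z, 2 * deriv sinhReg z + z * deriv (deriv sinhReg) z =
      (cexp (z / 2) - cexp (-z / 2)) / 4 := fun z => by
    have := (d0 z).hasDerivAt.fun_add ((hasDerivAt_id' z).fun_mul (d1 z).hasDerivAt)
    rw [funext e1] at this
    rw [← this.unique (hasDerivAt_cosh z)]
    ring
  have e3 : 3 * deriv (deriv sinhReg) 0 = 1 / 4 := by
    have := ((d1 0).hasDerivAt.const_mul (2 : ℂ)).fun_add
      ((hasDerivAt_id' (0 : ℂ)).fun_mul (d2 0).hasDerivAt)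
    rw [funext e2] at this
    have h := this.unique ((hasDerivAt_sinh 0).div_const 4)
    simp at h
    linear_combination h
  have e4 : deriv sinhReg 0 = 0 := by simpa using e2 0
  have := (d1 0).hasDerivAt.div (d0 0).hasDerivAt (by rw [sinhReg_zero]; exact one_ne_zero)
  have h2 : deriv (logDeriv sinhReg) 0 = _ := this.deriv
  rw [h2, sinhReg_zero, e4]
  linear_combination e3 / 3

lemma thetaReg_eq (τ : ℍ) (z : ℂ) :
    thetaReg τ z = sinhReg z * (evenProd τ z * (evenProd τ 0)⁻¹) := by
  rcases eq_or_ne z 0 with rfl | hz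
  · rw [thetaReg_zero, sinhReg_zero, mul_inv_cancel₀ (evenProd_zero_ne_zero τ), one_mul]
  · rw [thetaReg_of_ne hz, sinhReg_of_ne hz, theta_eq_thetaProd, thetaProd]
    ring

/-- The Lambert series `∑_{n ≥ 1} q^n / (1 - q^n)²`. -/
def lambertSum (τ : ℍ) : ℂ := ∑' n : ℕ, nome τ ^ (n + 1) / (1 - nome τ ^ (n + 1)) ^ 2

lemma norm_nome_pow_mul_exp_le {τ : ℍ} {w : ℂ} (hw : w.re < imPeriod τ / 2) (n : ℕ) :
    ‖nome τ ^ (n + 1) * cexp w‖ ≤ ‖nome τ‖ ^ n * rexp (-(imPeriod τ / 2)) := by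
  rw [norm_mul, norm_pow, pow_succ, mul_assoc]
  refine mul_le_mul_of_nonneg_left ?_ (by positivity)
  rw [norm_nome, Complex.norm_exp, ← Real.exp_add]
  exact Real.exp_le_exp.2 (by linarith)

lemma norm_nome_pow_mul_exp_lt_one {τ : ℍ} {w : ℂ} (hw : w.re < imPeriod τ / 2) (n : ℕ) :
    ‖nome τ ^ (n + 1) * cexp w‖ ≤ rexp (-(imPeriod τ / 2)) := by
  refine (norm_nome_pow_mul_exp_le hw n).trans ?_
  exact mul_le_of_le_one_left (Real.exp_pos _).le
    (pow_le_one₀ (norm_nonneg _) (norm_nome_lt_one τ).le)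

lemma one_sub_le_norm_one_sub_nome {τ : ℍ} {w : ℂ} (hw : w.re < imPeriod τ / 2) (n : ℕ) :
    1 - rexp (-(imPeriod τ / 2)) ≤ ‖1 + -(nome τ ^ (n + 1) * cexp w)‖ := by
  have h1 := norm_nome_pow_mul_exp_lt_one hw n
  have h2 := norm_sub_norm_le (1 : ℂ) (nome τ ^ (n + 1) * cexp w)
  rw [norm_one] at h2
  rw [← sub_eq_add_neg]
  linarith

lemma one_sub_exp_pos (τ : ℍ) : 0 < 1 - rexp (-(imPeriod τ / 2)) := by
  rw [sub_pos, Real.exp_lt_one_iff]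
  linarith [imPeriod_pos τ]

lemma hasDerivAt_nome_factor (τ : ℍ) (n : ℕ) (w : ℂ) :
    HasDerivAt (fun w => 1 + -(nome τ ^ (n + 1) * cexp w)) (-(nome τ ^ (n + 1) * cexp w)) w :=
  (((Complex.hasDerivAt_exp w).const_mul (nome τ ^ (n + 1))).neg).const_add 1

lemma logDeriv_nome_factor (τ : ℍ) (n : ℕ) (w : ℂ) :
    logDeriv (fun w => 1 + -(nome τ ^ (n + 1) * cexp w)) w =
      -(nome τ ^ (n + 1) * cexp w) / (1 + -(nome τ ^ (n + 1) * cexp w)) := by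
  rw [logDeriv_apply, (hasDerivAt_nome_factor τ n w).deriv]

lemma norm_logDeriv_nome_factor_le {τ : ℍ} {w : ℂ} (hw : w.re < imPeriod τ / 2) (n : ℕ) :
    ‖-(nome τ ^ (n + 1) * cexp w) / (1 + -(nome τ ^ (n + 1) * cexp w))‖ ≤
      ‖nome τ‖ ^ n * rexp (-(imPeriod τ / 2)) / (1 - rexp (-(imPeriod τ / 2))) := by
  rw [norm_div, norm_neg]
  exact div_le_div₀ (by positivity) (norm_nome_pow_mul_exp_le hw n) (one_sub_exp_pos τ)
    (one_sub_le_norm_one_sub_nome hw n)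

lemma summable_logDeriv_bound (τ : ℍ) : Summable fun n : ℕ =>
    ‖nome τ‖ ^ n * rexp (-(imPeriod τ / 2)) / (1 - rexp (-(imPeriod τ / 2))) :=
  ((summable_geometric_of_lt_one (norm_nonneg _) (norm_nome_lt_one τ)).mul_right _).div_const _

lemma isOpen_re_lt_half (τ : ℍ) : IsOpen {w : ℂ | w.re < imPeriod τ / 2} :=
  isOpen_lt Complex.continuous_re continuous_const

lemma nome_factor_ne_zero {τ : ℍ} {w : ℂ} (hw : w.re < imPeriod τ / 2) (n : ℕ) :
    1 + -(nome τ ^ (n + 1) * cexp w) ≠ 0 := fun h => by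
  have := one_sub_le_norm_one_sub_nome hw n
  rw [h, norm_zero] at this
  linarith [one_sub_exp_pos τ]

lemma nomeProd_exp_ne_zero_of_re {τ : ℍ} {w : ℂ} (hw : w.re < imPeriod τ / 2) :
    nomeProd τ (cexp w) ≠ 0 :=
  nomeProd_ne_zero fun n h => nome_factor_ne_zero hw n (by rw [h]; ring)

lemma logDeriv_nomeProd_exp {τ : ℍ} {w : ℂ} (hw : w.re < imPeriod τ / 2) :
    logDeriv (fun w => nomeProd τ (cexp w)) w =
      ∑' n : ℕ, -(nome τ ^ (n + 1) * cexp w) / (1 + -(nome τ ^ (n + 1) * cexp w)) := by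
  have hm : MultipliableLocallyUniformlyOn
      (fun (n : ℕ) (w : ℂ) => 1 + -(nome τ ^ (n + 1) * cexp w)) {w : ℂ | w.re < imPeriod τ / 2} :=
    (hasProdLocallyUniformlyOn_nomeProd τ).multipliableLocallyUniformlyOn.comp cexp
      (fun _ _ => mem_univ _) Complex.continuous_exp.continuousOn
  have := logDeriv_tprod_eq_tsum (isOpen_re_lt_half τ) hw (fun n => nome_factor_ne_zero hw n)
    (fun n => by fun_prop)
    (by
      simp only [logDeriv_nome_factor]
      exact .of_norm_bounded (summable_logDeriv_bound τ) fun n => norm_logDeriv_nome_factor_le hw n)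
    hm (nomeProd_exp_ne_zero_of_re hw)
  simp only [logDeriv_nome_factor] at this
  exact this

lemma differentiableAt_logDeriv_nomeProd_exp (τ : ℍ) :
    DifferentiableAt ℂ (logDeriv (fun w => nomeProd τ (cexp w))) 0 := by
  have hd : Differentiable ℂ fun w => nomeProd τ (cexp w) := by
    have := differentiable_nomeProd τ
    fun_prop
  have h : AnalyticAt ℂ (fun w => nomeProd τ (cexp w)) 0 := hd.analyticAt 0
  refine (h.deriv.div h (nomeProd_exp_ne_zero_of_re ?_)).differentiableAt
  rw [Complex.zero_re]
  exact half_pos (imPeriod_pos τ)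

lemma deriv_nome_factor_zero {τ : ℍ} (n : ℕ) :
    deriv (fun w => -(nome τ ^ (n + 1) * cexp w) / (1 + -(nome τ ^ (n + 1) * cexp w))) 0 =
      -(nome τ ^ (n + 1) / (1 - nome τ ^ (n + 1)) ^ 2) := by
  have h0 : (0 : ℂ).re < imPeriod τ / 2 := half_pos (imPeriod_pos τ)
  have hne := nome_factor_ne_zero h0 n
  have h1 : HasDerivAt (fun w => -(nome τ ^ (n + 1) * cexp w)) (-(nome τ ^ (n + 1) * cexp 0)) 0 :=
    ((Complex.hasDerivAt_exp 0).const_mul (nome τ ^ (n + 1))).fun_neg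
  have h2 := h1.fun_div (hasDerivAt_nome_factor τ n 0) hne
  rw [h2.deriv]
  generalize nome τ ^ (n + 1) = x at hne ⊢
  simp only [Complex.exp_zero, mul_one] at hne ⊢
  rw [← sub_eq_add_neg] at hne ⊢
  field_simp
  ring

lemma hasSum_deriv_nome_factor (τ : ℍ) :
    HasSum (fun n : ℕ => -(nome τ ^ (n + 1) / (1 - nome τ ^ (n + 1)) ^ 2))
      (deriv (fun w => ∑' n : ℕ, -(nome τ ^ (n + 1) * cexp w) / (1 + -(nome τ ^ (n + 1) * cexp w)))
        0) := by
  have h0 : (0 : ℂ).re < imPeriod τ / 2 := half_pos (imPeriod_pos τ)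
  simp only [← deriv_nome_factor_zero]
  refine Complex.hasSum_deriv_of_summable_norm (summable_logDeriv_bound τ)
    (fun n w hw => ?_) (isOpen_re_lt_half τ) (fun n w hw => ?_) h0
  · have h := hasDerivAt_nome_factor τ n w
    have h2 : DifferentiableAt ℂ (fun w => -(nome τ ^ (n + 1) * cexp w)) w := by fun_prop
    exact (h2.fun_div h.differentiableAt (nome_factor_ne_zero hw n)).differentiableWithinAt
  · exact norm_logDeriv_nome_factor_le hw n

lemma deriv_logDeriv_nomeProd_exp (τ : ℍ) :
    deriv (logDeriv (fun w => nomeProd τ (cexp w))) 0 = -lambertSum τ := by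
  have h0 : (0 : ℂ) ∈ {w : ℂ | w.re < imPeriod τ / 2} := half_pos (imPeriod_pos τ)
  have he : logDeriv (fun w => nomeProd τ (cexp w)) =ᶠ[𝓝 0]
      fun w => ∑' n : ℕ, -(nome τ ^ (n + 1) * cexp w) / (1 + -(nome τ ^ (n + 1) * cexp w)) :=
    Filter.mem_of_superset ((isOpen_re_lt_half τ).mem_nhds h0) fun w hw => logDeriv_nomeProd_exp hw
  rw [he.deriv_eq, ← (hasSum_deriv_nome_factor τ).tsum_eq, lambertSum, tsum_neg]

lemma deriv_psi_zero (τ : ℍ) : deriv (psi τ) 0 = -1 / 12 + 2 * lambertSum τ := by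
  set ℓ := logDeriv (fun w => nomeProd τ (cexp w)) with hℓ
  have hT := imPeriod_pos τ
  have hd : Differentiable ℂ fun w => nomeProd τ (cexp w) := by
    have := differentiable_nomeProd τ
    fun_prop
  have hd' : Differentiable ℂ fun w => nomeProd τ (cexp (-w)) := by
    have := differentiable_nomeProd τ
    fun_prop
  have h1 : ∀ᶠ w in 𝓝 (0 : ℂ), w.re < imPeriod τ / 2 :=
    (isOpen_re_lt_half τ).mem_nhds (by simp [hT])
  have h2 : ∀ᶠ w in 𝓝 (0 : ℂ), (-w).re < imPeriod τ / 2 := by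
    have : Tendsto (fun w : ℂ => -w) (𝓝 0) (𝓝 0) := by
      simpa using (continuous_neg (G := ℂ)).tendsto 0
    exact this.eventually h1
  have h3 : ∀ᶠ w in 𝓝 (0 : ℂ), sinhReg w ≠ 0 :=
    differentiable_sinhReg.continuous.continuousAt.eventually_ne (by simp [sinhReg_zero])
  have he : psi τ =ᶠ[𝓝 0] fun w => -(logDeriv sinhReg w + (ℓ w - ℓ (-w))) := by
    filter_upwards [h1, h2, h3] with w hw1 hw2 hw3
    have n1 := nomeProd_exp_ne_zero_of_re hw1
    have n2 := nomeProd_exp_ne_zero_of_re hw2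
    have hE : evenProd τ w ≠ 0 := mul_ne_zero n1 n2
    have hi := inv_ne_zero (evenProd_zero_ne_zero τ)
    rw [psi, funext (thetaReg_eq τ), logDeriv_mul (f := sinhReg) (g := fun w => evenProd τ w * (evenProd τ 0)⁻¹) w hw3
      (mul_ne_zero hE hi)
      (differentiable_sinhReg w) ((differentiable_evenProd τ w).mul_const _),
      logDeriv_mul_const w _ hi]
    have e1 : logDeriv (evenProd τ) w = ℓ w + logDeriv (fun w => nomeProd τ (cexp (-w))) w :=
      logDeriv_mul (f := fun w => nomeProd τ (cexp w)) (g := fun w => nomeProd τ (cexp (-w))) w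
        n1 n2 (hd w) (hd' w)
    have e2 : logDeriv (fun w => nomeProd τ (cexp (-w))) w = -ℓ (-w) := by
      rw [logDeriv_apply, deriv_comp_neg (f := fun w => nomeProd τ (cexp w)), hℓ, logDeriv_apply,
        neg_div]
    rw [e1, e2]
    ring
  have a1 := differentiableAt_logDeriv_nomeProd_exp τ
  have a2 : HasDerivAt (fun w => ℓ (-w)) (-deriv ℓ 0) 0 := by
    have h : HasDerivAt ℓ (deriv ℓ 0) (-(0 : ℂ)) := by
      rw [neg_zero]; exact a1.hasDerivAt
    have := h.scomp (0 : ℂ) (hasDerivAt_neg (0 : ℂ))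
    simpa [Function.comp_def] using this
  have a3 : DifferentiableAt ℂ (logDeriv sinhReg) 0 := by
    have h : AnalyticAt ℂ sinhReg 0 := differentiable_sinhReg.analyticAt 0
    exact (h.deriv.div h (by simp [sinhReg_zero])).differentiableAt
  rw [he.deriv_eq, (a3.hasDerivAt.fun_add (a1.hasDerivAt.fun_sub a2)).fun_neg.deriv,
    deriv_logDeriv_sinhReg_zero, deriv_logDeriv_nomeProd_exp]
  ring

/-- The inner sum of the Eisenstein series of weight two. -/
def eisInner (τ : ℍ) (d : ℤ) : ℂ := ∑' c : ℤ, if c = 0 ∧ d = 0 then (0 : ℂ) else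
  1 / (2 * π * I * c + 2 * π * I * τ * d) ^ 2

lemma eisInner_neg (τ : ℍ) (d : ℤ) : eisInner τ (-d) = eisInner τ d := by
  rw [eisInner, ← (Equiv.neg ℤ).tsum_eq, eisInner]
  refine tsum_congr fun c => ?_
  simp only [Equiv.neg_apply, neg_eq_zero]
  split_ifs
  · rfl
  · push_cast
    congr 1
    ring

lemma eisInner_zero (τ : ℍ) : eisInner τ 0 = -1 / 12 := by
  have h := two_mul_riemannZeta_eq_tsum_int_inv_pow_of_even (k := 2) (by norm_num) (by norm_num)
  rw [Nat.cast_ofNat, riemannZeta_two] at h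
  have hpi : (π : ℂ) ≠ 0 := by exact_mod_cast Real.pi_ne_zero
  have : eisInner τ 0 = (2 * π * I)⁻¹ ^ 2 * ∑' n : ℤ, ((n : ℂ) ^ 2)⁻¹ := by
    rw [eisInner, ← tsum_mul_left]
    refine tsum_congr fun c => ?_
    split_ifs with hc
    · simp [hc.1]
    · simp [mul_pow]
      ring
  rw [this, ← h]
  field_simp
  rw [I_sq]
  norm_num

lemma eisInner_pos (τ : ℍ) (n : ℕ) :
    eisInner τ ((n + 1 : ℕ) : ℤ) = nome τ ^ (n + 1) / (1 - nome τ ^ (n + 1)) ^ 2 := by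
  have hpi : (π : ℂ) ≠ 0 := by exact_mod_cast Real.pi_ne_zero
  have him : 0 < (((n + 1 : ℕ) : ℂ) * τ).im := by
    rw [← Complex.ofReal_natCast, Complex.im_ofReal_mul]
    exact mul_pos (by positivity) τ.im_pos
  have h := EisensteinSeries.qExpansion_identity (k := 1) le_rfl ⟨((n + 1 : ℕ) : ℂ) * τ, him⟩
  have hq : cexp (2 * π * I * (((n + 1 : ℕ) : ℂ) * τ)) = nome τ ^ (n + 1) := by
    rw [nome, ← Complex.exp_nat_mul]; congr 1; ring
  simp only [hq, pow_one] at h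
  rw [tsum_coe_mul_geometric_of_norm_lt_one] at h
  · have : eisInner τ ((n + 1 : ℕ) : ℤ) = (2 * π * I)⁻¹ ^ 2 *
        ∑' c : ℤ, 1 / ((((n + 1 : ℕ) : ℂ) * τ) + c) ^ 2 := by
      rw [eisInner, ← tsum_mul_left]
      refine tsum_congr fun c => ?_
      rw [if_neg (fun h => by have := h.2; omega)]
      rw [one_div, one_div, inv_pow, ← mul_inv, ← mul_pow]
      push_cast
      congr 1
      ring
    rw [this]
    have e := h
    simp only [Nat.reduceAdd] at e
    erw [e]
    simp
    field_simp
    rw [I_pow_four, one_mul]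
  · rw [norm_pow]
    exact pow_lt_one₀ (norm_nonneg _) (norm_nome_lt_one τ) n.succ_ne_zero

lemma summable_lambert (τ : ℍ) :
    Summable fun n : ℕ => nome τ ^ (n + 1) / (1 - nome τ ^ (n + 1)) ^ 2 := by
  have hT := imPeriod_pos τ
  have h0 : (0 : ℂ).re < imPeriod τ / 2 := by simp [hT]
  refine .of_norm_bounded ((summable_logDeriv_bound τ).div_const (1 - rexp (-(imPeriod τ / 2))))
    fun n => ?_
  have h1 := norm_nome_pow_mul_exp_le h0 n
  have h2 := one_sub_le_norm_one_sub_nome h0 n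
  rw [Complex.exp_zero, mul_one] at h1 h2
  rw [← sub_eq_add_neg] at h2
  have := one_sub_exp_pos τ
  rw [norm_div, norm_pow (1 - _), div_div, ← sq]
  exact div_le_div₀ (by positivity) h1 (by positivity) (pow_le_pow_left₀ this.le h2 2)

lemma two_mul_eisG_two (τ : ℍ) : 2 * eisG 2 τ = -1 / 12 + 2 * lambertSum τ := by
  have h : 2 * eisG 2 τ = ∑' d : ℤ, eisInner τ d := by
    rw [eisG, if_pos even_two]
    simp [eisInner]
  have hp : HasSum (fun n : ℕ => eisInner τ ((n + 1 : ℕ) : ℤ)) (lambertSum τ) := by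
    simp only [eisInner_pos]
    exact (summable_lambert τ).hasSum
  have hn : HasSum (fun n : ℕ => eisInner τ (-((n : ℤ) + 1))) (lambertSum τ) := by
    refine (hasSum_iff_of_eq fun n => ?_).1 hp
    rw [eisInner_neg]; push_cast; rfl
  have hnat : HasSum (fun n : ℕ => eisInner τ (n : ℤ)) (lambertSum τ + -1 / 12) := by
    rw [← eisInner_zero τ]
    have := (hasSum_nat_add_iff (f := fun n : ℕ => eisInner τ (n : ℤ)) 1).1 hp
    simpa using this
  rw [h, (hnat.of_nat_of_neg_add_one hn).tsum_eq]
  ring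

/-- The Taylor coefficients of `1 / z - θ'(z) / θ(z)` at `0`. -/
lemma iteratedDeriv_psi_zero (τ : ℍ) (m : ℕ) :
    iteratedDeriv m (psi τ) 0 = 2 * eisG (m + 1) τ := by
  rcases lt_or_ge 1 m with hm | hm
  · exact iteratedDeriv_psi_zero_of_two_lt (m := m + 1) (by omega)
  · interval_cases m
    · rw [iteratedDeriv_psi_zero_of_even (by simp), eisG, if_neg (by simp), mul_zero]
    · rw [iteratedDeriv_one, deriv_psi_zero, two_mul_eisG_two]

/-! ### The Kronecker function and its Fourier development -/

/-- The Kronecker function `θ(x + e) / (θ(x) θ(e))`. -/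
def kronecker (τ : ℍ) (e x : ℂ) : ℂ := theta τ (x + e) / (theta τ x * theta τ e)

/-- The Fourier coefficients of the Kronecker function. -/
def kroneckerCoeff (τ : ℍ) (k : ℤ) (e : ℂ) : ℂ := (1 - cexp (-(e + 2 * π * I * τ * k)))⁻¹

lemma kroneckerCoeff_add_tau (τ : ℍ) (k : ℤ) (e : ℂ) :
    kroneckerCoeff τ k (e + 2 * π * I * τ) = kroneckerCoeff τ (k + 1) e := by
  unfold kroneckerCoeff
  congr 4
  push_cast; ring

lemma kroneckerCoeff_add_two_pi_I (τ : ℍ) (k : ℤ) (e : ℂ) :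
    kroneckerCoeff τ k (e + 2 * π * I) = kroneckerCoeff τ k e := by
  unfold kroneckerCoeff
  rw [show -(e + 2 * π * I + 2 * π * I * τ * k) = -(e + 2 * π * I * τ * k) - 2 * π * I by ring,
    Complex.exp_periodic.sub_eq]

lemma one_sub_exp_ne_zero {τ : ℍ} {e : ℂ} (he : e ∉ periodLattice τ) (k : ℤ) :
    1 - cexp (-(e + 2 * π * I * τ * k)) ≠ 0 := by
  intro h
  have h1 : cexp (-(e + 2 * π * I * τ * k)) = 1 := (sub_eq_zero.mp h).symm
  rw [Complex.exp_eq_one_iff] at h1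
  obtain ⟨n, hn⟩ := h1
  refine he ⟨-n, -k, ?_⟩
  push_cast
  linear_combination -hn

lemma norm_exp_kronecker (τ : ℍ) (k : ℤ) (e : ℂ) :
    ‖cexp (-(e + 2 * π * I * τ * k))‖ = rexp (imPeriod τ * k - e.re) := by
  rw [Complex.norm_exp]
  congr 1
  simp [imPeriod]
  ring

lemma differentiableAt_kroneckerCoeff {τ : ℍ} {k : ℤ} {e : ℂ}
    (he : 1 - cexp (-(e + 2 * π * I * τ * k)) ≠ 0) :
    DifferentiableAt ℂ (kroneckerCoeff τ k) e := by
  unfold kroneckerCoeff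
  exact DifferentiableAt.fun_inv (by fun_prop) he

lemma summable_exp_neg_abs {δ : ℝ} (hδ : 0 < δ) : Summable fun k : ℤ => rexp (-(δ * |(k : ℝ)|)) := by
  have h : Summable fun n : ℕ => rexp (-(δ * |(n : ℝ)|)) := by
    have := (Real.summable_exp_nat_mul_iff (a := -δ)).2 (by linarith)
    refine this.congr fun n => ?_
    congr 1
    rw [abs_of_nonneg (Nat.cast_nonneg n)]; ring
  refine Summable.of_nat_of_neg (by simpa using h) (by simpa using h)

lemma eventually_norm_kronecker_term_le (τ : ℍ) (x : ℂ) (R : ℝ) : ∀ᶠ k : ℤ in cofinite, ∀ e ∈ {e : ℂ | |e.re| < R},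
      ‖kroneckerCoeff τ k e * cexp (k * x)‖ ≤
        2 * rexp R * rexp (-(min x.re (imPeriod τ - x.re) * |(k : ℝ)|)) := by
  have hT := imPeriod_pos τ
  set T := imPeriod τ
  obtain ⟨N, hN⟩ := exists_nat_gt ((R + Real.log 2) / T)
  have hN' : R + Real.log 2 < T * N := by rw [div_lt_iff₀ hT] at hN; linarith
  have hev : ∀ᶠ k : ℤ in cofinite, (N : ℤ) < |k| := by
    rw [Filter.eventually_cofinite]
    refine (Set.finite_Icc (-(N : ℤ)) N).subset fun k hk => ?_
    simp only [mem_ofPred_eq, not_lt] at hk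
    exact ⟨(abs_le.mp hk).1, (abs_le.mp hk).2⟩
  filter_upwards [hev] with k hk e he
  replace he := abs_lt.1 he
  have hR : 0 < R := by linarith [he.1, he.2]
  set Y := cexp (-(e + 2 * π * I * τ * k)) with hY
  have hYn : ‖Y‖ = rexp (T * k - e.re) := norm_exp_kronecker τ k e
  have hkx : ‖cexp (k * x)‖ = rexp (k * x.re) := by rw [Complex.norm_exp]; simp
  have h2 : (2 : ℝ) = rexp (Real.log 2) := (Real.exp_log (by norm_num)).symm
  have hk' : (N : ℝ) < |(k : ℝ)| := by exact_mod_cast hk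
  have hTk : T * N < T * |(k : ℝ)| := by gcongr
  have hnorm : ‖kroneckerCoeff τ k e * cexp (k * x)‖ = ‖1 - Y‖⁻¹ * rexp (k * x.re) := by
    rw [norm_mul, hkx, kroneckerCoeff, norm_inv]
  rw [hnorm]
  rcases le_or_gt 0 (k : ℝ) with hk0 | hk0
  · rw [abs_of_nonneg hk0] at hTk ⊢
    have hY2 : 2 ≤ ‖Y‖ := by
      rw [hYn, h2]; exact Real.exp_le_exp.2 (by linarith)
    have h1Y : ‖Y‖ / 2 ≤ ‖1 - Y‖ := by
      have := norm_sub_norm_le Y 1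
      rw [norm_one, norm_sub_rev] at this
      linarith
    have hY0 : 0 < ‖Y‖ / 2 := by linarith
    calc ‖1 - Y‖⁻¹ * rexp (k * x.re) ≤ (‖Y‖ / 2)⁻¹ * rexp (k * x.re) := by gcongr
      _ = 2 * (rexp (e.re - T * k) * rexp (k * x.re)) := by
          rw [hYn, inv_div, div_eq_mul_inv, ← Real.exp_neg]; ring_nf
      _ ≤ 2 * (rexp R * rexp (-(min x.re (T - x.re) * k))) := by
          rw [← Real.exp_add, ← Real.exp_add]
          refine mul_le_mul_of_nonneg_left (Real.exp_le_exp.2 ?_) (by norm_num)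
          have : min x.re (T - x.re) * k ≤ (T - x.re) * k := by gcongr; exact min_le_right _ _
          nlinarith
      _ = _ := by ring
  · rw [abs_of_neg hk0] at hTk ⊢
    have hY2 : ‖Y‖ ≤ 1 / 2 := by
      rw [hYn, h2, one_div, ← Real.exp_neg]; exact Real.exp_le_exp.2 (by linarith)
    have h1Y : 1 / 2 ≤ ‖1 - Y‖ := by
      have := norm_sub_norm_le 1 Y
      rw [norm_one] at this
      linarith
    calc ‖1 - Y‖⁻¹ * rexp (k * x.re) ≤ (1 / 2)⁻¹ * rexp (k * x.re) := by gcongr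
      _ = 2 * rexp (k * x.re) := by norm_num
      _ ≤ 2 * rexp (R + -(min x.re (T - x.re) * -k)) := by
          refine mul_le_mul_of_nonneg_left (Real.exp_le_exp.2 ?_) (by norm_num)
          have : min x.re (T - x.re) * (-k) ≤ x.re * (-k) := by
            gcongr
            · linarith
            · exact min_le_left _ _
          nlinarith
      _ = _ := by rw [Real.exp_add]; ring

section

variable {τ : ℍ} {x : ℂ}

lemma summable_kronecker_bound (hx0 : 0 < x.re) (hx1 : x.re < imPeriod τ) (R : ℝ) :
    Summable fun k : ℤ =>
      2 * rexp R * rexp (-(min x.re (imPeriod τ - x.re) * |(k : ℝ)|)) :=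
  (summable_exp_neg_abs (lt_min hx0 (by linarith))).mul_left _

lemma summable_kronecker_term (hx0 : 0 < x.re) (hx1 : x.re < imPeriod τ) (e : ℂ) :
    Summable fun k : ℤ => kroneckerCoeff τ k e * cexp (k * x) :=
  Summable.of_norm_bounded_eventually (summable_kronecker_bound hx0 hx1 (|e.re| + 1))
    ((eventually_norm_kronecker_term_le τ x (|e.re| + 1)).mono fun k hk => hk e (by simp))

lemma isOpen_re_strip (R : ℝ) : IsOpen {e : ℂ | |e.re| < R} :=
  isOpen_lt (by fun_prop) continuous_const

lemma tendstoLocallyUniformlyOn_kronecker_series (hx0 : 0 < x.re) (hx1 : x.re < imPeriod τ) :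
    TendstoLocallyUniformlyOn
      (fun (K : Finset ℤ) e => ∑ k ∈ K, kroneckerCoeff τ k e * cexp (k * x))
      (fun e => ∑' k : ℤ, kroneckerCoeff τ k e * cexp (k * x)) atTop univ := by
  refine tendstoLocallyUniformlyOn_of_forall_exists_nhds fun e _ =>
    ⟨{e' : ℂ | |e'.re| < |e.re| + 1}, ?_, ?_⟩
  · exact mem_nhdsWithin_of_mem_nhds ((isOpen_re_strip _).mem_nhds (by simp))
  · exact tendstoUniformlyOn_tsum_of_cofinite_eventually (summable_kronecker_bound hx0 hx1 _)
      (eventually_norm_kronecker_term_le τ x _)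

lemma differentiableOn_kronecker_sum (τ : ℍ) (x : ℂ) (K : Finset ℤ) :
    DifferentiableOn ℂ (fun e => ∑ k ∈ K, kroneckerCoeff τ k e * cexp (k * x))
      (periodLattice τ)ᶜ := by
  refine DifferentiableOn.fun_sum fun k _ => fun e he => ?_
  exact ((differentiableAt_kroneckerCoeff (one_sub_exp_ne_zero he k)).mul_const _).differentiableWithinAt

lemma differentiableOn_kronecker_tsum (hx0 : 0 < x.re) (hx1 : x.re < imPeriod τ) :
    DifferentiableOn ℂ (fun e => ∑' k : ℤ, kroneckerCoeff τ k e * cexp (k * x))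
      (periodLattice τ)ᶜ :=
  ((tendstoLocallyUniformlyOn_kronecker_series hx0 hx1).mono (subset_univ _)).differentiableOn
    (Eventually.of_forall fun K => differentiableOn_kronecker_sum τ x K)
    (isOpen_compl_periodLattice τ)

lemma tendsto_mul_one_sub_exp_inv :
    Tendsto (fun e : ℂ => e * (1 - cexp (-e))⁻¹) (𝓝[≠] 0) (𝓝 1) := by
  have h : HasDerivAt (fun e : ℂ => 1 - cexp (-e)) 1 0 := by
    have := ((hasDerivAt_id (0 : ℂ)).neg.cexp).const_sub 1
    simpa using this
  have h2 := h.tendsto_slope.inv₀ one_ne_zero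
  rw [inv_one] at h2
  refine h2.congr' ?_
  filter_upwards [self_mem_nhdsWithin] with e _
  simp [slope_def_field, div_eq_mul_inv, mul_comm]

lemma tendsto_mul_kronecker_tsum (hx0 : 0 < x.re) (hx1 : x.re < imPeriod τ) :
    Tendsto (fun e => e * ∑' k : ℤ, kroneckerCoeff τ k e * cexp (k * x)) (𝓝[≠] 0) (𝓝 1) := by
  have hT := imPeriod_pos τ
  set g : ℤ → ℂ → ℂ := fun k e => if k = 0 then 0 else kroneckerCoeff τ k e * cexp (k * x) with hg
  have hgu : TendstoUniformlyOn (fun (K : Finset ℤ) e => ∑ k ∈ K, g k e)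
      (fun e => ∑' k, g k e) atTop {e : ℂ | |e.re| < imPeriod τ} := by
    refine tendstoUniformlyOn_tsum_of_cofinite_eventually (summable_kronecker_bound hx0 hx1 (imPeriod τ)) ?_
    filter_upwards [eventually_norm_kronecker_term_le τ x (imPeriod τ)] with k hk e he
    simp only [hg]
    split_ifs
    · simp only [norm_zero]; positivity
    · exact hk e he
  have hcont : ContinuousOn (fun e => ∑' k, g k e) {e : ℂ | |e.re| < imPeriod τ} := by
    refine hgu.continuousOn (Eventually.of_forall fun K => ?_).frequently
    refine continuousOn_finsetSum _ fun k _ e he => ?_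
    simp only [hg]
    split_ifs with hk
    · exact continuousWithinAt_const
    · refine ((differentiableAt_kroneckerCoeff ?_).mul_const _).continuousAt.continuousWithinAt
      intro h
      have h1 : ‖cexp (-(e + 2 * π * I * τ * k))‖ = 1 := by
        rw [← sub_eq_zero.mp h, norm_one]
      rw [norm_exp_kronecker, Real.exp_eq_one_iff, sub_eq_zero] at h1
      rw [mem_ofPred_eq, ← h1, abs_mul, abs_of_pos hT] at he
      have h2 : (1 : ℝ) ≤ |(k : ℝ)| := by exact_mod_cast Int.one_le_abs hk
      nlinarith
  have hc0 : ContinuousAt (fun e => ∑' k, g k e) 0 :=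
    hcont.continuousAt ((isOpen_re_strip _).mem_nhds (by simpa using hT))
  have hsplit : ∀ e : ℂ, ∑' k : ℤ, kroneckerCoeff τ k e * cexp (k * x) =
      (1 - cexp (-e))⁻¹ + ∑' k, g k e := by
    intro e
    rw [(summable_kronecker_term hx0 hx1 e).tsum_eq_add_tsum_ite 0]
    simp [kroneckerCoeff, hg]
  have hlim : Tendsto (fun e : ℂ => e * (1 - cexp (-e))⁻¹ + e * ∑' k, g k e) (𝓝[≠] 0)
      (𝓝 (1 + 0 * ∑' k, g k 0)) :=
    tendsto_mul_one_sub_exp_inv.add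
      ((continuousAt_id.mul hc0).tendsto.mono_left nhdsWithin_le_nhds)
  rw [zero_mul, add_zero] at hlim
  refine hlim.congr fun e => ?_
  rw [hsplit]; ring

lemma tendsto_mul_kronecker (hx : x ∉ periodLattice τ) :
    Tendsto (fun e => e * kronecker τ e x) (𝓝[≠] 0) (𝓝 1) := by
  have h1 : ContinuousAt (fun e => theta τ (x + e) / (theta τ x * thetaReg τ e)) 0 := by
    refine ContinuousAt.div ?_ ?_ ?_
    · exact ((differentiable_theta τ).continuous.comp (by fun_prop : Continuous fun e : ℂ => x + e)).continuousAt
    · exact (continuous_const.mul (differentiable_thetaReg τ).continuous).continuousAt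
    · rw [thetaReg_zero, mul_one]; exact theta_ne_zero hx
  have h2 := h1.tendsto
  rw [thetaReg_zero, mul_one, add_zero, div_self (theta_ne_zero hx)] at h2
  refine (h2.mono_left nhdsWithin_le_nhds).congr' ?_
  filter_upwards [self_mem_nhdsWithin] with e he
  have he : e ≠ 0 := he
  have ht := theta_ne_zero hx
  rw [kronecker, theta_eq_mul_thetaReg τ e]
  field_simp

lemma differentiableAt_kronecker (hx : x ∉ periodLattice τ) {e : ℂ} (he : e ∉ periodLattice τ) :
    DifferentiableAt ℂ (fun e => kronecker τ e x) e := by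
  unfold kronecker
  have := differentiable_theta τ
  refine DifferentiableAt.fun_div (by fun_prop) (by fun_prop) ?_
  exact mul_ne_zero (theta_ne_zero hx) (theta_ne_zero he)

lemma kronecker_eq_tsum (hx0 : 0 < x.re) (hx1 : x.re < imPeriod τ) {e : ℂ}
    (he : e ∉ periodLattice τ) :
    kronecker τ e x = ∑' k : ℤ, kroneckerCoeff τ k e * cexp (k * x) := by
  have hx := notMem_periodLattice_of_re hx0 hx1
  rw [← sub_eq_zero]
  refine eq_zero_of_multiplier (τ := τ) (f := fun e => kronecker τ e x -
    ∑' k : ℤ, kroneckerCoeff τ k e * cexp (k * x)) hx0 hx1 ?_ ?_ ?_ ?_ e he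
  · intro z hz
    exact (differentiableAt_kronecker hx hz).sub ((differentiableOn_kronecker_tsum hx0 hx1).differentiableAt
      ((isOpen_compl_periodLattice τ).mem_nhds hz))
  · intro z hz
    simp only [kroneckerCoeff_add_two_pi_I, kronecker, ← add_assoc, theta_add_two_pi_I]
    rw [mul_neg, neg_div_neg_eq]
  · intro z hz
    have h1 : ∑' k : ℤ, kroneckerCoeff τ k (z + 2 * π * I * τ) * cexp (k * x) =
        cexp (-x) * ∑' k : ℤ, kroneckerCoeff τ k z * cexp (k * x) := by
      rw [← tsum_mul_left, ← (Equiv.addRight (1 : ℤ)).tsum_eq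
        (fun k => cexp (-x) * (kroneckerCoeff τ k z * cexp (k * x)))]
      refine tsum_congr fun k => ?_
      rw [kroneckerCoeff_add_tau, Equiv.coe_addRight, mul_left_comm, ← Complex.exp_add]
      congr 2
      push_cast; ring
    have h2 : kronecker τ (z + 2 * π * I * τ) x = cexp (-x) * kronecker τ z x := by
      simp only [kronecker, ← add_assoc, theta_add_tau]
      rw [show -π * I * τ - (x + z) = -x + (-π * I * τ - z) by ring, Complex.exp_add]
      have := Complex.exp_ne_zero (-π * I * τ - z)
      have h3 := theta_ne_zero hx
      have h4 := theta_ne_zero hz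
      field_simp
    rw [h1, h2]; ring
  · have := (tendsto_mul_kronecker hx).sub (tendsto_mul_kronecker_tsum hx0 hx1)
    rw [sub_self] at this
    refine this.congr fun e => ?_
    ring

lemma hasSum_kronecker (hx0 : 0 < x.re) (hx1 : x.re < imPeriod τ) {e : ℂ}
    (he : e ∉ periodLattice τ) :
    HasSum (fun k : ℤ => kroneckerCoeff τ k e * cexp (k * x)) (kronecker τ e x) := by
  rw [kronecker_eq_tsum hx0 hx1 he]
  exact (summable_kronecker_term hx0 hx1 e).hasSum

lemma hasSum_kronecker_of_neg (hx0 : -imPeriod τ < x.re) (hx1 : x.re < 0) {e : ℂ}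
    (he : e ∉ periodLattice τ) :
    HasSum (fun k : ℤ => (kroneckerCoeff τ k e - 1) * cexp (k * x)) (kronecker τ e x) := by
  set x' := x - 2 * π * I * τ with hx'
  have hre : x'.re = x.re + imPeriod τ := by
    simp [hx', imPeriod]
  have h0 : 0 < x'.re := by linarith
  have h1 : x'.re < imPeriod τ := by linarith
  have h := (hasSum_kronecker h0 h1 he).mul_left (cexp (-e))
  have hx'Λ := theta_ne_zero (notMem_periodLattice_of_re h0 h1)
  have heΛ := theta_ne_zero he
  have hk : cexp (-e) * kronecker τ e x' = kronecker τ e x := by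
    have h2 : x = x' + 2 * π * I * τ := by rw [hx']; ring
    rw [h2]
    simp only [kronecker]
    rw [show x' + 2 * π * I * τ + e = x' + e + 2 * π * I * τ by ring, theta_add_tau, theta_add_tau,
      show -π * I * τ - (x' + e) = -e + (-π * I * τ - x') by ring, Complex.exp_add]
    have := Complex.exp_ne_zero (-π * I * τ - x')
    field_simp
  rw [← hk]
  refine (hasSum_iff_of_eq fun k => ?_).1 h
  have h3 := one_sub_exp_ne_zero he k
  have h4 : kroneckerCoeff τ k e - 1 = cexp (-(e + 2 * π * I * τ * k)) * kroneckerCoeff τ k e := by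
    unfold kroneckerCoeff
    field_simp
    ring
  rw [h4, hx', show (k : ℂ) * (x - 2 * π * I * τ) = k * x + -(2 * π * I * τ * k) by ring, neg_add,
    Complex.exp_add, Complex.exp_add]
  ring

lemma analyticOnNhd_kronecker_sum (τ : ℍ) (x : ℂ) (K : Finset ℤ) :
    AnalyticOnNhd ℂ (fun e => ∑ k ∈ K, kroneckerCoeff τ k e * cexp (k * x)) (periodLattice τ)ᶜ :=
  (differentiableOn_kronecker_sum τ x K).analyticOnNhd (isOpen_compl_periodLattice τ)

lemma analyticAt_kroneckerCoeff {e : ℂ} (he : e ∉ periodLattice τ) (k : ℤ) :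
    AnalyticAt ℂ (kroneckerCoeff τ k) e :=
  (show DifferentiableOn ℂ (kroneckerCoeff τ k) (periodLattice τ)ᶜ from fun _ hz =>
    (differentiableAt_kroneckerCoeff (one_sub_exp_ne_zero hz k)).differentiableWithinAt).analyticAt
    ((isOpen_compl_periodLattice τ).mem_nhds he)

/-- The Fourier development of the `e`-derivatives of the Kronecker function. -/
lemma tendsto_sum_iteratedDeriv_kroneckerCoeff (hx0 : 0 < x.re) (hx1 : x.re < imPeriod τ) {e : ℂ}
    (he : e ∉ periodLattice τ) (j : ℕ) :
    Tendsto (fun K : Finset ℤ => ∑ k ∈ K, iteratedDeriv j (kroneckerCoeff τ k) e * cexp (k * x))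
      atTop (𝓝 (iteratedDeriv j (fun e => kronecker τ e x) e)) := by
  have hU := isOpen_compl_periodLattice τ
  have key : ∀ j : ℕ, TendstoLocallyUniformlyOn
      (fun (K : Finset ℤ) => iteratedDeriv j
        (fun e => ∑ k ∈ K, kroneckerCoeff τ k e * cexp (k * x)))
      (iteratedDeriv j fun e => ∑' k : ℤ, kroneckerCoeff τ k e * cexp (k * x)) atTop
      (periodLattice τ)ᶜ := by
    intro j
    induction j with
    | zero =>
      simp only [iteratedDeriv_zero]
      exact (tendstoLocallyUniformlyOn_kronecker_series hx0 hx1).mono (subset_univ _)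
    | succ j ih =>
      have := ih.deriv (Eventually.of_forall fun K => ?_) hU
      · simpa only [iteratedDeriv_succ, Function.comp_def] using this
      · rw [iteratedDeriv_eq_iterate]
        exact ((analyticOnNhd_kronecker_sum τ x K).iterated_deriv j).differentiableOn
  have h1 : iteratedDeriv j (fun e => kronecker τ e x) e =
      iteratedDeriv j (fun e => ∑' k : ℤ, kroneckerCoeff τ k e * cexp (k * x)) e := by
    refine Filter.EventuallyEq.iteratedDeriv_eq j ?_
    filter_upwards [hU.mem_nhds he] with e' he'
    exact kronecker_eq_tsum hx0 hx1 he'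
  rw [h1]
  refine ((key j).tendsto_at he).congr fun K => ?_
  rw [iteratedDeriv_fun_sum fun k _ => (((analyticAt_kroneckerCoeff he k).contDiffAt).mul
    contDiffAt_const)]
  exact Finset.sum_congr rfl fun k _ => iteratedDeriv_mul_const_field _ _

end

/-! ### Fay's determinant identity -/

lemma kronecker_sub_mul_div {τ : ℍ} {e a b p q : ℂ} (he : theta τ e ≠ 0)
    (he' : theta τ (e + (a - b)) ≠ 0) (hpq : theta τ (p - q) ≠ 0)
    (hpb : theta τ (p - b) ≠ 0) (haq : theta τ (a - q) ≠ 0) :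
    kronecker τ e (p - q) -
        kronecker τ e (p - b) / kronecker τ e (a - b) * kronecker τ e (a - q) =
      theta τ (p - a) / theta τ (p - b) *
        (theta τ (b - q) / theta τ (a - q) * kronecker τ (e + (a - b)) (p - q)) := by
  have key := theta_three_term τ (e + (p - q + a - b) / 2) ((p - q - a + b) / 2)
    ((p - b - a + q) / 2) ((p - q + a - b) / 2)
  have e1 : theta τ ((p - b - a + q) / 2 - (p - q + a - b) / 2) = -theta τ (a - q) := by
    rw [← theta_neg]; congr 1; ring
  have e2 : theta τ ((p - q - a + b) / 2 - (p - q + a - b) / 2) = -theta τ (a - b) := by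
    rw [← theta_neg]; congr 1; ring
  rw [e1, e2,
    show e + (p - q + a - b) / 2 + (p - q - a + b) / 2 = p - q + e by ring,
    show e + (p - q + a - b) / 2 - (p - q - a + b) / 2 = e + (a - b) by ring,
    show e + (p - q + a - b) / 2 + (p - b - a + q) / 2 = p - b + e by ring,
    show e + (p - q + a - b) / 2 - (p - b - a + q) / 2 = a - q + e by ring,
    show e + (p - q + a - b) / 2 + (p - q + a - b) / 2 = p - q + (e + (a - b)) by ring,
    show e + (p - q + a - b) / 2 - (p - q + a - b) / 2 = e by ring,
    show (p - b - a + q) / 2 + (p - q + a - b) / 2 = p - b by ring,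
    show (p - q - a + b) / 2 + (p - q + a - b) / 2 = p - q by ring,
    show (p - q - a + b) / 2 + (p - b - a + q) / 2 = p - a by ring,
    show (p - q - a + b) / 2 - (p - b - a + q) / 2 = b - q by ring] at key
  unfold kronecker
  rw [show a - b + e = e + (a - b) by ring]
  field_simp
  linear_combination -key

lemma bigTheta_succ {n : ℕ} (τ : ℍ) (x y : Fin (n + 1) → ℂ) :
    bigTheta τ x y = 1 / theta τ (x 0 - y 0) *
      (∏ j : Fin n, theta τ (x j.succ - x 0) / theta τ (x j.succ - y 0)) *
      (∏ j : Fin n, theta τ (y 0 - y j.succ) / theta τ (x 0 - y j.succ)) *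
      bigTheta τ (fun i => x i.succ) (fun i => y i.succ) := by
  have h1 : ∀ j : Fin n, theta τ (x j.succ - x 0) / theta τ (x j.succ - y 0) =
      theta τ (x 0 - x j.succ) / theta τ (y 0 - x j.succ) := by
    intro j
    rw [← neg_sub (x 0), ← neg_sub (y 0), theta_neg, theta_neg, neg_div_neg_eq]
  simp only [bigTheta, Fin.prod_univ_succ, Fin.prod_Ioi_zero, Fin.prod_Ioi_succ, h1,
    Finset.prod_mul_distrib, Finset.prod_div_distrib]
  simp only [div_eq_mul_inv, mul_inv]
  ring

/-- Fay's identity. -/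
theorem det_kronecker {τ : ℍ} {n : ℕ} (e : ℂ) (x y : Fin n → ℂ)
    (hxy : ∀ i j, theta τ (x i - y j) ≠ 0)
    (he : ∀ s : Finset (Fin n), theta τ (e + ∑ i ∈ s, (x i - y i)) ≠ 0) :
    (Matrix.of fun i j => kronecker τ e (x i - y j)).det =
      theta τ (e + ∑ i, (x i - y i)) / theta τ e * bigTheta τ x y := by
  induction n generalizing e with
  | zero =>
    have he0 : theta τ e ≠ 0 := by simpa using he ∅
    simp [bigTheta, div_self he0]
  | succ n ih =>
    have he0 : theta τ e ≠ 0 := by simpa using he ∅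
    have he1 : theta τ (e + (x 0 - y 0)) ≠ 0 := by simpa using he {0}
    have ih' := ih (e + (x 0 - y 0)) (fun i => x i.succ) (fun i => y i.succ)
      (fun i j => hxy _ _) (fun s => by
        have := he (Finset.cons 0 (s.map (Fin.succEmb n)) (by simp))
        simpa [-Finset.sum_sub_distrib, Finset.sum_cons, Finset.sum_map, add_assoc] using this)
    set M : Matrix (Fin (n + 1)) (Fin (n + 1)) ℂ :=
      Matrix.of fun i j => kronecker τ e (x i - y j) with hM
    have h00 : M 0 0 = theta τ (e + (x 0 - y 0)) / (theta τ (x 0 - y 0) * theta τ e) := by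
      simp [hM, kronecker, add_comm]
    have h00' : M 0 0 ≠ 0 := by
      rw [h00]; exact div_ne_zero he1 (mul_ne_zero (hxy 0 0) he0)
    set c : Fin (n + 1) → ℂ := Fin.cons 0 fun i => M i.succ 0 / M 0 0 with hc
    set N : Matrix (Fin (n + 1)) (Fin (n + 1)) ℂ :=
      Matrix.of fun i j => M i j - c i * M 0 j with hN
    have hdet : M.det = N.det := by
      refine Matrix.det_eq_of_forall_row_eq_smul_add_const c 0 (by simp [hc]) fun i j => ?_
      simp [hN, hc]
    have hcol : ∀ i : Fin n, N i.succ 0 = 0 := by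
      intro i
      simp only [hN, hc, Matrix.of_apply, Fin.cons_succ]
      field_simp
      ring
    have hsub : (N.submatrix Fin.succ Fin.succ).det =
        (∏ j : Fin n, theta τ (x j.succ - x 0) / theta τ (x j.succ - y 0)) *
        ((∏ j : Fin n, theta τ (y 0 - y j.succ) / theta τ (x 0 - y j.succ)) *
        (Matrix.of fun i j : Fin n =>
          kronecker τ (e + (x 0 - y 0)) (x i.succ - y j.succ)).det) := by
      rw [← Matrix.det_mul_row, ← Matrix.det_mul_column]
      congr 1
      ext i j
      simp only [hN, hc, hM, Matrix.submatrix_apply, Matrix.of_apply, Fin.cons_succ]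
      exact kronecker_sub_mul_div he0 he1 (hxy _ _) (hxy _ _) (hxy _ _)
    rw [hdet, Matrix.det_succ_column_zero, Fin.sum_univ_succ, Finset.sum_eq_zero fun i _ => by
      rw [hcol]; ring]
    simp only [Fin.succAbove_zero]
    rw [hsub, ih', bigTheta_succ, Fin.sum_univ_succ,
      show N 0 0 = M 0 0 by simp [hN, hc], h00, ← add_assoc]
    have := hxy 0 0
    simp only [Fin.val_zero, pow_zero, one_mul, add_zero]
    field_simp

/-! ### Sums over set partitions -/

section Moment

variable {ι : Type*} [LinearOrder ι] {R S : Type*} [CommRing R] [CommRing S]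

/-- The sum over all set partitions of `A` of the product of `c` over the blocks. -/
def moment (c : Finset ι → R) (A : Finset ι) : R :=
  if h : A.Nonempty then
    ∑ B ∈ (A.erase (A.min' h)).powerset,
      c (insert (A.min' h) B) * moment c (A.erase (A.min' h) \ B)
  else 1
termination_by A.card
decreasing_by
  exact (Finset.card_le_card Finset.sdiff_subset).trans_lt
    (Finset.card_erase_lt_of_mem (Finset.min'_mem A h))

@[simp]
lemma moment_empty (c : Finset ι → R) : moment c ∅ = 1 := by
  rw [moment]; simp

lemma moment_eq (c : Finset ι → R) {A : Finset ι} {a : ι} (ha : a ∈ A) (hmin : ∀ b ∈ A, a ≤ b) :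
    moment c A = ∑ B ∈ (A.erase a).powerset, c (insert a B) * moment c (A.erase a \ B) := by
  have h : A.Nonempty := ⟨a, ha⟩
  have hm : A.min' h = a := le_antisymm (Finset.min'_le _ _ ha) (hmin _ (Finset.min'_mem _ _))
  rw [moment, dif_pos h, hm]

lemma induction_min {p : Finset ι → Prop} (h0 : p ∅)
    (h : ∀ (A : Finset ι) (a : ι), a ∈ A → (∀ b ∈ A, a ≤ b) →
      (∀ B ⊆ A.erase a, p B) → p A) (A : Finset ι) : p A := by
  induction A using Finset.strongInduction with
  | H A ih =>
    rcases A.eq_empty_or_nonempty with rfl | hA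
    · exact h0
    · exact h A _ (A.min'_mem hA) (fun b hb => A.min'_le b hb) fun B hB =>
        ih B (hB.trans_ssubset (Finset.erase_ssubset (A.min'_mem hA)))

lemma moment_rel (r : R → S → Prop) (h0 : r 0 0) (h1 : r 1 1)
    (hadd : ∀ {x y x' y'}, r x y → r x' y' → r (x + x') (y + y'))
    (hmul : ∀ {x y x' y'}, r x y → r x' y' → r (x * x') (y * y'))
    {c : Finset ι → R} {d : Finset ι → S} (A : Finset ι)
    (hcd : ∀ B ⊆ A, B.Nonempty → r (c B) (d B)) : r (moment c A) (moment d A) := by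
  induction A using induction_min with
  | h0 => simpa using h1
  | h A a ha hmin ih =>
    rw [moment_eq c ha hmin, moment_eq d ha hmin]
    have key : ∀ T ⊆ (A.erase a).powerset,
        r (∑ B ∈ T, c (insert a B) * moment c (A.erase a \ B))
          (∑ B ∈ T, d (insert a B) * moment d (A.erase a \ B)) := by
      intro T
      induction T using Finset.induction_on with
      | empty => intro _; simpa using h0
      | insert B T hB ihT =>
        intro hT
        rw [Finset.sum_insert hB, Finset.sum_insert hB]
        have hBA : B ⊆ A.erase a := Finset.mem_powerset.1 (hT (Finset.mem_insert_self _ _))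
        refine hadd (hmul (hcd _ ?_ (Finset.insert_nonempty _ _)) ?_)
          (ihT ((Finset.subset_insert _ _).trans hT))
        · exact Finset.insert_subset ha (hBA.trans (Finset.erase_subset _ _))
        · exact ih _ Finset.sdiff_subset fun C hC hC' =>
            hcd C (hC.trans (Finset.sdiff_subset.trans (Finset.erase_subset _ _))) hC'
    exact key _ subset_rfl

lemma moment_unique {c : Finset ι → R} {N : Finset ι → R} (h0 : N ∅ = 1)
    (h : ∀ (A : Finset ι) (a : ι), a ∈ A → (∀ b ∈ A, a ≤ b) →
      N A = ∑ B ∈ (A.erase a).powerset, c (insert a B) * N (A.erase a \ B)) (A : Finset ι) :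
    N A = moment c A := by
  induction A using induction_min with
  | h0 => simpa using h0
  | h A a ha hmin ih =>
    rw [moment_eq c ha hmin, h A a ha hmin]
    exact Finset.sum_congr rfl fun B _ => by rw [ih _ Finset.sdiff_subset]

lemma map_moment (f : R →+* S) (c : Finset ι → R) (A : Finset ι) :
    f (moment c A) = moment (fun B => f (c B)) A :=
  moment_unique (N := fun A => f (moment c A)) (by simp)
    (fun A a ha hmin => by simp [moment_eq c ha hmin]) A

lemma moment_congr {c d : Finset ι → R} {A : Finset ι} (h : ∀ B ⊆ A, B.Nonempty → c B = d B) :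
    moment c A = moment d A :=
  moment_rel (fun x y => x = y) rfl rfl (by rintro _ _ _ _ rfl rfl; rfl)
    (by rintro _ _ _ _ rfl rfl; rfl) A h

lemma moment_pow_card_mul (t : R) (c : Finset ι → R) (A : Finset ι) :
    t ^ A.card * moment c A = moment (fun B => t ^ B.card * c B) A := by
  refine moment_unique (N := fun A => t ^ A.card * moment c A) (by simp) (fun A a ha hmin => ?_) A
  rw [moment_eq c ha hmin, Finset.mul_sum]
  refine Finset.sum_congr rfl fun B hB => ?_
  rw [Finset.mem_powerset] at hB
  have h1 : A.card = (insert a B).card + (A.erase a \ B).card := by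
    rw [Finset.card_insert_of_notMem fun h => by simpa using hB h, Finset.card_sdiff_of_subset hB,
      Finset.card_erase_of_mem ha]
    have := Finset.card_le_card hB
    rw [Finset.card_erase_of_mem ha] at this
    have := Finset.card_pos.2 ⟨a, ha⟩
    omega
  rw [h1, pow_add]
  ring

lemma moment_map {κ : Type*} [LinearOrder κ] (f : ι ↪o κ) (c : Finset κ → R) (A : Finset ι) :
    moment c (A.map f.toEmbedding) = moment (fun B => c (B.map f.toEmbedding)) A := by
  refine moment_unique (N := fun A => moment c (A.map f.toEmbedding)) (by simp)
    (fun A a ha hmin => ?_) A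
  rw [moment_eq c (a := f a) (by simpa using ha) (by simpa using hmin)]
  have h1 : (A.map f.toEmbedding).erase (f a) = (A.erase a).map f.toEmbedding := by
    rw [Finset.map_erase]; rfl
  rw [h1]
  symm
  refine Finset.sum_bij' (fun B _ => B.map f.toEmbedding)
    (fun B _ => B.preimage f f.injective.injOn) ?_ ?_ ?_ ?_ ?_
  · intro B hB
    rw [Finset.mem_powerset, Finset.map_subset_map]
    exact Finset.mem_powerset.1 hB
  · intro B hB
    rw [Finset.mem_powerset] at hB ⊢
    intro x hx
    rw [Finset.mem_preimage] at hx
    simpa using hB hx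
  · intro B _
    ext x; simp
  · intro B hB
    rw [Finset.mem_powerset] at hB
    ext x
    simp only [Finset.mem_map, Finset.mem_preimage]
    constructor
    · rintro ⟨y, hy, rfl⟩; exact hy
    · intro hx
      obtain ⟨y, _, rfl⟩ := Finset.mem_map.1 (hB hx)
      exact ⟨y, hx, rfl⟩
  · intro B _
    simp only [Finset.map_insert, Finset.map_sdiff]
    rfl

/-- A Leibniz rule for sums over set partitions. -/
lemma eq_sum_mul_moment {c d N : Finset ι → R} (hd : d ∅ = 0) (h0 : N ∅ = 0)
    (h : ∀ (A : Finset ι) (a : ι), a ∈ A → (∀ b ∈ A, a ≤ b) →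
      N A = ∑ B ∈ (A.erase a).powerset, (d (insert a B) * moment c (A.erase a \ B) +
        c (insert a B) * N (A.erase a \ B))) (A : Finset ι) :
    N A = ∑ B ∈ A.powerset, d B * moment c (A \ B) := by
  induction A using induction_min with
  | h0 => simp [h0, hd]
  | h A a ha hmin ih =>
    have h1 : ∑ B ∈ A.powerset, d B * moment c (A \ B) =
        ∑ B ∈ (A.erase a).powerset, d B * moment c (A \ B) +
        ∑ B ∈ (A.erase a).powerset, d (insert a B) * moment c (A.erase a \ B) := by
      conv_lhs => rw [← Finset.insert_erase ha, Finset.sum_powerset_insert (Finset.notMem_erase a A)]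
      congr 1
      · rw [Finset.insert_erase ha]
      · refine Finset.sum_congr rfl fun B _ => ?_
        congr 2
        ext x; simp only [Finset.mem_sdiff, Finset.mem_insert, Finset.mem_erase]; tauto
    rw [h1, h A a ha hmin, Finset.sum_add_distrib, add_comm]
    congr 1
    have h2 : ∀ B ∈ (A.erase a).powerset, d B * moment c (A \ B) =
        ∑ C ∈ (A.erase a \ B).powerset,
          d B * (c (insert a C) * moment c ((A.erase a \ B) \ C)) := by
      intro B hB
      rw [Finset.mem_powerset] at hB
      have haB : a ∉ B := fun h => by simpa using hB h
      rw [moment_eq c (a := a) (by simp [ha, haB]) (fun b hb => hmin b (Finset.mem_sdiff.1 hb).1),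
        Finset.mul_sum]
      have : (A \ B).erase a = A.erase a \ B := by
        ext x; simp only [Finset.mem_sdiff, Finset.mem_erase]; tauto
      rw [this]
    rw [Finset.sum_congr rfl h2, Finset.sum_congr rfl fun B hB => by
      rw [ih _ Finset.sdiff_subset, Finset.mul_sum]]
    rw [Finset.sum_comm' (s' := fun C => (A.erase a \ C).powerset) (t' := (A.erase a).powerset)]
    · refine Finset.sum_congr rfl fun C _ => Finset.sum_congr rfl fun B _ => ?_
      rw [sdiff_right_comm]; ring
    · intro B C
      simp only [Finset.mem_powerset, Finset.subset_sdiff]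
      tauto

lemma sum_mul_moment (z : ι → R) (c : Finset ι → R) (A : Finset ι) :
    ∑ B ∈ A.powerset, ((∑ i ∈ B, z i) * c B) * moment c (A \ B) =
      (∑ i ∈ A, z i) * moment c A := by
  symm
  refine eq_sum_mul_moment (N := fun A => (∑ i ∈ A, z i) * moment c A)
    (d := fun B => (∑ i ∈ B, z i) * c B) (by simp) (by simp) (fun A a ha hmin => ?_) A
  rw [moment_eq c ha hmin, Finset.mul_sum]
  refine Finset.sum_congr rfl fun B hB => ?_
  rw [Finset.mem_powerset] at hB
  have haB : a ∉ B := fun h => by simpa using hB h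
  have h1 : ∑ i ∈ A, z i = ∑ i ∈ insert a B, z i + ∑ i ∈ A.erase a \ B, z i := by
    rw [Finset.sum_insert haB, add_assoc, add_comm (∑ i ∈ B, z i), Finset.sum_sdiff hB,
      Finset.add_sum_erase _ _ ha]
  rw [h1]; ring

end Moment

lemma sum_Ioi_add {n : ℕ} {R : Type*} [CommRing R] (z : Fin n → R) (B : Finset (Fin n)) :
    ∑ i, ∑ j ∈ Finset.Ioi i, (if i ∈ B ∧ j ∈ B then z i + z j else 0) =
      ((B.card : R) - 1) * ∑ i ∈ B, z i := by
  have h := Finset.sum_sum_Ioi_add_eq_sum_sum_off_diag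
    (fun i j : Fin n => if i ∈ B ∧ j ∈ B then z j else 0)
  have h1 : ∀ i j : Fin n, (if i ∈ B ∧ j ∈ B then z i + z j else 0) =
      (if j ∈ B ∧ i ∈ B then z i else 0) + if i ∈ B ∧ j ∈ B then z j else 0 := by
    intro i j
    by_cases hi : i ∈ B <;> by_cases hj : j ∈ B <;> simp [hi, hj]
  simp only [h1]
  rw [h]
  have h2 : ∀ i : Fin n, ∑ j ∈ ({i} : Finset (Fin n))ᶜ, (if j ∈ B ∧ i ∈ B then z i else 0) =
      if i ∈ B then ((B.card : R) - 1) * z i else 0 := by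
    intro i
    by_cases hi : i ∈ B
    · simp only [hi, and_true, if_true]
      have h3 : ∑ j : Fin n, (if j ∈ B then z i else 0) = B.card * z i := by
        rw [Finset.sum_ite_mem]; simp
      rw [← Finset.sum_add_sum_compl {i}, Finset.sum_singleton, if_pos hi] at h3
      linear_combination h3
    · simp [hi]
  rw [Finset.sum_congr rfl fun i _ => h2 i, Finset.sum_ite_mem]
  simp [Finset.mul_sum]

lemma tendsto_moment {ι X : Type*} [LinearOrder ι] {l : Filter X} {c : X → Finset ι → ℂ}
    {d : Finset ι → ℂ} {A : Finset ι}
    (h : ∀ B ⊆ A, B.Nonempty → Tendsto (fun x => c x B) l (𝓝 (d B))) :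
    Tendsto (fun x => moment (c x) A) l (𝓝 (moment d A)) := by
  have h1 : ∀ x, moment (c x) A = moment (fun B x => c x B) A x := fun x =>
    (map_moment (Pi.evalRingHom (fun _ : X => ℂ) x) (fun B x => c x B) A).symm
  simp only [h1]
  exact moment_rel (fun (f : X → ℂ) a => Tendsto f l (𝓝 a)) tendsto_const_nhds tendsto_const_nhds
    (fun h h' => h.add h') (fun h h' => h.mul h') A h

lemma exists_orderEmb_mergeTuple {m : ℕ} (z : Fin (m + 2) → ℂ) {i j : Fin (m + 2)} (hij : i ≠ j) :
    ∃ g : Fin m ↪o Fin (m + 2),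
      (∀ x, (x ∈ Finset.univ.map g.toEmbedding ↔ x ∉ ({i, j} : Finset (Fin (m + 2))))) ∧
      ∀ t : Fin m, mergeTuple z i j (Fin.succ t : Fin (m + 1)) = z (g t) := by
  set l := (List.finRange (m + 2)).filter (fun l => l ≠ i ∧ l ≠ j) with hl
  have hmem : ∀ x, x ∈ l ↔ x ∉ ({i, j} : Finset (Fin (m + 2))) := by
    intro x; simp [hl]
  have hnd : l.Nodup := (List.nodup_finRange _).filter _
  have hlen : l.length = m := by
    rw [← List.toFinset_card_of_nodup hnd]
    have : l.toFinset = ({i, j} : Finset (Fin (m + 2)))ᶜ := by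
      ext x; rw [List.mem_toFinset, hmem, Finset.mem_compl]
    rw [this, Finset.card_compl, Finset.card_pair hij]
    simp
  have hsorted : l.Pairwise (· < ·) := (List.pairwise_lt_finRange _).filter _
  have hmono : StrictMono fun t : Fin m => l.get (t.cast hlen.symm) := by
    intro s t hst
    exact List.pairwise_iff_get.1 hsorted _ _ (by simpa using hst)
  refine ⟨OrderEmbedding.ofStrictMono _ hmono, fun x => ?_, fun t => ?_⟩
  · rw [← hmem, List.mem_iff_get]
    simp only [Finset.mem_map, Finset.mem_univ, true_and]
    constructor
    · rintro ⟨t, rfl⟩; exact ⟨_, rfl⟩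
    · rintro ⟨t, rfl⟩; exact ⟨t.cast hlen, rfl⟩
  · have ht : (t : ℕ) < l.length := by rw [hlen]; exact t.2
    change ((z i + z j) :: l.map z).getD (t.val + 1) 0 = z l[t.val]
    rw [List.getD_cons_succ, List.getD_eq_getElem _ _ (by simpa using ht), List.getElem_map]

lemma moment_mergeTuple {R : Type*} [CommRing R] {n : ℕ} (z : Fin n → ℂ) {i j : Fin n}
    (hij : i ≠ j) (c : ℕ → ℂ → R) :
    moment (fun B : Finset (Fin (n - 1)) => c B.card (∑ k ∈ B, mergeTuple z i j k)) Finset.univ =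
      ∑ B : Finset (Fin n), if i ∈ B ∧ j ∈ B then c (B.card - 1) (∑ k ∈ B, z k) *
        moment (fun B : Finset (Fin n) => c B.card (∑ k ∈ B, z k)) (Finset.univ \ B) else 0 := by
  obtain ⟨m, rfl⟩ : ∃ m, n = m + 2 := by
    obtain ⟨n, rfl⟩ : ∃ k, n = k + 1 := ⟨n - 1, by have := i.2; omega⟩
    rcases n with _ | m
    · exact absurd (Fin.ext (by have := i.2; have := j.2; omega)) hij
    · exact ⟨m, rfl⟩
  obtain ⟨g, hg, hgz⟩ := exists_orderEmb_mergeTuple z hij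
  change moment (fun B : Finset (Fin (m + 1)) => c B.card (∑ k ∈ B, mergeTuple z i j k))
    Finset.univ = _
  have h0 : mergeTuple z i j (0 : Fin (m + 1)) = z i + z j := by simp [mergeTuple]
  rw [moment_eq _ (Finset.mem_univ (0 : Fin (m + 1))) (fun b _ => Fin.zero_le b)]
  have hu : (Finset.univ : Finset (Fin (m + 1))).erase 0 =
      Finset.univ.map (Fin.succOrderEmb m).toEmbedding := by
    ext x
    refine Fin.cases ?_ (fun t => ?_) x
    · simp
    · simp
  rw [hu, ← Finset.sum_filter]
  have hgi : ∀ t, g t ≠ i ∧ g t ≠ j := by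
    intro t
    have := (hg (g t)).1 (by simp)
    simpa using this
  have hpair : ∀ B'' : Finset (Fin m), Disjoint ({i, j} : Finset (Fin (m + 2)))
      (B''.map g.toEmbedding) := by
    intro B''
    rw [Finset.disjoint_left]
    intro x hx hx'
    obtain ⟨t, _, rfl⟩ := Finset.mem_map.1 hx'
    have := hgi t
    simp at hx
    tauto
  refine (Finset.sum_bij' (i := fun (B'' : Finset (Fin m)) (_ : B'' ∈ Finset.univ) =>
      B''.map (Fin.succOrderEmb m).toEmbedding)
    (j := fun B' _ => B'.preimage _ (Fin.succOrderEmb m).injective.injOn)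
    (f := fun B'' => c (B''.card + 1) (z i + z j + ∑ t ∈ B'', z (g t)) *
      moment (fun B => c B.card (∑ t ∈ B, z (g t))) (Finset.univ \ B'')) ?_ ?_ ?_ ?_ ?_).symm.trans
    (Finset.sum_bij' (i := fun (B'' : Finset (Fin m)) (_ : B'' ∈ Finset.univ) =>
      {i, j} ∪ B''.map g.toEmbedding)
    (j := fun B _ => B.preimage g g.injective.injOn) ?_ ?_ ?_ ?_ ?_)
  · intro B _
    rw [Finset.mem_powerset, Finset.map_subset_map]
    exact Finset.subset_univ _
  · intro B _
    exact Finset.mem_univ _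
  · intro B _
    ext x; simp
  · intro B hB
    rw [Finset.mem_powerset] at hB
    ext x
    simp only [Finset.mem_map, Finset.mem_preimage]
    constructor
    · rintro ⟨y, hy, rfl⟩; exact hy
    · intro hx
      obtain ⟨y, _, rfl⟩ := Finset.mem_map.1 (hB hx)
      exact ⟨y, hx, rfl⟩
  · intro B _
    have hnot : (0 : Fin (m + 1)) ∉ B.map (Fin.succOrderEmb m).toEmbedding := by simp
    rw [← Finset.map_sdiff, moment_map, Finset.card_insert_of_notMem hnot, Finset.card_map,
      Finset.sum_insert hnot, Finset.sum_map, h0]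
    congr 1
    · congr 2
      exact Finset.sum_congr rfl fun t _ => (hgz t).symm
    · refine moment_congr fun C _ _ => ?_
      rw [Finset.card_map, Finset.sum_map]
      congr 1
      exact Finset.sum_congr rfl fun t _ => (hgz t).symm
  · intro B _
    simp
  · intro B _
    exact Finset.mem_univ _
  · intro B _
    ext t
    have := hgi t
    simp [this]
  · intro B hB
    rw [Finset.mem_filter] at hB
    ext x
    by_cases hx : x ∈ ({i, j} : Finset (Fin (m + 2)))
    · have : x ∈ B := by
        simp only [Finset.mem_insert, Finset.mem_singleton] at hx
        rcases hx with rfl | rfl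
        · exact hB.2.1
        · exact hB.2.2
      simp only [Finset.mem_union, hx, this, true_or]
    · obtain ⟨t, _, rfl⟩ := Finset.mem_map.1 ((hg x).2 hx)
      rw [Finset.mem_union, Finset.mem_map]
      simp only [hx, false_or, Finset.mem_preimage]
      constructor
      · rintro ⟨s, hs, hst⟩
        rw [← hst]; exact hs
      · intro h; exact ⟨t, h, rfl⟩
  · intro B _
    rw [Finset.card_union_of_disjoint (hpair B), Finset.card_pair hij, Finset.card_map,
      Finset.sum_union (hpair B), Finset.sum_pair hij, Finset.sum_map]
    have h1 : Finset.univ \ ({i, j} ∪ B.map g.toEmbedding) =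
        (Finset.univ \ B).map g.toEmbedding := by
      ext x
      by_cases hx : x ∈ ({i, j} : Finset (Fin (m + 2)))
      · have : x ∉ (Finset.univ \ B).map g.toEmbedding :=
          Finset.disjoint_left.1 (hpair _) hx
        simp only [Finset.mem_sdiff, Finset.mem_union, hx, this, true_or, not_true, and_false]
      · obtain ⟨t, _, rfl⟩ := Finset.mem_map.1 ((hg x).2 hx)
        simp only [Finset.mem_sdiff, Finset.mem_union, hx, false_or, Finset.mem_univ, true_and]
        rw [Finset.mem_map', Finset.mem_map']
        simp
    rw [h1, moment_map]
    congr 1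
    · congr 1; omega
    · refine moment_congr fun C _ _ => ?_
      rw [Finset.card_map, Finset.sum_map]
      rfl

/-! ### The combinatorics of the Fourier coefficients -/

section Fourier

variable {R : Type*} [CommRing R]

lemma prod_image_eq_sum {ι : Type*} [DecidableEq ι] {a : ℤ → R} {p : ℕ → ℤ → R}
    (hp : ∀ N κ, p N κ + a κ * ∑ j ∈ Finset.range N, (N.choose j : R) * p j κ = a κ)
    {A : Finset ι} {b : ι} (hb : b ∈ A) (k : ι → ℤ) :
    ∏ κ ∈ A.image k, a κ = ∑ B ∈ ((A.erase b).filter fun i => k i = k b).powerset,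
      p B.card (k b) * ∏ κ ∈ (A.erase b \ B).image k, a κ := by
  set F := (A.erase b).filter fun i => k i = k b with hF
  set P := ∏ κ ∈ (A.image k).erase (k b), a κ with hP
  have hkb : k b ∈ A.image k := Finset.mem_image_of_mem k hb
  have hterm : ∀ B ∈ F.powerset, p B.card (k b) * ∏ κ ∈ (A.erase b \ B).image k, a κ =
      p B.card (k b) * a (k b) * P + if B = F then p F.card (k b) * (1 - a (k b)) * P else 0 := by
    intro B hB
    rw [Finset.mem_powerset] at hB
    split_ifs with h
    · have : (A.erase b \ B).image k = (A.image k).erase (k b) := by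
        ext κ
        simp only [Finset.mem_image, Finset.mem_sdiff, Finset.mem_erase, h, hF, Finset.mem_filter]
        constructor
        · rintro ⟨x, ⟨⟨hx, hxA⟩, h2⟩, rfl⟩
          exact ⟨fun h3 => h2 ⟨⟨hx, hxA⟩, h3⟩, x, hxA, rfl⟩
        · rintro ⟨h1, x, hxA, rfl⟩
          exact ⟨x, ⟨⟨fun h => h1 (by rw [h]), hxA⟩, fun h2 => h1 h2.2⟩, rfl⟩
      rw [this, ← hP, h]; ring
    · have hlt : ∃ x ∈ F, x ∉ B := by
        by_contra hcon
        push Not at hcon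
        exact h (Finset.Subset.antisymm hB hcon)
      obtain ⟨x, hxF, hxB⟩ := hlt
      rw [hF, Finset.mem_filter] at hxF
      have : (A.erase b \ B).image k = A.image k := by
        refine Finset.Subset.antisymm (Finset.image_subset_image
          (Finset.sdiff_subset.trans (Finset.erase_subset _ _))) ?_
        intro κ hκ
        obtain ⟨y, hy, rfl⟩ := Finset.mem_image.1 hκ
        by_cases hyb : k y = k b
        · rw [hyb, ← hxF.2]
          exact Finset.mem_image_of_mem k (Finset.mem_sdiff.2 ⟨hxF.1, hxB⟩)
        · refine Finset.mem_image_of_mem k (Finset.mem_sdiff.2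
            ⟨Finset.mem_erase.2 ⟨fun h => hyb (by rw [h]), hy⟩, fun h2 => hyb ?_⟩)
          exact (Finset.mem_filter.1 (hB h2)).2
      rw [this, ← Finset.mul_prod_erase _ _ hkb, ← hP]; ring
  rw [Finset.sum_congr rfl hterm, Finset.sum_add_distrib, Finset.sum_ite_eq' F.powerset F,
    if_pos (Finset.mem_powerset_self F), ← Finset.mul_prod_erase _ _ hkb, ← hP,
    Finset.sum_powerset_apply_card (fun m => p m (k b) * a (k b) * P), Finset.sum_range_succ]
  have h1 : ∑ m ∈ Finset.range F.card, F.card.choose m • (p m (k b) * a (k b) * P) =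
      a (k b) * (∑ j ∈ Finset.range F.card, (F.card.choose j : R) * p j (k b)) * P := by
    rw [Finset.mul_sum, Finset.sum_mul]
    refine Finset.sum_congr rfl fun m _ => ?_
    rw [nsmul_eq_mul]; ring
  rw [h1, Nat.choose_self, one_smul]
  linear_combination -P * hp F.card (k b)

/-- The sum over all `k : A → K` of `∏ i, E (k i) i` times the product of `a` over the image. -/
lemma sum_prod_image_eq_moment {ι : Type*} [LinearOrder ι] [Fintype ι] {a : ℤ → R} {p : ℕ → ℤ → R}
    (hp : ∀ N κ, p N κ + a κ * ∑ j ∈ Finset.range N, (N.choose j : R) * p j κ = a κ)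
    (E : ℤ → ι → R) (K : Finset ℤ) (A : Finset ι) :
    ∑ k ∈ Fintype.piFinset (fun i => if i ∈ A then K else {0}),
      (∏ i ∈ A, E (k i) i) * ∏ κ ∈ A.image k, a κ =
    moment (fun B => ∑ κ ∈ K, p (B.card - 1) κ * ∏ i ∈ B, E κ i) A := by
  refine moment_unique (N := fun A => ∑ k ∈ Fintype.piFinset (fun i => if i ∈ A then K else {0}),
      (∏ i ∈ A, E (k i) i) * ∏ κ ∈ A.image k, a κ) ?_ (fun A b hb _ => ?_) A
  · simp
  have h1 : ∀ k : ι → ℤ, (∏ i ∈ A, E (k i) i) * ∏ κ ∈ A.image k, a κ =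
      ∑ B ∈ ((A.erase b).filter fun i => k i = k b).powerset, (∏ i ∈ A, E (k i) i) *
        (p B.card (k b) * ∏ κ ∈ (A.erase b \ B).image k, a κ) := fun k => by
    rw [prod_image_eq_sum hp hb k, Finset.mul_sum]
  simp only [h1]
  rw [Finset.sum_comm' (t' := (A.erase b).powerset)
    (s' := fun B => (Fintype.piFinset (fun i => if i ∈ A then K else {0})).filter
      fun k => ∀ i ∈ B, k i = k b)]
  swap
  · intro k B
    simp only [Finset.mem_powerset, Finset.mem_filter, Finset.subset_iff]
    constructor
    · rintro ⟨h1, h2⟩; exact ⟨⟨h1, fun i hi => (h2 hi).2⟩, fun i hi => (h2 hi).1⟩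
    · rintro ⟨⟨h1, h2⟩, h3⟩; exact ⟨h1, fun i hi => ⟨h3 hi, h2 i hi⟩⟩
  refine Finset.sum_congr rfl fun B hB => ?_
  rw [Finset.mem_powerset] at hB
  have hbB : b ∉ B := fun h => by simpa using hB h
  have hBA : ∀ i ∈ B, i ∈ A ∧ i ≠ b := fun i hi => by
    have := hB hi; simp at this; tauto
  rw [Finset.sum_mul_sum, ← Finset.sum_product', Finset.card_insert_of_notMem hbB,
    Nat.add_sub_cancel]
  refine Finset.sum_bij' (fun k _ => (k b, fun i => if i ∈ insert b B then 0 else k i))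
    (fun q _ => fun i => if i ∈ insert b B then q.1 else q.2 i) ?_ ?_ ?_ ?_ ?_
  · intro k hk
    rw [Finset.mem_filter, Fintype.mem_piFinset] at hk
    rw [Finset.mem_product, Fintype.mem_piFinset]
    refine ⟨by simpa [hb] using hk.1 b, fun i => ?_⟩
    have := hk.1 i
    simp only
    by_cases hi : i ∈ insert b B
    · have h2 : i ∉ A.erase b \ B := by
        rw [Finset.mem_insert] at hi
        simp only [Finset.mem_sdiff, Finset.mem_erase]; tauto
      simp [hi, h2]
    · rw [if_neg hi]
      rw [Finset.mem_insert, not_or] at hi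
      have h2 : i ∈ A.erase b \ B ↔ i ∈ A := by
        simp only [Finset.mem_sdiff, Finset.mem_erase]; tauto
      simpa only [h2] using this
  · intro q hq
    rw [Finset.mem_product, Fintype.mem_piFinset] at hq
    rw [Finset.mem_filter, Fintype.mem_piFinset]
    refine ⟨fun i => ?_, fun i hi => by simp [hi]⟩
    have := hq.2 i
    by_cases hi : i ∈ insert b B
    · have hiA : i ∈ A := by
        rcases Finset.mem_insert.1 hi with rfl | h
        · exact hb
        · exact (hBA i h).1
      simpa only [hi, hiA, if_true] using hq.1
    · rw [if_neg hi]
      rw [Finset.mem_insert, not_or] at hi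
      have h2 : i ∈ A.erase b \ B ↔ i ∈ A := by
        simp only [Finset.mem_sdiff, Finset.mem_erase]; tauto
      simpa only [h2] using this
  · intro k hk
    rw [Finset.mem_filter] at hk
    funext i
    by_cases hi : i ∈ insert b B
    · simp only [hi, if_true]
      rcases Finset.mem_insert.1 hi with rfl | h
      · rfl
      · exact (hk.2 i h).symm
    · simp only [hi, if_false]
  · intro q hq
    rw [Finset.mem_product, Fintype.mem_piFinset] at hq
    refine Prod.ext (by simp) (funext fun i => ?_)
    by_cases hi : i ∈ insert b B
    · have h2 : i ∉ A.erase b \ B := by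
        rw [Finset.mem_insert] at hi
        simp only [Finset.mem_sdiff, Finset.mem_erase]; tauto
      have := hq.2 i
      simp only [h2, if_false, Finset.mem_singleton] at this
      simp [hi, this]
    · simp only [hi, if_false]
  · intro k hk
    rw [Finset.mem_filter] at hk
    have hsub : ∀ i ∈ A.erase b \ B, i ∉ insert b B := by
      intro i hi
      simp only [Finset.mem_sdiff, Finset.mem_erase] at hi
      simp only [Finset.mem_insert]; tauto
    have e1 : ∏ i ∈ A, E (k i) i = (∏ i ∈ insert b B, E (k b) i) *
        ∏ i ∈ A.erase b \ B, E (if i ∈ insert b B then 0 else k i) i := by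
      have hins : insert b B ⊆ A := Finset.insert_subset hb fun i hi => (hBA i hi).1
      rw [← Finset.prod_sdiff hins, mul_comm]
      congr 1
      · refine Finset.prod_congr rfl fun i hi => ?_
        rcases Finset.mem_insert.1 hi with rfl | h
        · rfl
        · rw [hk.2 i h]
      · have : A \ insert b B = A.erase b \ B := by
          ext i; simp only [Finset.mem_sdiff, Finset.mem_insert, Finset.mem_erase]; tauto
        rw [this]
        exact Finset.prod_congr rfl fun i hi => by rw [if_neg (hsub i hi)]
    have e2 : (A.erase b \ B).image (fun i => if i ∈ insert b B then 0 else k i) =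
        (A.erase b \ B).image k :=
      Finset.image_congr fun i hi => if_neg (hsub i hi)
    simp only
    rw [e1, e2]; ring

lemma det_fiber (a : ℤ → R) {n : ℕ} (k : Fin n → ℤ) :
    (Matrix.of fun i j => if k i = k j then a (k i) - (if j < i then 1 else 0) else 0).det =
      ∏ κ ∈ Finset.univ.image k, a κ := by
  induction n with
  | zero => simp
  | succ n ih =>
    set M : Matrix (Fin (n + 1)) (Fin (n + 1)) R :=
      Matrix.of fun i j => if k i = k j then a (k i) - (if j < i then 1 else 0) else 0 with hM
    have hsub : (M.submatrix Fin.succ Fin.succ).det =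
        ∏ κ ∈ Finset.univ.image (fun i => k (Fin.succ i)), a κ := by
      rw [← ih]
      congr 1
      ext i j
      simp [hM]
    have himg : Finset.univ.image k =
        insert (k 0) (Finset.univ.image fun i => k (Fin.succ i)) := by
      ext κ
      simp [Fin.exists_fin_succ, eq_comm]
    by_cases hex : ∃ m : Fin n, k m.succ = k 0
    · have hne : (Finset.univ.filter fun m : Fin n => k m.succ = k 0).Nonempty := by
        obtain ⟨m, hm⟩ := hex
        exact ⟨m, by simpa using hm⟩
      set m := Finset.min' _ hne with hm
      have hkm : k m.succ = k 0 := by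
        have := Finset.min'_mem _ hne
        rw [← hm] at this
        simpa using this
      have hmin : ∀ j : Fin n, k j.succ = k 0 → m ≤ j := fun j hj =>
        Finset.min'_le _ _ (by simpa using hj)
      have hrow : M 0 + (-1 : R) • M m.succ = Pi.single 0 1 := by
        funext j
        refine Fin.cases ?_ (fun j => ?_) j
        · simp [hM, hkm]
        · simp only [hM, Pi.add_apply, Pi.smul_apply, Matrix.of_apply, hkm]
          by_cases hj : k j.succ = k 0
          · have := hmin j hj
            simp [hj, not_lt.2 this]
          · simp [Ne.symm hj]
      rw [← Matrix.det_updateRow_add_smul_self M (Fin.succ_ne_zero m).symm (-1), hrow,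
        Matrix.det_succ_row_zero, Fin.sum_univ_succ, Finset.sum_eq_zero fun i _ => by simp]
      have : ((M.updateRow 0 (Pi.single 0 1)).submatrix Fin.succ (Fin.succAbove 0)) =
          M.submatrix Fin.succ Fin.succ := by
        ext i j
        simp [Matrix.updateRow_ne]
      rw [this, hsub, himg, Finset.insert_eq_of_mem]
      · simp
      · exact Finset.mem_image.2 ⟨m, Finset.mem_univ _, hkm⟩
    · push Not at hex
      rw [Matrix.det_succ_row_zero, Fin.sum_univ_succ, Finset.sum_eq_zero fun i _ => by
        simp [hM, (hex i).symm]]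
      rw [show (M.submatrix Fin.succ (Fin.succAbove 0)) = M.submatrix Fin.succ Fin.succ by
        ext i j; simp, hsub, himg, Finset.prod_insert]
      · simp [hM]
      · simpa using hex

end Fourier

/-! ### The ordered cycle integral as a sum over set partitions -/

open MeasureTheory

lemma iteratedDeriv_cexp (n : ℕ) : iteratedDeriv n cexp = cexp := by
  rw [iteratedDeriv_eq_iterate, Complex.iter_deriv_exp]

lemma kroneckerCoeff_iteratedDeriv {τ : ℍ} {e : ℂ} (he : e ∉ periodLattice τ) (N : ℕ) (κ : ℤ) :
    iteratedDeriv N (kroneckerCoeff τ κ) e + kroneckerCoeff τ κ e *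
      ∑ j ∈ Finset.range N, (N.choose j : ℂ) * iteratedDeriv j (kroneckerCoeff τ κ) e =
    kroneckerCoeff τ κ e := by
  set μ := cexp (-(2 * π * I * τ * κ)) with hμ
  have hY : ∀ e, cexp (-(e + 2 * π * I * τ * κ)) = cexp (-e) * μ := fun e => by
    rw [hμ, ← Complex.exp_add]; ring_nf
  have ha : kroneckerCoeff τ κ e * (1 - cexp (-e) * μ) = 1 := by
    rw [kroneckerCoeff, ← hY]; exact inv_mul_cancel₀ (one_sub_exp_ne_zero he κ)
  have hcd := (analyticAt_kroneckerCoeff he κ).contDiffAt (n := N)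
  have hcexp : ContDiffAt ℂ N cexp e := Complex.contDiff_exp.contDiffAt
  have h1 : (fun e => kroneckerCoeff τ κ e * cexp e) =ᶠ[𝓝 e]
      fun e => cexp e + μ * kroneckerCoeff τ κ e := by
    filter_upwards [(isOpen_compl_periodLattice τ).mem_nhds he] with e' he'
    have h := one_sub_exp_ne_zero he' κ
    have h2 : kroneckerCoeff τ κ e' * (1 - cexp (-e') * μ) = 1 := by
      rw [kroneckerCoeff, ← hY]; exact inv_mul_cancel₀ h
    have h3 : cexp e' * cexp (-e') = 1 := by rw [← Complex.exp_add]; simp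
    linear_combination cexp e' * h2 + kroneckerCoeff τ κ e' * μ * h3
  have h2 := h1.iteratedDeriv_eq N
  rw [iteratedDeriv_fun_mul hcd hcexp, iteratedDeriv_fun_add hcexp (contDiffAt_const.mul hcd),
    iteratedDeriv_const_mul_field] at h2
  simp only [iteratedDeriv_cexp] at h2
  rw [← Finset.sum_mul, Finset.sum_range_succ, Nat.choose_self, Nat.cast_one, one_mul] at h2
  have h3 : cexp e * cexp (-e) = 1 := by rw [← Complex.exp_add]; simp
  set s := ∑ j ∈ Finset.range N, (N.choose j : ℂ) * iteratedDeriv j (kroneckerCoeff τ κ) e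
  set p := iteratedDeriv N (kroneckerCoeff τ κ) e
  linear_combination (kroneckerCoeff τ κ e * cexp (-e)) * h2 - p * ha +
    (kroneckerCoeff τ κ e * (1 - s - p)) * h3

lemma integral_exp_int_mul (r : ℝ) (m : ℤ) :
    ∫ t in Icc 0 (2 * π), cexp (m * (r + I * (t : ℂ))) = if m = 0 then (2 * π : ℂ) else 0 := by
  rw [integral_Icc_eq_integral_Ioc, ← intervalIntegral.integral_of_le (by positivity)]
  split_ifs with hm
  · simp [hm]
  · have hm' : (m : ℂ) * I ≠ 0 := mul_ne_zero (by exact_mod_cast hm) I_ne_zero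
    have h1 : ∀ t : ℝ, cexp (m * (r + I * (t : ℂ))) = cexp (m * r) * cexp (m * I * t) := by
      intro t; rw [← Complex.exp_add]; ring_nf
    simp only [h1]
    rw [intervalIntegral.integral_const_mul, integral_exp_mul_complex hm']
    have : cexp (m * I * ((2 * π : ℝ) : ℂ)) = 1 := by
      rw [Complex.exp_eq_one_iff]; exact ⟨m, by push_cast; ring⟩
    rw [this]; simp

lemma volume_restrict_box (n : ℕ) (c : ℝ) :
    (volume : Measure (Fin n → ℝ)).restrict (Icc 0 fun _ => c) =
      Measure.pi fun _ : Fin n => (volume : Measure ℝ).restrict (Icc 0 c) := by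
  rw [← Measure.restrict_pi_pi, ← volume_pi, ← Set.pi_univ_Icc]
  rfl

lemma integral_det_columns {n : ℕ} (c : ℝ) (f : Fin n → Fin n → ℝ → ℂ)
    (hf : ∀ i j, Continuous (f i j)) :
    ∫ t in Icc (0 : Fin n → ℝ) (fun _ => c), (Matrix.of fun i j => f i j (t j)).det =
      (Matrix.of fun i j => ∫ s in Icc 0 c, f i j s).det := by
  simp only [Matrix.det_apply', Matrix.of_apply]
  rw [integral_finsetSum]
  · refine Finset.sum_congr rfl fun σ _ => ?_
    rw [integral_const_mul, volume_restrict_box,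
      integral_fintype_prod_eq_prod (fun i : Fin n => f (σ i) i)]
  · intro σ _
    refine Continuous.integrableOn_Icc ?_
    refine continuous_const.mul (continuous_finsetProd _ fun i _ => ?_)
    exact (hf _ _).comp (continuous_apply i)

lemma det_sum_rows {R : Type*} [CommRing R] {n : ℕ} (K : Finset ℤ) (f : Fin n → Fin n → ℤ → R) :
    (Matrix.of fun i j => ∑ k ∈ K, f i j k).det =
      ∑ k ∈ Fintype.piFinset (fun _ : Fin n => K), (Matrix.of fun i j => f i j (k i)).det := by
  rw [← Matrix.det_transpose, Matrix.det_apply']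
  simp only [Matrix.transpose_apply, Matrix.of_apply, Finset.prod_univ_sum, Finset.mul_sum]
  rw [Finset.sum_comm]
  refine Finset.sum_congr rfl fun k _ => ?_
  rw [← Matrix.det_transpose, Matrix.det_apply']
  rfl

lemma det_exp_kernel {n : ℕ} (b : Fin n → Fin n → ℂ) (k : Fin n → ℤ) (z w : Fin n → ℂ) :
    (Matrix.of fun i j => b i j * cexp (k i * (z i + w i - w j))).det =
      (∏ i, cexp (k i * z i)) *
        (Matrix.of fun i j => b i j * cexp (((k j - k i : ℤ) : ℂ) * w j)).det := by
  have h1 : (Matrix.of fun i j => b i j * cexp (k i * (z i + w i - w j))) =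
      Matrix.of fun i j => (cexp (k i * z i) * cexp (k i * w i)) *
        (Matrix.of fun i j => cexp (-(k j * w j)) *
          (Matrix.of fun i j => b i j * cexp (((k j - k i : ℤ) : ℂ) * w j)) i j) i j := by
    ext i j
    simp only [Matrix.of_apply]
    rw [show cexp (k i * z i) * cexp (k i * w i) * (cexp (-(k j * w j)) *
      (b i j * cexp (((k j - k i : ℤ) : ℂ) * w j))) = b i j * (cexp (k i * z i) *
        cexp (k i * w i) * cexp (-(k j * w j)) * cexp (((k j - k i : ℤ) : ℂ) * w j)) by ring,
      ← Complex.exp_add, ← Complex.exp_add, ← Complex.exp_add]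
    congr 2
    push_cast; ring
  rw [h1, Matrix.det_mul_column, Matrix.det_mul_row, Finset.prod_mul_distrib, mul_assoc,
    ← mul_assoc (∏ i, cexp (k i * w i)), ← Finset.prod_mul_distrib]
  simp [← Complex.exp_add]

section

variable {n : ℕ} {τ : ℍ} {z : Fin n → ℂ} {r : Fin n → ℝ}

/-- The Fourier coefficients of the Kronecker function in the strip containing `P_i - Q_j`. -/
def orderedCoeff (τ : ℍ) (e : ℂ) (i j : Fin n) (k : ℤ) : ℂ :=
  kroneckerCoeff τ k e - if j < i then 1 else 0

/-- The points `log v_j` of the torus. -/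
def torusPoint (r : Fin n → ℝ) (t : Fin n → ℝ) (j : Fin n) : ℂ := (r j : ℂ) + I * (t j : ℂ)

lemma integral_det_truncated {e : ℂ} (he : e ∉ periodLattice τ) (z : Fin n → ℂ) (r : Fin n → ℝ)
    (K : Finset ℤ) :
    ∫ t in Icc (0 : Fin n → ℝ) (fun _ => 2 * π), (Matrix.of fun i j => ∑ k ∈ K,
        orderedCoeff τ e i j k * cexp (k * (z i + torusPoint r t i - torusPoint r t j))).det =
      (2 * π) ^ n * moment (fun B => ∑ κ ∈ K,
        iteratedDeriv (B.card - 1) (kroneckerCoeff τ κ) e * cexp (κ * ∑ i ∈ B, z i))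
          Finset.univ := by
  have hcont : ∀ j : Fin n, Continuous fun t => torusPoint r t j := fun j => by
    unfold torusPoint; fun_prop
  simp only [det_sum_rows, det_exp_kernel]
  rw [integral_finsetSum]
  swap
  · intro k _
    refine Continuous.integrableOn_Icc (continuous_const.mul (Continuous.matrix_det ?_))
    refine continuous_matrix fun i j => ?_
    have := hcont j
    simp only [Matrix.of_apply]
    fun_prop
  have h1 : ∀ k : Fin n → ℤ, ∫ t in Icc (0 : Fin n → ℝ) (fun _ => 2 * π),
      (∏ i, cexp (k i * z i)) * (Matrix.of fun i j => orderedCoeff τ e i j (k i) *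
        cexp (((k j - k i : ℤ) : ℂ) * torusPoint r t j)).det =
      (2 * π) ^ n * ((∏ i, cexp (k i * z i)) *
        ∏ κ ∈ Finset.univ.image k, kroneckerCoeff τ κ e) := by
    intro k
    rw [integral_const_mul, ← det_fiber (fun κ => kroneckerCoeff τ κ e)]
    have h2 := integral_det_columns (n := n) (2 * π) (fun i j s => orderedCoeff τ e i j (k i) *
        cexp (((k j - k i : ℤ) : ℂ) * ((r j : ℂ) + I * (s : ℂ)))) (fun i j => by fun_prop)
    unfold torusPoint
    rw [h2, mul_left_comm]
    congr 1
    have h3 : (Matrix.of fun i j : Fin n => ∫ s in Icc 0 (2 * π), orderedCoeff τ e i j (k i) *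
        cexp (((k j - k i : ℤ) : ℂ) * ((r j : ℂ) + I * (s : ℂ)))) =
        (2 * π : ℂ) • Matrix.of fun i j => if k i = k j then
          kroneckerCoeff τ (k i) e - (if j < i then 1 else 0) else 0 := by
      ext i j
      rw [Matrix.of_apply, integral_const_mul, integral_exp_int_mul, Matrix.smul_apply,
        Matrix.of_apply]
      by_cases h : k i = k j
      · simp [h, orderedCoeff, mul_comm]
      · have : k j - k i ≠ 0 := fun h' => h (by linarith)
        simp [h, this]
    rw [h3, Matrix.det_smul, Fintype.card_fin]
  rw [Finset.sum_congr rfl fun k _ => h1 k, ← Finset.mul_sum]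
  congr 1
  have h4 := sum_prod_image_eq_moment (ι := Fin n) (a := fun κ => kroneckerCoeff τ κ e)
    (p := fun N κ => iteratedDeriv N (kroneckerCoeff τ κ) e)
    (kroneckerCoeff_iteratedDeriv he) (fun κ i => cexp (κ * z i)) K Finset.univ
  simp only [Finset.mem_univ, if_true] at h4
  rw [h4]
  refine moment_congr fun B _ _ => Finset.sum_congr rfl fun κ _ => ?_
  rw [← Complex.exp_sum, Finset.mul_sum]

lemma InOmegaGW.re_pos (h : InOmegaGW τ z r) (i : Fin n) : 0 < (z i).re := by
  linarith [h.1 i]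

lemma sum_sub_le_of_interlaced {n : ℕ} (a r : Fin (n + 1) → ℝ)
    (h : ∀ i j, i < j → a j < r i) : ∑ i, (a i - r i) ≤ a 0 - r (Fin.last n) := by
  induction n with
  | zero => simp
  | succ n ih =>
    have := ih (fun i => a i.succ) (fun i => r i.succ) fun i j hij =>
      h _ _ (Fin.succ_lt_succ_iff.2 hij)
    rw [Fin.sum_univ_succ]
    have h2 := h 0 (Fin.succ 0) (Fin.succ_pos 0)
    rw [Fin.succ_last] at this
    linarith

lemma InOmegaGW.sum_re_lt (h : InOmegaGW τ z r) {B : Finset (Fin n)} (hB : B.Nonempty) :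
    0 < (∑ i ∈ B, z i).re ∧ (∑ i ∈ B, z i).re < imPeriod τ := by
  rw [Complex.re_sum]
  refine ⟨Finset.sum_pos (fun i _ => h.re_pos i) hB, ?_⟩
  obtain ⟨i, hi⟩ := hB
  obtain ⟨n, rfl⟩ : ∃ k, n = k + 1 := ⟨n - 1, by have := i.2; omega⟩
  have h1 := sum_sub_le_of_interlaced (fun i => (z i).re + r i) r h.2.1
  have h2 := h.2.2 0 (Fin.last n)
  have h3 : ∑ i ∈ B, (z i).re ≤ ∑ i, (z i).re :=
    Finset.sum_le_sum_of_subset_of_nonneg (Finset.subset_univ _) fun i _ _ => (h.re_pos i).le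
  simp only [add_sub_cancel_right] at h1
  unfold imPeriod
  linarith

lemma re_kernel (z : Fin n → ℂ) (r t : Fin n → ℝ) (i j : Fin n) :
    (z i + torusPoint r t i - torusPoint r t j).re = (z i).re + r i - r j := by
  simp [torusPoint]

lemma InOmegaGW.kernel_le (h : InOmegaGW τ z r) (t : Fin n → ℝ) {i j : Fin n} (hij : i ≤ j) :
    0 < (z i + torusPoint r t i - torusPoint r t j).re ∧
      (z i + torusPoint r t i - torusPoint r t j).re < imPeriod τ := by
  rw [re_kernel]
  refine ⟨?_, h.2.2 i j⟩
  rcases hij.eq_or_lt with rfl | hlt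
  · linarith [h.re_pos i]
  · linarith [h.re_pos i, h.re_pos j, h.2.1 i j hlt]

lemma InOmegaGW.kernel_lt (h : InOmegaGW τ z r) (t : Fin n → ℝ) {i j : Fin n} (hij : j < i) :
    -imPeriod τ < (z i + torusPoint r t i - torusPoint r t j).re ∧
      (z i + torusPoint r t i - torusPoint r t j).re < 0 := by
  rw [re_kernel]
  have h1 := h.2.2 j i
  rw [← imPeriod] at h1
  exact ⟨by linarith [h.re_pos i, h.re_pos j], by linarith [h.2.1 j i hij]⟩

lemma InOmegaGW.theta_kernel_ne_zero (h : InOmegaGW τ z r) (t : Fin n → ℝ) (i j : Fin n) :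
    theta τ (z i + torusPoint r t i - torusPoint r t j) ≠ 0 := by
  rcases le_or_gt i j with hij | hij
  · exact theta_ne_zero (notMem_periodLattice_of_re (h.kernel_le t hij).1 (h.kernel_le t hij).2)
  · have := h.kernel_lt t hij
    rw [← neg_neg (z i + torusPoint r t i - torusPoint r t j), theta_neg, neg_ne_zero]
    refine theta_ne_zero (notMem_periodLattice_of_re ?_ ?_)
    · rw [Complex.neg_re]; linarith
    · rw [Complex.neg_re]; linarith

lemma InOmegaGW.hasSum_kernel (h : InOmegaGW τ z r) {e : ℂ} (he : e ∉ periodLattice τ)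
    (t : Fin n → ℝ) (i j : Fin n) :
    HasSum (fun k : ℤ => orderedCoeff τ e i j k *
        cexp (k * (z i + torusPoint r t i - torusPoint r t j)))
      (kronecker τ e (z i + torusPoint r t i - torusPoint r t j)) := by
  rcases le_or_gt i j with hij | hij
  · simpa [orderedCoeff, not_lt.2 hij] using
      hasSum_kronecker (h.kernel_le t hij).1 (h.kernel_le t hij).2 he
  · simpa [orderedCoeff, hij] using
      hasSum_kronecker_of_neg (h.kernel_lt t hij).1 (h.kernel_lt t hij).2 he

lemma norm_exp_kernel (z : Fin n → ℂ) (r t : Fin n → ℝ) (i j : Fin n) (k : ℤ) :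
    ‖cexp (k * (z i + torusPoint r t i - torusPoint r t j))‖ =
      ‖cexp (k * (z i + torusPoint r 0 i - torusPoint r 0 j))‖ := by
  rw [Complex.norm_exp, Complex.norm_exp]
  congr 1
  simp only [Complex.mul_re, re_kernel, Complex.intCast_im, zero_mul]

lemma InOmegaGW.integral_det (h : InOmegaGW τ z r) {e : ℂ} (he : e ∉ periodLattice τ) :
    ∫ t in Icc (0 : Fin n → ℝ) (fun _ => 2 * π), (Matrix.of fun i j =>
        kronecker τ e (z i + torusPoint r t i - torusPoint r t j)).det =
      (2 * π) ^ n * moment (fun B =>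
        iteratedDeriv (B.card - 1) (fun e => kronecker τ e (∑ i ∈ B, z i)) e) Finset.univ := by
  have hcont : ∀ j : Fin n, Continuous fun t => torusPoint r t j := fun j => by
    unfold torusPoint; fun_prop
  set C : Fin n → Fin n → ℝ := fun i j => ∑' k : ℤ, ‖orderedCoeff τ e i j k *
    cexp (k * (z i + torusPoint r 0 i - torusPoint r 0 j))‖ with hC
  have hC0 : ∀ i j, 0 ≤ C i j := fun i j => tsum_nonneg fun _ => norm_nonneg _
  set x := ∑ i, ∑ j, C i j with hx
  have hCx : ∀ i j, C i j ≤ x := fun i j =>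
    (Finset.single_le_sum (f := fun j => C i j) (fun j _ => hC0 i j) (Finset.mem_univ j)).trans
      (Finset.single_le_sum (f := fun i => ∑ j, C i j)
        (fun i _ => Finset.sum_nonneg fun j _ => hC0 i j) (Finset.mem_univ i))
  have hbound : ∀ (K : Finset ℤ) (t : Fin n → ℝ) (i j : Fin n),
      ‖∑ k ∈ K, orderedCoeff τ e i j k *
        cexp (k * (z i + torusPoint r t i - torusPoint r t j))‖ ≤ x := by
    intro K t i j
    refine ((norm_sum_le _ _).trans ?_).trans (hCx i j)
    have : ∀ k : ℤ, ‖orderedCoeff τ e i j k *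
        cexp (k * (z i + torusPoint r t i - torusPoint r t j))‖ = ‖orderedCoeff τ e i j k *
        cexp (k * (z i + torusPoint r 0 i - torusPoint r 0 j))‖ := fun k => by
      rw [norm_mul, norm_mul, norm_exp_kernel]
    rw [Finset.sum_congr rfl fun k _ => this k]
    exact (h.hasSum_kernel he 0 i j).summable.norm.sum_le_tsum K fun _ _ => norm_nonneg _
  have hlim1 : Tendsto (fun K : Finset ℤ => ∫ t in Icc (0 : Fin n → ℝ) (fun _ => 2 * π),
      (Matrix.of fun i j => ∑ k ∈ K, orderedCoeff τ e i j k *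
        cexp (k * (z i + torusPoint r t i - torusPoint r t j))).det) atTop
      (𝓝 (∫ t in Icc (0 : Fin n → ℝ) (fun _ => 2 * π), (Matrix.of fun i j =>
        kronecker τ e (z i + torusPoint r t i - torusPoint r t j)).det)) := by
    refine tendsto_integral_filter_of_dominated_convergence
      (fun _ => (Fintype.card (Fin n)).factorial • x ^ Fintype.card (Fin n)) ?_ ?_ ?_ ?_
    · refine Eventually.of_forall fun K => Continuous.aestronglyMeasurable
        (Continuous.matrix_det (continuous_matrix fun i j => ?_))
      have := hcont j
      have := hcont i
      simp only [Matrix.of_apply]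
      fun_prop
    · refine Eventually.of_forall fun K => Eventually.of_forall fun t => ?_
      exact Matrix.det_le (abv := NormedField.toAbsoluteValue ℂ) fun i j => hbound K t i j
    · exact (continuous_const.integrableOn_Icc)
    · refine Eventually.of_forall fun t => ?_
      have hc : Continuous fun A : Matrix (Fin n) (Fin n) ℂ => A.det :=
        Continuous.matrix_det continuous_id
      refine (hc.tendsto _).comp ?_
      exact tendsto_pi_nhds.2 fun i => tendsto_pi_nhds.2 fun j => h.hasSum_kernel he t i j
  simp only [integral_det_truncated he] at hlim1
  refine tendsto_nhds_unique hlim1 (Tendsto.const_mul _ (tendsto_moment fun B _ hB => ?_))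
  exact tendsto_sum_iteratedDeriv_kroneckerCoeff (h.sum_re_lt hB).1 (h.sum_re_lt hB).2 he _

theorem InOmegaGW.theta_mul_cycleIntegral (h : InOmegaGW τ z r) {e : ℂ}
    (he : ∀ s : Finset (Fin n), e + ∑ i ∈ s, z i ∉ periodLattice τ) :
    theta τ (e + ∑ i, z i) * cycleIntegral τ z r = theta τ (∑ i, z i) * theta τ e *
      moment (fun B => iteratedDeriv (B.card - 1) (fun e => kronecker τ e (∑ i ∈ B, z i)) e)
        Finset.univ := by
  have he0 : e ∉ periodLattice τ := by simpa using he ∅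
  have hθ := theta_ne_zero he0
  have h1 := h.integral_det he0
  have h2 : ∀ t : Fin n → ℝ, (Matrix.of fun i j =>
      kronecker τ e (z i + torusPoint r t i - torusPoint r t j)).det =
      theta τ (e + ∑ i, z i) / theta τ e *
        bigTheta τ (fun i => z i + torusPoint r t i) (torusPoint r t) := by
    intro t
    have := det_kronecker (τ := τ) e (fun i => z i + torusPoint r t i) (torusPoint r t)
      (h.theta_kernel_ne_zero t) (fun s => by
        simpa only [add_sub_cancel_right] using theta_ne_zero (he s))
    simpa only [add_sub_cancel_right] using this
  simp only [h2] at h1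
  rw [integral_const_mul] at h1
  have h3 : cycleIntegral τ z r = (1 / (2 * π * I)) ^ n * (I ^ n * (theta τ (∑ i, z i) *
      ∫ t in Icc (0 : Fin n → ℝ) (fun _ => 2 * π),
        bigTheta τ (fun i => z i + torusPoint r t i) (torusPoint r t))) := by
    rw [cycleIntegral, integral_const_mul, ← integral_const_mul (theta τ (∑ i, z i))]
    rfl
  have hpi : (2 * π : ℂ) ≠ 0 := by
    simp [Real.pi_ne_zero]
  have hI : (1 / (2 * π * I)) ^ n * I ^ n * (2 * π) ^ n = 1 := by
    rw [← mul_pow, ← mul_pow]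
    have : 1 / (2 * π * I) * I * (2 * π) = 1 := by
      field_simp
    rw [this, one_pow]
  rw [h3]
  set J := ∫ t in Icc (0 : Fin n → ℝ) (fun _ => 2 * π),
        bigTheta τ (fun i => z i + torusPoint r t i) (torusPoint r t)
  set M := moment (fun B => iteratedDeriv (B.card - 1)
    (fun e => kronecker τ e (∑ i ∈ B, z i)) e) Finset.univ
  have h4 : theta τ (e + ∑ i, z i) * J = theta τ e * ((2 * π) ^ n * M) := by
    rw [← h1]; field_simp
  linear_combination ((1 / (2 * π * I)) ^ n * I ^ n * theta τ (∑ i, z i)) * h4 +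
    theta τ (∑ i, z i) * theta τ e * M * hI

end

/-! ### Power series of the Kronecker function -/

/-- `f` is analytic at `0` with Taylor series `P`. -/
def HasTaylor (f : ℂ → ℂ) (P : PowerSeries ℂ) : Prop :=
  AnalyticAt ℂ f 0 ∧ ∀ j, iteratedDeriv j f 0 = (Nat.factorial j : ℂ) * PowerSeries.coeff j P

namespace HasTaylor

variable {f g : ℂ → ℂ} {P Q : PowerSeries ℂ}

lemma congr (h : HasTaylor f P) (hfg : f =ᶠ[𝓝 0] g) : HasTaylor g P :=
  ⟨h.1.congr hfg, fun j => by rw [← h.2 j]; exact hfg.symm.iteratedDeriv_eq j⟩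

lemma unique (h : HasTaylor f P) (h' : HasTaylor f Q) : P = Q := by
  ext j
  have := (h.2 j).symm.trans (h'.2 j)
  exact mul_left_cancel₀ (by exact_mod_cast Nat.factorial_ne_zero j) this

lemma _root_.AnalyticAt.hasTaylor (h : AnalyticAt ℂ f 0) :
    HasTaylor f (PowerSeries.mk fun j => iteratedDeriv j f 0 / (Nat.factorial j : ℂ)) :=
  ⟨h, fun j => by
    have : (Nat.factorial j : ℂ) ≠ 0 := by exact_mod_cast Nat.factorial_ne_zero j
    rw [PowerSeries.coeff_mk]; field_simp⟩

lemma const (a : ℂ) : HasTaylor (fun _ => a) (PowerSeries.C a) := by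
  refine ⟨analyticAt_const, fun j => ?_⟩
  rw [iteratedDeriv_const, PowerSeries.coeff_C]
  split_ifs with h
  · simp [h]
  · simp

lemma id : HasTaylor (fun e => e) PowerSeries.X := by
  refine ⟨analyticAt_id, fun j => ?_⟩
  rw [PowerSeries.coeff_X]
  rcases j with _ | _ | j
  · simp
  · simp
  · rw [iteratedDeriv_succ', deriv_id'', iteratedDeriv_const]
    simp

lemma add (h : HasTaylor f P) (h' : HasTaylor g Q) : HasTaylor (fun e => f e + g e) (P + Q) :=
  ⟨h.1.add h'.1, fun j => by
    rw [iteratedDeriv_fun_add h.1.contDiffAt h'.1.contDiffAt, h.2, h'.2, map_add, mul_add]⟩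

lemma mul (h : HasTaylor f P) (h' : HasTaylor g Q) : HasTaylor (fun e => f e * g e) (P * Q) := by
  refine ⟨h.1.mul h'.1, fun N => ?_⟩
  rw [iteratedDeriv_fun_mul h.1.contDiffAt h'.1.contDiffAt, PowerSeries.coeff_mul,
    Finset.Nat.sum_antidiagonal_eq_sum_range_succ
      (fun i j => PowerSeries.coeff i P * PowerSeries.coeff j Q), Finset.mul_sum]
  refine Finset.sum_congr rfl fun i hi => ?_
  have hi' : i ≤ N := Nat.lt_succ_iff.1 (Finset.mem_range.1 hi)
  rw [h.2, h'.2, ← Nat.choose_mul_factorial_mul_factorial hi']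
  push_cast; ring

lemma deriv (h : HasTaylor f P) : HasTaylor (deriv f) (PowerSeries.derivative ℂ P) :=
  ⟨h.1.deriv, fun j => by
    rw [← iteratedDeriv_succ', h.2, PowerSeries.coeff_derivative, Nat.factorial_succ]
    push_cast; ring⟩

lemma pow (h : HasTaylor f P) (n : ℕ) : HasTaylor (fun e => f e ^ n) (P ^ n) := by
  induction n with
  | zero => simpa using const 1
  | succ n ih => simpa only [pow_succ] using ih.mul h

end HasTaylor

section Series

variable {R S : Type*} [CommRing R] [Algebra ℂ R] [CommRing S] [Algebra ℂ S]

/-- The coefficients of `exp (∑ m, E m X^(m+1) / (m+1)!)`. -/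
def expCoeff (E : ℕ → R) : ℕ → R
  | 0 => 1
  | j + 1 => (1 / (j + 1) : ℂ) •
      ∑ i : Fin (j + 1), ((1 / (Nat.factorial i) : ℂ) • E i) * expCoeff E (j - i)
termination_by j => j

lemma expCoeff_zero (E : ℕ → R) : expCoeff E 0 = 1 := by rw [expCoeff]

lemma expCoeff_succ (E : ℕ → R) (j : ℕ) : expCoeff E (j + 1) = (1 / (j + 1) : ℂ) •
    ∑ i ∈ Finset.range (j + 1), ((1 / (Nat.factorial i) : ℂ) • E i) * expCoeff E (j - i) := by
  rw [expCoeff, Finset.sum_range]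

lemma map_expCoeff (f : R →ₐ[ℂ] S) (E : ℕ → R) (j : ℕ) :
    f (expCoeff E j) = expCoeff (fun m => f (E m)) j := by
  induction j using Nat.strong_induction_on with
  | _ j ih =>
    rcases j with _ | j
    · simp [expCoeff_zero]
    · rw [expCoeff_succ, expCoeff_succ, map_smul, map_sum]
      congr 1
      refine Finset.sum_congr rfl fun i _ => ?_
      rw [map_mul, map_smul, ih _ (by omega)]

/-- The polynomial `(j - 1)(j - 2) ⋯ (j - l + 1)`. -/
def blockFactor (l j : ℕ) : ℂ := ∏ t ∈ Finset.range (l - 1), ((j : ℂ) - (t + 1))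

/-- The power series of `e^l ∂_e^(l-1) (exp (∑ m, E m e^(m+1) / (m+1)!) / e)`. -/
def blockSeries (E : ℕ → R) (l : ℕ) : PowerSeries R :=
  PowerSeries.mk fun j => blockFactor l j • expCoeff E j

lemma map_blockSeries (f : R →ₐ[ℂ] S) (E : ℕ → R) (l : ℕ) :
    PowerSeries.map (f : R →+* S) (blockSeries E l) = blockSeries (fun m => f (E m)) l := by
  ext j
  simp [blockSeries, map_expCoeff]

end Series

lemma blockSeries_succ_succ (E : ℕ → ℂ) (k : ℕ) :
    blockSeries E (k + 2) = PowerSeries.X * PowerSeries.derivative ℂ (blockSeries E (k + 1)) +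
      PowerSeries.C (-(k + 1 : ℂ)) * blockSeries E (k + 1) := by
  ext j
  have h : blockFactor (k + 2) j = ((j : ℂ) - (k + 1)) * blockFactor (k + 1) j := by
    simp [blockFactor, Finset.prod_range_succ, mul_comm]
  rw [map_add, PowerSeries.coeff_C_mul]
  rcases j with _ | j
  · simp [blockSeries, h]
    ring
  · rw [PowerSeries.coeff_succ_X_mul, PowerSeries.coeff_derivative]
    simp only [blockSeries, PowerSeries.coeff_mk, h, smul_eq_mul]
    push_cast; ring

section

variable {τ : ℍ} {y : ℂ}

/-- `e` times the Kronecker function, as a function analytic at `e = 0`. -/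
def kroneckerReg (τ : ℍ) (y e : ℂ) : ℂ := theta τ (y + e) / (theta τ y * thetaReg τ e)

/-- `e^(k+1) ∂_e^k` applied to the Kronecker function. -/
def blockFun (τ : ℍ) (y : ℂ) : ℕ → ℂ → ℂ
  | 0 => kroneckerReg τ y
  | k + 1 => fun e => e * deriv (blockFun τ y k) e + -(k + 1 : ℂ) * blockFun τ y k e

lemma isOpen_thetaReg_ne_zero (τ : ℍ) : IsOpen {e | thetaReg τ e ≠ 0} :=
  (isOpen_ne (x := (0 : ℂ))).preimage (differentiable_thetaReg τ).continuous

lemma analyticOnNhd_blockFun (hy : y ∉ periodLattice τ) (k : ℕ) :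
    AnalyticOnNhd ℂ (blockFun τ y k) {e | thetaReg τ e ≠ 0} := by
  induction k with
  | zero =>
    refine DifferentiableOn.analyticOnNhd (fun e he => ?_) (isOpen_thetaReg_ne_zero τ)
    have h1 := differentiable_theta τ
    have h2 := differentiable_thetaReg τ
    refine DifferentiableAt.differentiableWithinAt (DifferentiableAt.fun_div (by fun_prop)
      (by fun_prop) (mul_ne_zero (theta_ne_zero hy) he))
  | succ k ih =>
    exact (analyticOnNhd_id.mul ih.deriv).add (analyticOnNhd_const.mul ih)

lemma ne_zero_of_notMem_periodLattice {e : ℂ} (he : e ∉ periodLattice τ) : e ≠ 0 := by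
  rintro rfl; exact he (zero_mem_periodLattice τ)

lemma pow_mul_iteratedDeriv_kronecker (hy : y ∉ periodLattice τ) (k : ℕ) {e : ℂ}
    (he : e ∉ periodLattice τ) :
    e ^ (k + 1) * iteratedDeriv k (fun e => kronecker τ e y) e = blockFun τ y k e := by
  induction k generalizing e with
  | zero =>
    have h0 := ne_zero_of_notMem_periodLattice he
    have h1 := theta_ne_zero hy
    have h2 := thetaReg_ne_zero he
    simp only [iteratedDeriv_zero, blockFun, kronecker, kroneckerReg, theta_eq_mul_thetaReg τ e]
    field_simp
    ring
  | succ k ih =>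
    have h0 := ne_zero_of_notMem_periodLattice he
    have heq : iteratedDeriv k (fun e => kronecker τ e y) =ᶠ[𝓝 e]
        fun e => blockFun τ y k e / e ^ (k + 1) := by
      filter_upwards [(isOpen_compl_periodLattice τ).mem_nhds he] with e' he'
      have h0' := ne_zero_of_notMem_periodLattice he'
      rw [← ih he']; field_simp
    have hd := (analyticOnNhd_blockFun hy k e (thetaReg_ne_zero he)).differentiableAt
    rw [iteratedDeriv_succ, heq.deriv_eq,
      (hd.hasDerivAt.fun_div (hasDerivAt_pow (k + 1) e) (pow_ne_zero _ h0)).deriv]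
    simp only [blockFun, Nat.add_sub_cancel]
    push_cast
    field_simp
    ring

lemma hasTaylor_kroneckerReg (hy : y ∉ periodLattice τ) :
    HasTaylor (kroneckerReg τ y)
      (PowerSeries.mk fun j => expCoeff (fun m => eStar (m + 1) τ y) j) := by
  have hθ := differentiable_theta τ
  have hr := differentiable_thetaReg τ
  have hy0 := theta_ne_zero hy
  have hr0 : thetaReg τ 0 ≠ 0 := by rw [thetaReg_zero]; exact one_ne_zero
  have hg : AnalyticAt ℂ (kroneckerReg τ y) 0 := analyticOnNhd_blockFun hy 0 0 hr0
  set H : ℂ → ℂ := fun e => logDeriv (theta τ) (y + e) + psi τ e with hH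
  have hA1 : AnalyticAt ℂ (fun e => logDeriv (theta τ) (y + e)) 0 := by
    have h1 : AnalyticAt ℂ (logDeriv (theta τ)) (y + 0) := by
      rw [add_zero]; exact analyticAt_logDeriv_theta hy
    exact h1.comp_of_eq (analyticAt_const.add analyticAt_id) rfl
  have hHA : AnalyticAt ℂ H 0 := hA1.add (analyticAt_psi τ)
  have hH0 : ∀ m, iteratedDeriv m H 0 = eStar (m + 1) τ y := by
    intro m
    rw [hH, iteratedDeriv_fun_add hA1.contDiffAt (analyticAt_psi τ).contDiffAt,
      iteratedDeriv_psi_zero, eStar, iteratedDeriv_comp_const_add]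
    simp
  have hode : deriv (kroneckerReg τ y) =ᶠ[𝓝 0] fun e => H e * kroneckerReg τ y e := by
    have hopen : ∀ᶠ e in 𝓝 (0 : ℂ), y + e ∉ periodLattice τ := by
      have : ContinuousAt (fun e : ℂ => y + e) 0 := by fun_prop
      exact this.eventually_mem
        ((isOpen_compl_periodLattice τ).mem_nhds (by simpa using hy))
    filter_upwards [(isOpen_thetaReg_ne_zero τ).mem_nhds hr0, hopen] with e he he2
    have he : thetaReg τ e ≠ 0 := he
    have hye := theta_ne_zero he2
    have d1 : HasDerivAt (fun e => theta τ (y + e)) (deriv (theta τ) (y + e)) e :=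
      (hθ (y + e)).hasDerivAt.comp_const_add y e
    have d2 : HasDerivAt (fun e => theta τ y * thetaReg τ e)
        (theta τ y * deriv (thetaReg τ) e) e := (hr e).hasDerivAt.const_mul _
    have := (d1.fun_div d2 (mul_ne_zero hy0 he)).deriv
    unfold kroneckerReg
    rw [this, hH]
    simp only [psi, logDeriv_apply]
    field_simp
    ring
  refine ⟨hg, fun j => ?_⟩
  rw [PowerSeries.coeff_mk]
  induction j using Nat.strong_induction_on with
  | _ j ih =>
    rcases j with _ | j
    · rw [iteratedDeriv_zero, expCoeff_zero, kroneckerReg, thetaReg_zero]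
      simp [div_self hy0]
    · rw [iteratedDeriv_succ', hode.iteratedDeriv_eq,
        iteratedDeriv_fun_mul hHA.contDiffAt hg.contDiffAt, expCoeff_succ, Finset.smul_sum,
        Finset.mul_sum]
      refine Finset.sum_congr rfl fun i hi => ?_
      have hi' : i ≤ j := Nat.lt_succ_iff.1 (Finset.mem_range.1 hi)
      rw [hH0, ih _ (by omega), Nat.factorial_succ, ← Nat.choose_mul_factorial_mul_factorial hi']
      have h1 : (Nat.factorial i : ℂ) ≠ 0 := by exact_mod_cast Nat.factorial_ne_zero i
      have h2 : (j + 1 : ℂ) ≠ 0 := by exact_mod_cast Nat.succ_ne_zero j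
      simp only [smul_eq_mul]
      push_cast
      field_simp

lemma hasTaylor_blockFun (hy : y ∉ periodLattice τ) (k : ℕ) :
    HasTaylor (blockFun τ y k) (blockSeries (fun m => eStar (m + 1) τ y) (k + 1)) := by
  induction k with
  | zero =>
    have : blockSeries (fun m => eStar (m + 1) τ y) (0 + 1) =
        PowerSeries.mk fun j => expCoeff (fun m => eStar (m + 1) τ y) j := by
      ext j; simp [blockSeries, blockFactor]
    rw [this]
    exact hasTaylor_kroneckerReg hy
  | succ k ih =>
    rw [blockSeries_succ_succ]
    exact (HasTaylor.id.mul ih.deriv).add ((HasTaylor.const _).mul ih)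

end

/-! ### The continuation of the cycle integral -/

section

variable {n : ℕ} {τ : ℍ} {z : Fin n → ℂ}

/-- The generating series `e^n ∑_π ∏_B ∂_e^(|B|-1) (θ(z_B + e) / (θ(z_B) θ(e)))`. -/
def momentSeries (τ : ℍ) (z : Fin n → ℂ) : PowerSeries ℂ :=
  moment (fun B => blockSeries (fun m => eStar (m + 1) τ (∑ i ∈ B, z i)) B.card) Finset.univ

lemma hasTaylor_moment (hz : z ∈ regularLocus n τ) :
    HasTaylor (fun e => moment (fun B => blockFun τ (∑ i ∈ B, z i) (B.card - 1) e) Finset.univ)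
      (momentSeries τ z) := by
  have h1 : (fun e => moment (fun B => blockFun τ (∑ i ∈ B, z i) (B.card - 1) e)
      (Finset.univ : Finset (Fin n))) =
      moment (fun B e => blockFun τ (∑ i ∈ B, z i) (B.card - 1) e) Finset.univ := by
    funext e
    exact (map_moment (Pi.evalRingHom (fun _ : ℂ => ℂ) e)
      (fun B e => blockFun τ (∑ i ∈ B, z i) (B.card - 1) e) Finset.univ).symm
  rw [h1]
  refine moment_rel HasTaylor ?_ ?_ (fun h h' => h.add h') (fun h h' => h.mul h') _ ?_
  · have := HasTaylor.const 0
    rwa [map_zero] at this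
  · have := HasTaylor.const 1
    rwa [map_one] at this
  · intro B _ hB
    have := hasTaylor_blockFun (hz B hB) (B.card - 1)
    rwa [Nat.sub_add_cancel (Finset.card_pos.2 hB)] at this

lemma InOmegaGW.mem_regularLocus {r : Fin n → ℝ} (h : InOmegaGW τ z r) : z ∈ regularLocus n τ :=
  fun _ hI => notMem_periodLattice_of_re (h.sum_re_lt hI).1 (h.sum_re_lt hI).2

lemma InOmegaGW.momentSeries_eq {r : Fin n → ℝ} (h : InOmegaGW τ z r) (hn : 1 ≤ n) :
    ∃ P : PowerSeries ℂ, momentSeries τ z = PowerSeries.X ^ (n - 1) * P ∧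
      PowerSeries.coeff 0 P = cycleIntegral τ z r := by
  have hz := h.mem_regularLocus
  have hne : (Finset.univ : Finset (Fin n)).Nonempty := ⟨⟨0, hn⟩, Finset.mem_univ _⟩
  have hS := hz Finset.univ hne
  have hS0 := theta_ne_zero hS
  have hr0 : thetaReg τ 0 ≠ 0 := by rw [thetaReg_zero]; exact one_ne_zero
  set Rf : ℂ → ℂ := fun e => cycleIntegral τ z r * kroneckerReg τ (∑ i, z i) e with hRf
  have hRA : AnalyticAt ℂ Rf 0 := analyticAt_const.mul (analyticOnNhd_blockFun hS 0 0 hr0)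
  refine ⟨PowerSeries.mk fun j => iteratedDeriv j Rf 0 / (Nat.factorial j : ℂ), ?_, ?_⟩
  swap
  · rw [PowerSeries.coeff_mk, iteratedDeriv_zero, hRf]
    simp [kroneckerReg, thetaReg_zero, div_self hS0]
  refine (hasTaylor_moment hz).unique ((((HasTaylor.id).pow (n - 1)).mul hRA.hasTaylor).congr ?_)
  have hF := (hasTaylor_moment hz).1
  have hG : AnalyticAt ℂ (fun e : ℂ => e ^ (n - 1) * Rf e) 0 :=
    (analyticAt_id.pow (n - 1)).mul hRA
  have hev : ∀ᶠ e in 𝓝[≠] (0 : ℂ), ∀ s : Finset (Fin n), e + ∑ i ∈ s, z i ∉ periodLattice τ := by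
    rw [Filter.eventually_all]
    intro s
    by_cases hs : s.Nonempty
    · have : ContinuousAt (fun e : ℂ => e + ∑ i ∈ s, z i) 0 := by fun_prop
      refine Filter.Eventually.filter_mono nhdsWithin_le_nhds 
        (this.eventually_mem ((isOpen_compl_periodLattice τ).mem_nhds (by simpa using hz s hs)))
    · rw [Finset.not_nonempty_iff_eq_empty.1 hs]
      simpa using eventually_notMem_periodLattice τ 0
  refine (hG.frequently_eq_iff_eventually_eq hF).1 (Eventually.frequently ?_)
  filter_upwards [hev] with e he
  have he0 : e ∉ periodLattice τ := by simpa using he ∅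
  have h1 := h.theta_mul_cycleIntegral he
  have hthe := thetaReg_ne_zero he0
  have hne0 := ne_zero_of_notMem_periodLattice he0
  have h2 : moment (fun B => blockFun τ (∑ i ∈ B, z i) (B.card - 1) e)
      (Finset.univ : Finset (Fin n)) = e ^ n * moment (fun B => iteratedDeriv (B.card - 1)
        (fun e => kronecker τ e (∑ i ∈ B, z i)) e) Finset.univ := by
    have := moment_pow_card_mul e (fun B => iteratedDeriv (B.card - 1)
        (fun e => kronecker τ e (∑ i ∈ B, z i)) e) (Finset.univ : Finset (Fin n))
    rw [Finset.card_univ, Fintype.card_fin] at this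
    rw [this]
    refine moment_congr fun B _ hB => ?_
    have h3 := pow_mul_iteratedDeriv_kronecker (hz B hB) (B.card - 1) he0
    rw [Nat.sub_add_cancel (Finset.card_pos.2 hB)] at h3
    exact h3.symm
  rw [h2, hRf]
  simp only [kroneckerReg]
  rw [theta_eq_mul_thetaReg τ e] at h1
  obtain ⟨m, rfl⟩ : ∃ m, n = m + 1 := ⟨n - 1, by omega⟩
  rw [Nat.add_sub_cancel, add_comm (∑ i, z i) e]
  field_simp
  linear_combination e ^ m * h1

end

lemma isPreconnected_regularLocus (n : ℕ) (τ : ℍ) : IsPreconnected (regularLocus n τ) := by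
  refine isPreconnected_of_forall_pair fun z hz w hw => ?_
  set s : Set ℂ := ⋃ I ∈ {I : Finset (Fin n) | I.Nonempty},
    {t | ∑ i ∈ I, z i + t * ∑ i ∈ I, (w i - z i) ∈ periodLattice τ} with hs
  have hcount : s.Countable := by
    refine Set.Countable.biUnion (Set.to_countable _) fun I hI => ?_
    by_cases hb : ∑ i ∈ I, (w i - z i) = 0
    · simp [hb, hz I hI]
    · refine (countable_periodLattice τ).preimage_of_injOn
        (f := fun t => ∑ i ∈ I, z i + t * ∑ i ∈ I, (w i - z i)) ?_
      intro t _ t' _ h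
      exact mul_right_cancel₀ hb (add_left_cancel h)
  have hconn : IsPathConnected sᶜ := by
    refine hcount.isPathConnected_compl_of_one_lt_rank ?_
    rw [Complex.rank_real_complex]
    norm_num
  have hcont : Continuous fun (t : ℂ) (i : Fin n) => z i + t * (w i - z i) := by fun_prop
  refine ⟨(fun (t : ℂ) (i : Fin n) => z i + t * (w i - z i)) '' sᶜ, ?_, ⟨0, ?_, ?_⟩, ⟨1, ?_, ?_⟩,
    hconn.isConnected.isPreconnected.image _ hcont.continuousOn⟩
  · rintro _ ⟨t, ht, rfl⟩ I hI hmem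
    refine ht (Set.mem_biUnion hI ?_)
    rw [Finset.sum_add_distrib, ← Finset.mul_sum] at hmem
    exact hmem
  · intro h
    obtain ⟨I, hI, h⟩ := Set.mem_iUnion₂.1 h
    exact hz I hI (by simpa using h)
  · simp
  · intro h
    obtain ⟨I, hI, h⟩ := Set.mem_iUnion₂.1 h
    exact hw I hI (by simpa using h)
  · simp

lemma analyticAt_eStar {τ : ℍ} {y : ℂ} (hy : y ∉ periodLattice τ) (m : ℕ) :
    AnalyticAt ℂ (eStar m τ) y := by
  have h := (analyticAt_logDeriv_theta hy).iterated_deriv (m - 1)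
  rw [← iteratedDeriv_eq_iterate] at h
  exact h.add analyticAt_const

lemma analyticOnNhd_coeff_blockSeries {n : ℕ} (τ : ℍ) {B : Finset (Fin n)} (hB : B.Nonempty)
    (l j : ℕ) : AnalyticOnNhd ℂ (fun z : Fin n → ℂ => PowerSeries.coeff j
      (blockSeries (fun m => eStar (m + 1) τ (∑ i ∈ B, z i)) l)) (regularLocus n τ) := by
  have hE : ∀ m, AnalyticOnNhd ℂ (fun z : Fin n → ℂ => eStar (m + 1) τ (∑ i ∈ B, z i))
      (regularLocus n τ) := by
    intro m z hz
    have hlin : AnalyticAt ℂ (fun z : Fin n → ℂ => ∑ i ∈ B, z i) z :=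
      Finset.analyticAt_fun_sum _ fun i _ =>
        (ContinuousLinearMap.proj (R := ℂ) (φ := fun _ : Fin n => ℂ) i).analyticAt z
    exact (analyticAt_eStar (hz B hB) (m + 1)).comp hlin
  have hs : ∀ j, AnalyticOnNhd ℂ (fun z : Fin n → ℂ =>
      expCoeff (fun m => eStar (m + 1) τ (∑ i ∈ B, z i)) j) (regularLocus n τ) := by
    intro j
    induction j using Nat.strong_induction_on with
    | _ j ih =>
      rcases j with _ | j
      · simp only [expCoeff_zero]; exact analyticOnNhd_const
      · simp only [expCoeff_succ]
        refine analyticOnNhd_const.smul (Finset.analyticOnNhd_fun_sum _ fun i _ => ?_)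
        exact (analyticOnNhd_const.smul (hE i)).mul (ih _ (by omega))
  simp only [blockSeries, PowerSeries.coeff_mk]
  exact analyticOnNhd_const.smul (hs j)

lemma analyticOnNhd_coeff_momentSeries (n : ℕ) (τ : ℍ) (j : ℕ) :
    AnalyticOnNhd ℂ (fun z : Fin n → ℂ => PowerSeries.coeff j (momentSeries τ z))
      (regularLocus n τ) := by
  have h1 : ∀ z : Fin n → ℂ, momentSeries τ z =
      moment (fun (B : Finset (Fin n)) (z : Fin n → ℂ) =>
        blockSeries (fun m => eStar (m + 1) τ (∑ i ∈ B, z i)) B.card) Finset.univ z := fun z =>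
    (map_moment (Pi.evalRingHom (fun _ : Fin n → ℂ => PowerSeries ℂ) z)
      (fun (B : Finset (Fin n)) (z : Fin n → ℂ) =>
        blockSeries (fun m => eStar (m + 1) τ (∑ i ∈ B, z i)) B.card) Finset.univ).symm
  simp only [h1]
  refine moment_rel (S := PUnit.{1}) (d := fun _ => 0) (fun (f : (Fin n → ℂ) → PowerSeries ℂ) _ =>
    ∀ j, AnalyticOnNhd ℂ (fun z => PowerSeries.coeff j (f z)) (regularLocus n τ))
    ?_ ?_ ?_ ?_ Finset.univ ?_ j
  · intro j; simpa using analyticOnNhd_const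
  · intro j; simp only [Pi.one_apply]; exact analyticOnNhd_const
  · intro f f' _ _ h h' j
    simp only [Pi.add_apply, map_add]
    exact (h j).add (h' j)
  · intro f f' _ _ h h' j
    simp only [Pi.mul_apply, PowerSeries.coeff_mul]
    exact Finset.analyticOnNhd_fun_sum _ fun p _ => (h _).mul (h' _)
  · intro B _ hB j
    exact analyticOnNhd_coeff_blockSeries τ hB _ j

lemma exists_eventually_inOmegaGW (n : ℕ) (τ : ℍ) :
    ∃ (z₀ : Fin n → ℂ) (r : Fin n → ℝ), ∀ᶠ z in 𝓝 z₀, InOmegaGW τ z r := by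
  set δ := imPeriod τ / (2 * n + 1) with hδ
  have hT := imPeriod_pos τ
  have hδ0 : 0 < δ := by positivity
  have hδT : δ * (2 * n + 1) = imPeriod τ := by rw [hδ]; field_simp
  refine ⟨fun _ => (δ : ℂ), fun i => -(2 * (i : ℕ) * δ), ?_⟩
  have hre : ∀ i : Fin n, ContinuousAt (fun z : Fin n → ℂ => (z i).re) fun _ => (δ : ℂ) :=
    fun i =>
      Complex.continuous_re.continuousAt.comp (continuous_apply i).continuousAt
  unfold InOmegaGW
  refine Filter.Eventually.and (Filter.eventually_all.2 fun i => ?_)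
    (Filter.Eventually.and (Filter.eventually_all.2 fun i => Filter.eventually_all.2 fun j => ?_)
      (Filter.eventually_all.2 fun i => Filter.eventually_all.2 fun j => ?_))
  · have := (hre i).eventually (lt_mem_nhds (show 0 < ((δ : ℂ)).re by simpa using hδ0))
    filter_upwards [this] with z hz
    linarith
  · by_cases hij : i < j
    · have h1 : ((i : ℕ) : ℝ) + 1 ≤ (j : ℕ) := by exact_mod_cast hij
      have := (hre j).eventually (gt_mem_nhds (show ((δ : ℂ)).re < 2 * δ by
        rw [Complex.ofReal_re]; linarith))
      filter_upwards [this] with z hz _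
      nlinarith
    · simp [hij]
  · have h1 : ((j : ℕ) : ℝ) + 1 ≤ n := by exact_mod_cast j.2
    have h2 : (0 : ℝ) ≤ (i : ℕ) := Nat.cast_nonneg _
    have := (hre i).eventually (gt_mem_nhds (show ((δ : ℂ)).re < 2 * δ by
      rw [Complex.ofReal_re]; linarith))
    filter_upwards [this] with z hz
    rw [← imPeriod, ← hδT]
    nlinarith

lemma isCycleContinuation_coeff_momentSeries {n : ℕ} (hn : 1 ≤ n) :
    IsCycleContinuation n fun z τ => PowerSeries.coeff (n - 1) (momentSeries τ z) := by
  refine fun τ => ⟨analyticOnNhd_coeff_momentSeries n τ _, fun z r h => ?_⟩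
  obtain ⟨P, hP, hP0⟩ := h.momentSeries_eq hn
  simp only
  rw [hP, ← hP0]
  simpa using PowerSeries.coeff_X_pow_mul P (n - 1) 0

lemma isCycleContinuation_TGW {n : ℕ} (hn : 1 ≤ n) : IsCycleContinuation n (TGW n) :=
  Classical.epsilon_spec ⟨_, isCycleContinuation_coeff_momentSeries hn⟩

lemma eqOn_regularLocus {n : ℕ} {τ : ℍ} {f g : (Fin n → ℂ) → ℂ}
    (hf : AnalyticOnNhd ℂ f (regularLocus n τ)) (hg : AnalyticOnNhd ℂ g (regularLocus n τ))
    (h : ∀ z r, InOmegaGW τ z r → f z = g z) : EqOn f g (regularLocus n τ) := by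
  obtain ⟨z₀, r, hz⟩ := exists_eventually_inOmegaGW n τ
  exact hf.eqOn_of_preconnected_of_eventuallyEq hg (isPreconnected_regularLocus n τ)
    hz.self_of_nhds.mem_regularLocus (hz.mono fun z hz => h z r hz)

lemma TGW_eq_coeff {n : ℕ} (hn : 1 ≤ n) {τ : ℍ} {z : Fin n → ℂ} (hz : z ∈ regularLocus n τ) :
    TGW n z τ = PowerSeries.coeff (n - 1) (momentSeries τ z) :=
  eqOn_regularLocus (isCycleContinuation_TGW hn τ).1
    (isCycleContinuation_coeff_momentSeries hn τ).1
    (fun z r h => ((isCycleContinuation_TGW hn τ).2 z r h).trans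
      ((isCycleContinuation_coeff_momentSeries hn τ).2 z r h).symm) hz

lemma coeff_momentSeries_eq_zero {n j : ℕ} (hj : j < n - 1) {τ : ℍ} {z : Fin n → ℂ}
    (hz : z ∈ regularLocus n τ) : PowerSeries.coeff j (momentSeries τ z) = 0 := by
  refine eqOn_regularLocus (g := fun _ => 0) (analyticOnNhd_coeff_momentSeries n τ j)
    analyticOnNhd_const (fun z r h => ?_) hz
  obtain ⟨P, hP, -⟩ := h.momentSeries_eq (by omega)
  rw [hP, PowerSeries.coeff_X_pow_mul', if_neg (by omega)]

lemma mergeTuple_mem_regularLocus {n : ℕ} {τ : ℍ} {z : Fin n → ℂ} (hz : z ∈ regularLocus n τ)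
    {i j : Fin n} (hij : i ≠ j) : mergeTuple z i j ∈ regularLocus (n - 1) τ := by
  obtain ⟨m, rfl⟩ : ∃ m, n = m + 2 := by
    obtain ⟨n, rfl⟩ : ∃ k, n = k + 1 := ⟨n - 1, by have := i.2; omega⟩
    rcases n with _ | m
    · exact absurd (Fin.ext (by have := i.2; have := j.2; omega)) hij
    · exact ⟨m, rfl⟩
  obtain ⟨g, hg, hgz⟩ := exists_orderEmb_mergeTuple z hij
  intro (I : Finset (Fin (m + 1))) hI
  set J := (I.preimage Fin.succ (Fin.succ_injective m).injOn).map g.toEmbedding with hJ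
  have hdis : Disjoint ({i, j} : Finset (Fin (m + 2))) J := by
    rw [Finset.disjoint_left]
    intro x hx hx'
    obtain ⟨t, _, rfl⟩ := Finset.mem_map.1 hx'
    exact (hg (g t)).1 (by simp) hx
  have hsum : ∑ k ∈ I.erase 0, mergeTuple z i j (k : Fin (m + 1)) = ∑ x ∈ J, z x := by
    rw [hJ, Finset.sum_map]
    refine (Finset.sum_bij (fun t _ => Fin.succ t) ?_ ?_ ?_ ?_).symm
    · intro t ht; simpa using ht
    · intro s _ t _ h; exact Fin.succ_injective m h
    · intro k hk
      rw [Finset.mem_erase] at hk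
      obtain ⟨t, rfl⟩ := Fin.exists_succ_eq_of_ne_zero hk.1
      exact ⟨t, by simpa using hk.2, rfl⟩
    · intro t _; exact (hgz t).symm
  have h0 : mergeTuple z i j (0 : Fin (m + 1)) = z i + z j := by simp [mergeTuple]
  by_cases hI0 : (0 : Fin (m + 1)) ∈ I
  · change ∑ k ∈ I, mergeTuple z i j (k : Fin (m + 1)) ∉ _
    rw [← Finset.add_sum_erase I _ hI0, hsum, h0, ← Finset.sum_pair hij, ← Finset.sum_union hdis]
    exact hz _ ⟨i, by simp⟩
  · change ∑ k ∈ I, mergeTuple z i j (k : Fin (m + 1)) ∉ _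
    rw [← Finset.erase_eq_of_notMem hI0, hsum]
    refine hz J ?_
    obtain ⟨k, hk⟩ := hI
    obtain ⟨t, rfl⟩ := Fin.exists_succ_eq_of_ne_zero (fun h : k = (0 : Fin (m + 1)) => hI0 (h ▸ hk))
    exact ⟨g t, Finset.mem_map_of_mem _ (by simpa using hk)⟩

/-! ### Derivatives of sums over set partitions -/

section

variable {R : Type*} [CommRing R] [Algebra ℂ R] (D : Derivation ℂ R R)

lemma derivation_expCoeff {E : ℕ → R} {d : R} (h0 : D (E 0) = d) (h1 : ∀ m, D (E (m + 1)) = 0)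
    (j : ℕ) : D (expCoeff E (j + 1)) = d * expCoeff E j := by
  induction j using Nat.strong_induction_on with
  | _ j ih =>
    have hj : (j + 1 : ℂ) ≠ 0 := by exact_mod_cast Nat.succ_ne_zero j
    have key : ∑ i ∈ Finset.range (j + 1), ((1 / (Nat.factorial i) : ℂ) • E i) *
        D (expCoeff E (j - i)) = (j : ℂ) • (d * expCoeff E j) := by
      rcases j with _ | j
      · simp [expCoeff_zero]
      · rw [Finset.sum_range_succ]
        have hj' : (j + 1 : ℂ) ≠ 0 := by exact_mod_cast Nat.succ_ne_zero j
        have h2 : ∀ i ∈ Finset.range (j + 1), ((1 / (Nat.factorial i) : ℂ) • E i) *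
            D (expCoeff E (j + 1 - i)) =
            d * (((1 / (Nat.factorial i) : ℂ) • E i) * expCoeff E (j - i)) := by
          intro i hi
          have hi' : i ≤ j := Nat.lt_succ_iff.1 (Finset.mem_range.1 hi)
          rw [Nat.succ_sub hi', ih _ (by omega)]; ring
        rw [Finset.sum_congr rfl h2, ← Finset.mul_sum, expCoeff_succ, Nat.sub_self, expCoeff_zero,
          D.map_one_eq_zero, mul_zero, add_zero, mul_smul_comm, smul_smul]
        push_cast
        rw [mul_one_div_cancel hj', one_smul]
    rw [expCoeff_succ, Derivation.map_smul, map_sum]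
    have h3 : ∀ i ∈ Finset.range (j + 1),
        D (((1 / (Nat.factorial i) : ℂ) • E i) * expCoeff E (j - i)) =
          (if i = 0 then d * expCoeff E j else 0) +
            ((1 / (Nat.factorial i) : ℂ) • E i) * D (expCoeff E (j - i)) := by
      intro i _
      rw [Derivation.leibniz, Derivation.map_smul, smul_eq_mul, smul_eq_mul]
      rcases i with _ | i
      · simp [h0]; ring
      · simp [h1]
    rw [Finset.sum_congr rfl h3, Finset.sum_add_distrib, key, Finset.sum_ite_eq', if_pos (by simp),
      ← one_smul ℂ (d * expCoeff E j), smul_smul, ← add_smul, smul_smul]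
    congr 1
    field_simp
    ring

/-- A derivation applied to the coefficients of a power series. -/
def coeffDerivation (P : PowerSeries R) : PowerSeries R :=
  PowerSeries.mk fun j => D (PowerSeries.coeff j P)

lemma coeffDerivation_sum {ι : Type*} (s : Finset ι) (f : ι → PowerSeries R) :
    coeffDerivation D (∑ i ∈ s, f i) = ∑ i ∈ s, coeffDerivation D (f i) := by
  ext j; simp [coeffDerivation]

lemma coeffDerivation_mul (P Q : PowerSeries R) :
    coeffDerivation D (P * Q) = coeffDerivation D P * Q + P * coeffDerivation D Q := by
  ext j
  simp only [coeffDerivation, PowerSeries.coeff_mk, map_add, PowerSeries.coeff_mul, map_sum,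
    Derivation.leibniz, smul_eq_mul]
  rw [← Finset.sum_add_distrib]
  refine Finset.sum_congr rfl fun p _ => ?_
  ring

lemma coeffDerivation_blockSeries {E : ℕ → R} {d : R} (h0 : D (E 0) = d)
    (h1 : ∀ m, D (E (m + 1)) = 0) (l : ℕ) :
    coeffDerivation D (blockSeries E (l + 1)) = PowerSeries.C d *
      (PowerSeries.X * (blockSeries E (l + 1) +
        PowerSeries.C (algebraMap ℂ R l) * blockSeries E l)) := by
  ext j
  rw [PowerSeries.coeff_C_mul]
  rcases j with _ | j
  · simp [coeffDerivation, blockSeries, expCoeff_zero]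
  · rw [PowerSeries.coeff_succ_X_mul, map_add, PowerSeries.coeff_C_mul]
    simp only [coeffDerivation, blockSeries, PowerSeries.coeff_mk, Derivation.map_smul,
      derivation_expCoeff D h0 h1]
    have h2 : blockFactor (l + 1) (j + 1) = blockFactor (l + 1) j + l * blockFactor l j := by
      rcases l with _ | l
      · simp [blockFactor]
      · simp only [blockFactor, Nat.add_sub_cancel]
        rw [Finset.prod_range_succ', Finset.prod_range_succ]
        have : ∀ t ∈ Finset.range l, (((j + 1 : ℕ) : ℂ) - (((t + 1 : ℕ) : ℂ) + 1)) =
            (j : ℂ) - (t + 1) := by intro t _; push_cast; ring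
        rw [Finset.prod_congr rfl this]
        push_cast; ring
    simp only [h2, Algebra.smul_def, map_mul, map_add]
    ring

lemma coeffDerivation_moment {ι : Type*} [LinearOrder ι] {c d : Finset ι → PowerSeries R}
    (hd : d ∅ = 0) (h : ∀ B, B.Nonempty → coeffDerivation D (c B) = d B) (A : Finset ι) :
    coeffDerivation D (moment c A) = ∑ B ∈ A.powerset, d B * moment c (A \ B) := by
  refine eq_sum_mul_moment (N := fun A => coeffDerivation D (moment c A)) hd ?_
    (fun A a ha hmin => ?_) A
  · ext j
    simp only [moment_empty, coeffDerivation, PowerSeries.coeff_mk, PowerSeries.coeff_one]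
    split_ifs <;> simp
  · rw [moment_eq c ha hmin, coeffDerivation_sum]
    refine Finset.sum_congr rfl fun B _ => ?_
    rw [coeffDerivation_mul, h _ (Finset.insert_nonempty _ _)]

end

/-- The derivative of the generating series, in terms of the generating series itself and those
of the merged tuples. -/
lemma sum_blockSeries_mul_moment {n : ℕ} (τ : ℍ) (z : Fin n → ℂ) :
    ∑ B : Finset (Fin n), PowerSeries.C (∑ i ∈ B, z i) *
      (blockSeries (fun m => eStar (m + 1) τ (∑ i ∈ B, z i)) B.card +
        PowerSeries.C ((B.card : ℂ) - 1) *
          blockSeries (fun m => eStar (m + 1) τ (∑ i ∈ B, z i)) (B.card - 1)) *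
      moment (fun B => blockSeries (fun m => eStar (m + 1) τ (∑ i ∈ B, z i)) B.card)
        (Finset.univ \ B) =
    PowerSeries.C (∑ i, z i) * momentSeries τ z +
      ∑ i, ∑ j ∈ Finset.Ioi i, PowerSeries.C (z i + z j) *
        momentSeries τ (mergeTuple z i j) := by
  set c : ℕ → ℂ → PowerSeries ℂ := fun l y => blockSeries (fun m => eStar (m + 1) τ y) l with hc
  set M : Finset (Fin n) → PowerSeries ℂ :=
    moment fun B : Finset (Fin n) => c B.card (∑ i ∈ B, z i) with hM
  have h1 := sum_mul_moment (fun i => PowerSeries.C (z i))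
    (fun B : Finset (Fin n) => c B.card (∑ i ∈ B, z i)) Finset.univ
  rw [Finset.powerset_univ] at h1
  simp only [← map_sum] at h1
  have h2 : ∀ i, ∀ j ∈ Finset.Ioi i, PowerSeries.C (z i + z j) *
      momentSeries τ (mergeTuple z i j) = ∑ B : Finset (Fin n),
        PowerSeries.C (if i ∈ B ∧ j ∈ B then z i + z j else 0) *
          (c (B.card - 1) (∑ k ∈ B, z k) * M (Finset.univ \ B)) := by
    intro i j hij
    have := moment_mergeTuple z (Finset.mem_Ioi.1 hij).ne c
    rw [momentSeries, this, Finset.mul_sum]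
    refine Finset.sum_congr rfl fun B _ => ?_
    split_ifs <;> simp [hM]
  rw [Finset.sum_congr rfl fun i _ => Finset.sum_congr rfl (h2 i),
    Finset.sum_congr rfl fun i _ => Finset.sum_comm, Finset.sum_comm]
  rw [momentSeries, ← h1, ← Finset.sum_add_distrib]
  refine Finset.sum_congr rfl fun B _ => ?_
  have h3 : ∑ i, ∑ j ∈ Finset.Ioi i, PowerSeries.C (if i ∈ B ∧ j ∈ B then z i + z j else 0) *
      (c (B.card - 1) (∑ k ∈ B, z k) * M (Finset.univ \ B)) =
      PowerSeries.C (((B.card : ℂ) - 1) * ∑ i ∈ B, z i) *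
        (c (B.card - 1) (∑ k ∈ B, z k) * M (Finset.univ \ B)) := by
    rw [← sum_Ioi_add z B, map_sum, Finset.sum_mul]
    refine Finset.sum_congr rfl fun i _ => ?_
    rw [map_sum, Finset.sum_mul]
  rw [h3, map_mul]
  ring

section

variable {n : ℕ}

lemma zFun_mem (i : Fin n) : zFun i ∈ qeRing n :=
  Algebra.subset_adjoin (Or.inl (Or.inl ⟨i, rfl⟩))

lemma g2Fun_mem (n : ℕ) : g2Fun n ∈ qeRing n :=
  Algebra.subset_adjoin (Or.inl (Or.inr rfl))

lemma eFun_mem {m : ℕ} (hm : 1 ≤ m) {I : Finset (Fin n)} (hI : I.Nonempty) :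
    eFun m I ∈ qeRing n :=
  Algebra.subset_adjoin (Or.inr ⟨m, I, hm, hI, rfl⟩)

/-- The function `z_I` as an element of the quasi-elliptic ring. -/
def zElt (I : Finset (Fin n)) : qeRing n := ∑ i ∈ I, ⟨zFun i, zFun_mem i⟩

/-- The function `ℰ*_{m+1}(z_I)` as an element of the quasi-elliptic ring. -/
def eElt (I : Finset (Fin n)) (m : ℕ) : qeRing n :=
  if hI : I.Nonempty then ⟨eFun (m + 1) I, eFun_mem (Nat.le_add_left 1 m) hI⟩ else 0

/-- Evaluation of the elements of the quasi-elliptic ring at a point. -/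
def evalElt (p : Locus n) : qeRing n →ₐ[ℂ] ℂ :=
  (Pi.evalAlgHom ℂ (fun _ : Locus n => ℂ) p).comp (qeRing n).val

lemma evalElt_zElt (p : Locus n) (I : Finset (Fin n)) :
    evalElt p (zElt I) = ∑ i ∈ I, p.1.1 i := by
  rw [zElt, map_sum]; rfl

lemma evalElt_eElt (p : Locus n) {I : Finset (Fin n)} (hI : I.Nonempty) (m : ℕ) :
    evalElt p (eElt I m) = eStar (m + 1) p.1.2 (∑ i ∈ I, p.1.1 i) := by
  rw [eElt, dif_pos hI]; rfl

/-- The generating series as a power series over the quasi-elliptic ring. -/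
def momentElt (n : ℕ) : PowerSeries (qeRing n) :=
  moment (fun B : Finset (Fin n) => blockSeries (eElt B) B.card) Finset.univ

lemma map_moment_evalElt (p : Locus n) (A : Finset (Fin n)) :
    PowerSeries.map (evalElt p : qeRing n →+* ℂ)
      (moment (fun B : Finset (Fin n) => blockSeries (eElt B) B.card) A) =
      moment (fun B => blockSeries (fun m => eStar (m + 1) p.1.2 (∑ i ∈ B, p.1.1 i)) B.card) A := by
  rw [map_moment]
  refine moment_congr fun B _ hB => ?_
  rw [map_blockSeries]
  simp only [evalElt_eElt p hB]

lemma map_momentElt (p : Locus n) :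
    PowerSeries.map (evalElt p : qeRing n →+* ℂ) (momentElt n) = momentSeries p.1.2 p.1.1 :=
  map_moment_evalElt p _

lemma tFun_eq (hn : 1 ≤ n) :
    tFun n = (PowerSeries.coeff (n - 1) (momentElt n) : qeRing n) := by
  funext p
  rw [tFun, TGW_eq_coeff hn p.2, ← map_momentElt p, PowerSeries.coeff_map]
  rfl

lemma tFun_mem (hn : 1 ≤ n) : tFun n ∈ qeRing n := by
  rw [tFun_eq hn]; exact SetLike.coe_mem _

variable {D : Derivation ℂ (qeRing n) (qeRing n)}

lemma IsG2Derivation.map_eElt_zero (hD : IsG2Derivation D) (I : Finset (Fin n)) :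
    D (eElt I 0) = -2 * zElt I := by
  by_cases hI : I.Nonempty
  · apply Subtype.ext
    rw [hD.map_e_one (eElt I 0) I hI (by rw [eElt, dif_pos hI])]
    funext p
    change _ = evalElt p (-2 * zElt I)
    rw [map_mul, evalElt_zElt, map_neg, map_ofNat]
  · rw [eElt, dif_neg hI, Finset.not_nonempty_iff_eq_empty.1 hI]
    simp [zElt]

lemma IsG2Derivation.map_eElt_succ (hD : IsG2Derivation D) (I : Finset (Fin n)) (m : ℕ) :
    D (eElt I (m + 1)) = 0 := by
  by_cases hI : I.Nonempty
  · exact hD.map_e _ (m + 1 + 1) I (by omega) hI (by rw [eElt, dif_pos hI])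
  · rw [eElt, dif_neg hI, map_zero]

theorem IsG2Derivation.apply_tFun (hD : IsG2Derivation D) (hn : 1 ≤ n) (p : Locus n) :
    ((D ⟨tFun n, tFun_mem hn⟩ : qeRing n) : Locus n → ℂ) p =
      -2 * ∑ i : Fin n, ∑ j ∈ Finset.Ioi i, (p.1.1 i + p.1.1 j) *
        TGW (n - 1) (mergeTuple p.1.1 i j) p.1.2 := by
  set d : Finset (Fin n) → PowerSeries (qeRing n) := fun B =>
    PowerSeries.C (-2 * zElt B) * (PowerSeries.X * (blockSeries (eElt B) B.card +
      PowerSeries.C (algebraMap ℂ _ ((B.card : ℂ) - 1)) * blockSeries (eElt B) (B.card - 1)))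
    with hd
  have h1 : coeffDerivation D (momentElt n) = ∑ B : Finset (Fin n), d B *
      moment (fun B => blockSeries (eElt B) B.card) (Finset.univ \ B) := by
    rw [momentElt, coeffDerivation_moment D (d := d), Finset.powerset_univ]
    · simp [hd, zElt]
    · intro B hB
      obtain ⟨l, hl⟩ : ∃ l, B.card = l + 1 := ⟨B.card - 1, by have := Finset.card_pos.2 hB; omega⟩
      rw [hd]
      simp only [hl, Nat.add_sub_cancel]
      rw [coeffDerivation_blockSeries D (hD.map_eElt_zero B) (hD.map_eElt_succ B)]
      push_cast
      rw [add_sub_cancel_right]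
  have h2 : PowerSeries.map (evalElt p : qeRing n →+* ℂ) (coeffDerivation D (momentElt n)) =
      PowerSeries.C (-2) * (PowerSeries.X * (PowerSeries.C (∑ i, p.1.1 i) * momentSeries p.1.2 p.1.1 +
      ∑ i, ∑ j ∈ Finset.Ioi i, PowerSeries.C (p.1.1 i + p.1.1 j) *
        momentSeries p.1.2 (mergeTuple p.1.1 i j))) := by
    rw [h1, ← sum_blockSeries_mul_moment, map_sum, Finset.mul_sum, Finset.mul_sum]
    refine Finset.sum_congr rfl fun B _ => ?_
    rcases B.eq_empty_or_nonempty with rfl | hB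
    · simp [hd, zElt]
    rw [map_mul, map_moment_evalElt, hd]
    simp only [map_mul, map_add, PowerSeries.map_C, PowerSeries.map_X, map_blockSeries]
    have e1 : ((evalElt p : qeRing n →+* ℂ) (zElt B)) = ∑ i ∈ B, p.1.1 i := evalElt_zElt p B
    have e2 : ∀ a : ℂ, (evalElt p : qeRing n →+* ℂ) (algebraMap ℂ _ a) = a := fun a =>
      (evalElt p).commutes a
    have e3 : (evalElt p : qeRing n →+* ℂ) (-2) = -2 := by rw [map_neg, map_ofNat]
    simp only [e1, e2, e3, evalElt_eElt p hB]
    ring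
  have h3 : ((D ⟨tFun n, tFun_mem hn⟩ : qeRing n) : Locus n → ℂ) p = PowerSeries.coeff (n - 1)
      (PowerSeries.map (evalElt p : qeRing n →+* ℂ) (coeffDerivation D (momentElt n))) := by
    have : (⟨tFun n, tFun_mem hn⟩ : qeRing n) = PowerSeries.coeff (n - 1) (momentElt n) :=
      Subtype.ext (tFun_eq hn)
    rw [this, PowerSeries.coeff_map, coeffDerivation, PowerSeries.coeff_mk]
    rfl
  rw [h3, h2, PowerSeries.coeff_C_mul]
  congr 1
  obtain ⟨n, rfl⟩ : ∃ m, n = m + 1 := ⟨n - 1, by omega⟩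
  rcases n with _ | n
  · simp
  refine (PowerSeries.coeff_succ_X_mul n _).trans ?_
  rw [map_add, PowerSeries.coeff_C_mul,
    coeff_momentSeries_eq_zero (by omega) p.2, mul_zero, zero_add, map_sum]
  refine Finset.sum_congr rfl fun i _ => ?_
  rw [map_sum]
  refine Finset.sum_congr rfl fun j hj => ?_
  rw [PowerSeries.coeff_C_mul]
  congr 1
  exact (TGW_eq_coeff (n := n + 1 + 1 - 1) (by omega)
    (mergeTuple_mem_regularLocus p.2 (Finset.mem_Ioi.1 hj).ne)).symm

end

/-! ### Modular transformations -/

lemma iteratedDeriv_comp_mul_left (c : ℂ) (f : ℂ → ℂ) (j : ℕ) (x : ℂ) :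
    iteratedDeriv j (fun w => f (c * w)) x = c ^ j * iteratedDeriv j f (c * x) := by
  induction j generalizing x with
  | zero => simp
  | succ j ih =>
    rw [iteratedDeriv_succ, funext ih, deriv_const_mul_field, deriv_comp_mul_left,
      iteratedDeriv_succ, smul_eq_mul]
    ring

lemma iteratedDeriv_linear (a : ℂ) (j : ℕ) (x : ℂ) :
    iteratedDeriv j (fun w : ℂ => a * w) x = if j = 0 then a * x else if j = 1 then a else 0 := by
  rcases j with _ | _ | j
  · simp
  · rw [iteratedDeriv_succ, iteratedDeriv_zero]
    simp
  · have : deriv (fun w : ℂ => a * w) = fun _ => a := by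
      funext w; simp
    rw [iteratedDeriv_succ', this, iteratedDeriv_const]
    simp

lemma iteratedDeriv_linear_add {a c x : ℂ} {f : ℂ → ℂ} (hf : AnalyticAt ℂ f (c * x)) (j : ℕ) :
    iteratedDeriv j (fun w => a * w + c * f (c * w)) x =
      (if j = 0 then a * x else if j = 1 then a else 0) +
        c ^ (j + 1) * iteratedDeriv j f (c * x) := by
  have h2 : AnalyticAt ℂ (fun w => c * f (c * w)) x := by
    have : AnalyticAt ℂ (fun w : ℂ => c * w) x := analyticAt_const.mul analyticAt_id
    exact analyticAt_const.mul (hf.comp this)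
  have h1 : AnalyticAt ℂ (fun w : ℂ => a * w) x := analyticAt_const.mul analyticAt_id
  rw [iteratedDeriv_fun_add h1.contDiffAt h2.contDiffAt, iteratedDeriv_linear,
    iteratedDeriv_const_mul_field, iteratedDeriv_comp_mul_left]
  ring

lemma logDeriv_gaussian_mul {F G : ℂ → ℂ} {b c k : ℂ} (hk : k ≠ 0) (hG : Differentiable ℂ G)
    (hF : ∀ w, F w = k * (cexp (b * w ^ 2) * G (c * w))) {w : ℂ} (hw : G (c * w) ≠ 0) :
    logDeriv F w = 2 * b * w + c * logDeriv G (c * w) := by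
  have h1 : HasDerivAt (fun w => cexp (b * w ^ 2)) (cexp (b * w ^ 2) * (b * (2 * w))) w := by
    have : HasDerivAt (fun w : ℂ => b * w ^ 2) (b * (2 * w)) w := by
      simpa using (hasDerivAt_pow 2 w).const_mul b
    exact this.cexp
  have h2 : HasDerivAt (fun w => G (c * w)) (deriv G (c * w) * c) w := by
    have h3 : HasDerivAt (fun w : ℂ => c * w) c w := by
      simpa using (hasDerivAt_id w).const_mul c
    exact (hG (c * w)).hasDerivAt.comp w h3
  have h3 := ((h1.fun_mul h2).const_mul k).deriv
  have he := Complex.exp_ne_zero (b * w ^ 2)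
  rw [logDeriv_apply, logDeriv_apply, funext hF, h3]
  beta_reduce
  generalize deriv G (c * w) = v
  generalize G (c * w) = u at hw ⊢
  field_simp

section

variable {τ T τ' : ℍ}

lemma psi_eq_of_theta_eq (h : theta T = theta τ) : psi T = psi τ := by
  unfold psi thetaReg; rw [h]

lemma eisG_eq_of_theta_eq (h : theta T = theta τ) (m : ℕ) : eisG (m + 1) T = eisG (m + 1) τ := by
  have h1 := iteratedDeriv_psi_zero T m
  rw [psi_eq_of_theta_eq h, iteratedDeriv_psi_zero] at h1
  exact (mul_left_cancel₀ two_ne_zero h1).symm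

lemma eStar_eq_of_theta_eq (h : theta T = theta τ) (m : ℕ) :
    eStar (m + 1) T = eStar (m + 1) τ := by
  unfold eStar; rw [h, eisG_eq_of_theta_eq h]

lemma theta_int_vadd (τ : ℍ) (m : ℤ) : theta ((m : ℝ) +ᵥ τ) = theta τ := by
  have hstep : ∀ m : ℤ, theta (((m + 1 : ℤ) : ℝ) +ᵥ τ) = theta ((m : ℝ) +ᵥ τ) := fun m =>
    funext fun z => theta_tau_add_one (by
      rw [UpperHalfPlane.coe_vadd, UpperHalfPlane.coe_vadd]; push_cast; ring) z
  induction m using Int.induction_on with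
  | zero => simp
  | succ i ih => rw [hstep, ih]
  | pred i ih =>
    rw [← ih, ← hstep (-(i : ℤ) - 1)]
    congr 3; ring

lemma theta_inv' (h : (τ' : ℂ) = -1 / T) (w : ℂ) :
    theta τ' w = (T : ℂ)⁻¹ * (cexp (T / (4 * π * I) * w ^ 2) * theta T (T * w)) := by
  rw [theta_inv h, show (T : ℂ) * w ^ 2 / (4 * π * I) = T / (4 * π * I) * w ^ 2 by ring]
  ring

lemma thetaReg_inv (h : (τ' : ℂ) = -1 / T) (w : ℂ) :
    thetaReg τ' w = 1 * (cexp (T / (4 * π * I) * w ^ 2) * thetaReg T (T * w)) := by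
  have hT : (T : ℂ) ≠ 0 := T.ne_zero
  rcases eq_or_ne w 0 with rfl | hw
  · simp [thetaReg_zero]
  · rw [thetaReg_of_ne hw, theta_inv' h, theta_eq_mul_thetaReg T]
    field_simp

lemma eisG_inv (h : (τ' : ℂ) = -1 / T) (m : ℕ) :
    eisG (m + 1) τ' = (T : ℂ) ^ (m + 1) * eisG (m + 1) T -
      if m = 1 then (T : ℂ) / (4 * π * I) else 0 := by
  have hev : psi τ' =ᶠ[𝓝 0] fun w => -(2 * ((T : ℂ) / (4 * π * I))) * w + T * psi T (T * w) := by
    have h0 : thetaReg T (T * 0) ≠ 0 := by rw [mul_zero, thetaReg_zero]; exact one_ne_zero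
    have hc : ContinuousAt (fun w => thetaReg T (T * w)) 0 :=
      ((differentiable_thetaReg T).continuous.comp (continuous_const.mul continuous_id)).continuousAt
    filter_upwards [hc.eventually_ne h0] with w hw
    rw [psi, psi, logDeriv_gaussian_mul one_ne_zero (differentiable_thetaReg T) (thetaReg_inv h) hw]
    ring
  have h1 := hev.iteratedDeriv_eq m
  rw [iteratedDeriv_psi_zero, iteratedDeriv_linear_add (by rw [mul_zero]; exact analyticAt_psi T),
    mul_zero, mul_zero, iteratedDeriv_psi_zero] at h1
  rcases eq_or_ne m 1 with rfl | hm
  · simp only [one_ne_zero, if_false, if_true] at h1 ⊢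
    linear_combination h1 / 2
  · simp only [hm, if_false, ite_self] at h1 ⊢
    linear_combination h1 / 2

lemma eStar_inv (h : (τ' : ℂ) = -1 / T) {w : ℂ} (hw : (T : ℂ) * w ∉ periodLattice T) (m : ℕ) :
    eStar (m + 1) τ' w = (T : ℂ) ^ (m + 1) * eStar (m + 1) T (T * w) +
      if m = 0 then (T : ℂ) * w / (2 * π * I) else 0 := by
  have hT : (T : ℂ) ≠ 0 := T.ne_zero
  have hev : logDeriv (theta τ') =ᶠ[𝓝 w] fun w =>
      (2 * ((T : ℂ) / (4 * π * I))) * w + T * logDeriv (theta T) (T * w) := by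
    have hc : ContinuousAt (fun w : ℂ => (T : ℂ) * w) w := by fun_prop
    filter_upwards [hc.eventually_mem ((isOpen_compl_periodLattice T).mem_nhds hw)] with w' hw'
    exact logDeriv_gaussian_mul (inv_ne_zero hT) (differentiable_theta T) (theta_inv' h)
      (theta_ne_zero hw')
  have hpi : (π : ℂ) ≠ 0 := by exact_mod_cast Real.pi_ne_zero
  have h1 := hev.iteratedDeriv_eq m
  rw [iteratedDeriv_linear_add (analyticAt_logDeriv_theta hw)] at h1
  unfold eStar
  rw [Nat.add_sub_cancel, h1, eisG_inv h]
  rcases m with _ | _ | m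
  · simp only [if_true, zero_ne_one, if_false]
    field_simp
    ring
  · simp only [zero_add, one_ne_zero, if_true, if_false]
    ring
  · simp only [Nat.add_eq_zero_iff, one_ne_zero, and_false, if_false, Nat.add_eq_right]
    ring

lemma mem_periodLattice_of_div {m : ℤ} (hT : (T : ℂ) = m + τ) (h : (τ' : ℂ) = -1 / T) {x : ℂ}
    (hx : x / T ∈ periodLattice τ') : x ∈ periodLattice τ := by
  obtain ⟨a, b, hab⟩ := hx
  have hT0 : (T : ℂ) ≠ 0 := T.ne_zero
  refine ⟨a * m - b, a, ?_⟩
  rw [h] at hab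
  have : x = 2 * π * I * a * T - 2 * π * I * b := by
    field_simp at hab
    linear_combination hab
  rw [this, hT]
  push_cast; ring

lemma periodLattice_subset_of_vadd {m : ℤ} (hT : (T : ℂ) = m + τ) {x : ℂ}
    (hx : x ∈ periodLattice T) : x ∈ periodLattice τ := by
  obtain ⟨a, b, rfl⟩ := hx
  refine ⟨a + m * b, b, ?_⟩
  rw [hT]; push_cast; ring

end

/-! ### Existence and uniqueness of the derivation -/

section

variable {n : ℕ}

/-- Labels of the generators of the quasi-elliptic ring: `z_i`, `𝔾_2` and `ℰ*_{m+1}(z_I)`. -/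
inductive Gen (n : ℕ) : Type
  | z (i : Fin n) : Gen n
  | g : Gen n
  | e (m : ℕ) (I : Finset (Fin n)) : Gen n

/-- The generators of the quasi-elliptic ring. -/
def genElt : Gen n → qeRing n
  | .z i => ⟨zFun i, zFun_mem i⟩
  | .g => ⟨g2Fun n, g2Fun_mem n⟩
  | .e m I => eElt I m

/-- The presentation of the quasi-elliptic ring. -/
def presentation (n : ℕ) : MvPolynomial (Gen n) ℂ →ₐ[ℂ] qeRing n := MvPolynomial.aeval genElt

lemma presentation_surjective (n : ℕ) : Function.Surjective (presentation n) := by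
  have h : qeRing n ≤ ((qeRing n).val.comp (presentation n)).range := by
    refine Algebra.adjoin_le ?_
    rintro f ((⟨i, rfl⟩ | hf) | ⟨m, I, hm, hI, rfl⟩)
    · exact ⟨MvPolynomial.X (.z i), by simp [presentation, genElt]⟩
    · rw [Set.mem_singleton_iff.1 hf]
      exact ⟨MvPolynomial.X .g, by simp [presentation, genElt]⟩
    · obtain ⟨m, rfl⟩ : ∃ k, m = k + 1 := ⟨m - 1, by omega⟩
      exact ⟨MvPolynomial.X (.e m I), by simp [presentation, genElt, eElt, hI]⟩
  intro f
  obtain ⟨P, hP⟩ := h f.2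
  exact ⟨P, Subtype.ext hP⟩

/-- The values of the generators at a point. -/
def genVal (p : Locus n) (x : Gen n) : ℂ := evalElt p (genElt x)

lemma evalElt_presentation (p : Locus n) (P : MvPolynomial (Gen n) ℂ) :
    evalElt p (presentation n P) = MvPolynomial.aeval (genVal p) P := by
  have : (evalElt p).comp (presentation n) = MvPolynomial.aeval (genVal p) := by
    ext x; simp [presentation, genVal]
  exact DFunLike.congr_fun this P

lemma presentation_eq_zero_iff (P : MvPolynomial (Gen n) ℂ) :
    presentation n P = 0 ↔ ∀ p, MvPolynomial.aeval (genVal p) P = 0 := by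
  simp only [← evalElt_presentation]
  constructor
  · intro h p; rw [h, map_zero]
  · intro h; exact Subtype.ext (funext h)

lemma genVal_z (p : Locus n) (i : Fin n) : genVal p (.z i) = p.1.1 i := rfl

lemma genVal_g (p : Locus n) : genVal p .g = eisG 2 p.1.2 := rfl

lemma genVal_e (p : Locus n) (m : ℕ) (I : Finset (Fin n)) : genVal p (.e m I) =
    if I.Nonempty then eStar (m + 1) p.1.2 (∑ i ∈ I, p.1.1 i) else 0 := by
  split_ifs with hI
  · exact evalElt_eElt p hI m
  · rw [genVal, genElt, eElt, dif_neg hI, map_zero]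

/-- The constant `-1 / (4πi)`. -/
def modConst : ℂ := -1 / (4 * π * I)

/-- The action on generators of a modular transformation with automorphy factor `s`. -/
def modAct (s : ℂ) : MvPolynomial (Gen n) ℂ →ₐ[ℂ] MvPolynomial (Gen n) ℂ :=
  MvPolynomial.aeval fun
    | .z i => MvPolynomial.C s⁻¹ * MvPolynomial.X (.z i)
    | .g => MvPolynomial.C (s ^ 2) * MvPolynomial.X .g + MvPolynomial.C (modConst * s)
    | .e m I => MvPolynomial.C (s ^ (m + 1)) * MvPolynomial.X (.e m I) +
        if m = 0 then MvPolynomial.C (-2 * modConst) * ∑ i ∈ I, MvPolynomial.X (.z i) else 0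

lemma aeval_modAct_X (s : ℂ) (p : Locus n) (x : Gen n) :
    MvPolynomial.aeval (genVal p) (modAct s (MvPolynomial.X x)) = match x with
      | .z i => s⁻¹ * genVal p (.z i)
      | .g => s ^ 2 * genVal p .g + modConst * s
      | .e m I => s ^ (m + 1) * genVal p (.e m I) +
        if m = 0 then -2 * modConst * ∑ i ∈ I, genVal p (.z i) else 0 := by
  rcases x with i | _ | ⟨m, I⟩
  · simp [modAct]
  · simp [modAct]
  · by_cases hm : m = 0
    · simp [modAct, hm]
    · simp [modAct, hm]

lemma exists_locus_modular (p : Locus n) (m : ℤ) : ∃ p' : Locus n, ∀ P : MvPolynomial (Gen n) ℂ,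
    MvPolynomial.aeval (genVal p') P =
      MvPolynomial.aeval (genVal p) (modAct (m + p.1.2) P) := by
  obtain ⟨⟨z, τ⟩, hz⟩ := p
  set T : ℍ := (m : ℝ) +ᵥ τ with hTdef
  have hT : (T : ℂ) = m + τ := by rw [hTdef, UpperHalfPlane.coe_vadd]; push_cast; rfl
  have hθ : theta T = theta τ := theta_int_vadd τ m
  have hT0 : (T : ℂ) ≠ 0 := T.ne_zero
  set τ' : ℍ := UpperHalfPlane.mk (-(T : ℂ))⁻¹ T.im_inv_neg_coe_pos with hτ'
  have h : (τ' : ℂ) = -1 / T := by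
    change (-(T : ℂ))⁻¹ = -1 / T
    field_simp
  have hsum : ∀ I : Finset (Fin n), ∑ i ∈ I, z i / T = (∑ i ∈ I, z i) / T := fun I =>
    (Finset.sum_div _ _ _).symm
  have hz' : (fun i => z i / T) ∈ regularLocus n τ' := by
    intro I hI hmem
    rw [hsum] at hmem
    exact hz I hI (mem_periodLattice_of_div hT h hmem)
  refine ⟨⟨(fun i => z i / T, τ'), hz'⟩, fun P => ?_⟩
  have hpi : (π : ℂ) ≠ 0 := by exact_mod_cast Real.pi_ne_zero
  have key : MvPolynomial.aeval (genVal ⟨(fun i => z i / T, τ'), hz'⟩) =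
      (MvPolynomial.aeval (genVal ⟨(z, τ), hz⟩)).comp (modAct (m + τ)) := by
    refine MvPolynomial.algHom_ext fun x => ?_
    rw [AlgHom.comp_apply, aeval_modAct_X, MvPolynomial.aeval_X, ← hT]
    rcases x with i | _ | ⟨k, I⟩
    · simp only [genVal_z]; ring
    · simp only [genVal_g]
      rw [eisG_inv h 1, eisG_eq_of_theta_eq hθ, modConst]
      simp only [if_true]
      ring
    · simp only [genVal_e, genVal_z]
      split_ifs with hI hk hk
      · rw [hsum, eStar_inv h, if_pos hk, mul_div_cancel₀ _ hT0, eStar_eq_of_theta_eq hθ, modConst]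
        · field_simp
          ring
        · rw [mul_div_cancel₀ _ hT0]
          exact fun hmem => hz I hI (periodLattice_subset_of_vadd hT hmem)
      · rw [hsum, eStar_inv h, if_neg hk, mul_div_cancel₀ _ hT0, eStar_eq_of_theta_eq hθ]
        rw [mul_div_cancel₀ _ hT0]
        exact fun hmem => hz I hI (periodLattice_subset_of_vadd hT hmem)
      · rw [Finset.not_nonempty_iff_eq_empty.1 hI]; simp
      · simp
  exact DFunLike.congr_fun key P

lemma exists_polynomial_modAct (p : Locus n) (P : MvPolynomial (Gen n) ℂ) :
    ∃ (N : ℕ) (Q : Polynomial ℂ), ∀ s : ℂ, s ≠ 0 →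
      s ^ N * MvPolynomial.aeval (genVal p) (modAct s P) = Q.eval s := by
  induction P using MvPolynomial.induction_on with
  | C a => exact ⟨0, Polynomial.C a, fun s _ => by simp [modAct]⟩
  | add P P' ih ih' =>
    obtain ⟨N, Q, hQ⟩ := ih
    obtain ⟨N', Q', hQ'⟩ := ih'
    refine ⟨N + N', Polynomial.X ^ N' * Q + Polynomial.X ^ N * Q', fun s hs => ?_⟩
    simp only [map_add, Polynomial.eval_add, Polynomial.eval_mul, Polynomial.eval_pow,
      Polynomial.eval_X, ← hQ s hs, ← hQ' s hs]
    ring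
  | mul_X P x ih =>
    obtain ⟨N, Q, hQ⟩ := ih
    have hx : ∃ Q' : Polynomial ℂ, ∀ s : ℂ, s ≠ 0 →
        s * MvPolynomial.aeval (genVal p) (modAct s (MvPolynomial.X x)) = Q'.eval s := by
      rcases x with i | _ | ⟨m, I⟩
      · refine ⟨Polynomial.C (genVal p (.z i)), fun s hs => ?_⟩
        rw [aeval_modAct_X]
        simp [hs]
      · refine ⟨Polynomial.X * (Polynomial.X ^ 2 * Polynomial.C (genVal p .g) +
          Polynomial.C modConst * Polynomial.X), fun s hs => ?_⟩
        rw [aeval_modAct_X]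
        simp only [Polynomial.eval_mul, Polynomial.eval_add, Polynomial.eval_pow, Polynomial.eval_X,
          Polynomial.eval_C]
      · refine ⟨Polynomial.X * (Polynomial.X ^ (m + 1) * Polynomial.C (genVal p (.e m I)) +
          Polynomial.C (if m = 0 then -2 * modConst * ∑ i ∈ I, genVal p (.z i) else 0)),
          fun s hs => ?_⟩
        rw [aeval_modAct_X]
        simp only [Polynomial.eval_mul, Polynomial.eval_add, Polynomial.eval_pow, Polynomial.eval_X,
          Polynomial.eval_C]
    obtain ⟨Q', hQ'⟩ := hx
    refine ⟨N + 1, Q * Q', fun s hs => ?_⟩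
    rw [map_mul, map_mul, Polynomial.eval_mul, ← hQ s hs, ← hQ' s hs]
    ring

lemma presentation_modAct {P : MvPolynomial (Gen n) ℂ} (hP : presentation n P = 0) {s : ℂ}
    (hs : s ≠ 0) : presentation n (modAct s P) = 0 := by
  rw [presentation_eq_zero_iff] at hP ⊢
  intro p
  obtain ⟨N, Q, hQ⟩ := exists_polynomial_modAct p P
  have hQ0 : Q = 0 := by
    refine Polynomial.eq_zero_of_infinite_isRoot Q ?_
    refine (Set.infinite_range_of_injective (f := fun m : ℤ => (m : ℂ) + p.1.2) ?_).mono ?_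
    · intro a b hab
      exact_mod_cast add_right_cancel hab
    · rintro _ ⟨m, rfl⟩
      obtain ⟨p', hp'⟩ := exists_locus_modular p m
      have hne : (m : ℂ) + p.1.2 ≠ 0 := by
        intro h0
        have h1 := congrArg Complex.im h0
        simp only [Complex.add_im, Complex.intCast_im, zero_add, Complex.zero_im] at h1
        exact p.1.2.im_pos.ne' h1
      change Q.eval _ = 0
      rw [← hQ _ hne, ← hp', hP, mul_zero]
  have := hQ s hs
  rw [hQ0, Polynomial.eval_zero] at this
  exact (mul_eq_zero.1 this).resolve_left (pow_ne_zero _ hs)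

/-- The derivation `∂_{𝔾_2}` on the polynomial ring in the generators. -/
def polyDerivation (n : ℕ) :
    Derivation ℂ (MvPolynomial (Gen n) ℂ) (MvPolynomial (Gen n) ℂ) :=
  MvPolynomial.mkDerivation ℂ fun
    | .z _ => 0
    | .g => 1
    | .e m I => if m = 0 then -2 * ∑ i ∈ I, MvPolynomial.X (.z i) else 0

/-- The exponential of a multiple of `∂_{𝔾_2}`, evaluated at a point. -/
def expAct (p : Locus n) : MvPolynomial (Gen n) ℂ →ₐ[ℂ] Polynomial ℂ :=
  MvPolynomial.aeval fun
    | .z i => Polynomial.C (genVal p (.z i))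
    | .g => Polynomial.C (genVal p .g) + Polynomial.X
    | .e m I => Polynomial.C (genVal p (.e m I)) +
        if m = 0 then Polynomial.C (-2 * ∑ i ∈ I, genVal p (.z i)) * Polynomial.X else 0

lemma modConst_ne_zero : modConst ≠ 0 := by
  have hpi : (π : ℂ) ≠ 0 := by exact_mod_cast Real.pi_ne_zero
  exact div_ne_zero (by norm_num) (by simp [hpi])

lemma eval_expAct (p : Locus n) {s : ℂ} (hs : s ≠ 0) (P : MvPolynomial (Gen n) ℂ) :
    (expAct p P).eval (2 * modConst / s) =
      MvPolynomial.aeval (genVal p) (modAct s (modAct s⁻¹ P)) := by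
  have key : (Polynomial.aeval (2 * modConst / s)).comp (expAct p) =
      (MvPolynomial.aeval (genVal p)).comp ((modAct s).comp (modAct s⁻¹)) := by
    refine MvPolynomial.algHom_ext fun x => ?_
    rcases x with i | _ | ⟨m, I⟩
    · simp [expAct, modAct, hs]
    · simp [expAct, modAct]
      field_simp
      ring
    · rcases m with _ | m
      · simp [expAct, modAct, ← Finset.mul_sum, Polynomial.eval_finsetSum]
        field_simp
        ring
      · simp [expAct, modAct]
        field_simp
  have := DFunLike.congr_fun key P
  simpa [Polynomial.aeval_def, Polynomial.eval₂_eq_eval_map] using this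

lemma expAct_eq_zero {P : MvPolynomial (Gen n) ℂ} (hP : presentation n P = 0) (p : Locus n) :
    expAct p P = 0 := by
  refine Polynomial.eq_zero_of_infinite_isRoot _ ?_
  refine (Set.infinite_range_of_injective
    (f := fun m : ℕ => 2 * modConst / ((m : ℂ) + 1)) ?_).mono ?_
  · intro a b hab
    have h2 : 2 * modConst ≠ 0 := mul_ne_zero two_ne_zero modConst_ne_zero
    have ha : (a : ℂ) + 1 ≠ 0 := Nat.cast_add_one_ne_zero a
    have hb : (b : ℂ) + 1 ≠ 0 := Nat.cast_add_one_ne_zero b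
    have hab : 2 * modConst / ((a : ℂ) + 1) = 2 * modConst / ((b : ℂ) + 1) := hab
    rw [div_eq_div_iff ha hb] at hab
    have := mul_left_cancel₀ h2 hab
    exact_mod_cast (add_right_cancel this).symm
  · rintro _ ⟨m, rfl⟩
    have hm : (m : ℂ) + 1 ≠ 0 := Nat.cast_add_one_ne_zero m
    change Polynomial.eval _ _ = 0
    rw [eval_expAct p hm]
    exact (presentation_eq_zero_iff _).1
      (presentation_modAct (presentation_modAct hP (inv_ne_zero hm)) hm) p

lemma eval_zero_expAct (p : Locus n) (P : MvPolynomial (Gen n) ℂ) :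
    (expAct p P).eval 0 = MvPolynomial.aeval (genVal p) P := by
  have key : (Polynomial.aeval (0 : ℂ)).comp (expAct p) = MvPolynomial.aeval (genVal p) := by
    refine MvPolynomial.algHom_ext fun x => ?_
    rcases x with i | _ | ⟨m, I⟩
    · simp [expAct]
    · simp [expAct]
    · rcases m with _ | m <;> simp [expAct]
  have := DFunLike.congr_fun key P
  simpa [Polynomial.aeval_def, Polynomial.eval₂_eq_eval_map] using this

lemma eval_derivative_expAct (p : Locus n) (P : MvPolynomial (Gen n) ℂ) :
    (Polynomial.derivative (expAct p P)).eval 0 =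
      MvPolynomial.aeval (genVal p) (polyDerivation n P) := by
  induction P using MvPolynomial.induction_on with
  | C a =>
    have : expAct p (MvPolynomial.C a) = Polynomial.C a := by simp [expAct]
    rw [this, polyDerivation, MvPolynomial.derivation_C]
    simp
  | add P P' ih ih' => simp only [map_add, Polynomial.eval_add, ih, ih']
  | mul_X P x ih =>
    rw [map_mul, Polynomial.derivative_mul, Polynomial.eval_add, Polynomial.eval_mul,
      Polynomial.eval_mul, ih, eval_zero_expAct, eval_zero_expAct, Derivation.leibniz, map_add,
      smul_eq_mul, smul_eq_mul, map_mul, map_mul]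
    have hx : (Polynomial.derivative (expAct p (MvPolynomial.X x))).eval 0 =
        MvPolynomial.aeval (genVal p) (polyDerivation n (MvPolynomial.X x)) := by
      rw [polyDerivation, MvPolynomial.mkDerivation_X]
      rcases x with i | _ | ⟨m, I⟩
      · simp [expAct]
      · simp [expAct]
      · rcases m with _ | m <;> simp [expAct, Polynomial.eval_finsetSum]
    rw [hx]; ring

lemma presentation_polyDerivation {P : MvPolynomial (Gen n) ℂ} (hP : presentation n P = 0) :
    presentation n (polyDerivation n P) = 0 := by
  rw [presentation_eq_zero_iff]
  intro p
  rw [← eval_derivative_expAct, expAct_eq_zero hP]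
  simp

lemma presentation_polyDerivation_congr {P Q : MvPolynomial (Gen n) ℂ}
    (h : presentation n P = presentation n Q) :
    presentation n (polyDerivation n P) = presentation n (polyDerivation n Q) := by
  rw [← sub_eq_zero, ← map_sub, ← map_sub]
  exact presentation_polyDerivation (by rw [map_sub, h, sub_self])

/-- A polynomial in the generators representing a given element. -/
def lift (f : qeRing n) : MvPolynomial (Gen n) ℂ := (presentation_surjective n f).choose

lemma presentation_lift (f : qeRing n) : presentation n (lift f) = f :=
  (presentation_surjective n f).choose_spec

/-- The derivation `∂_{𝔾_2}`. -/
def g2Derivation (n : ℕ) : Derivation ℂ (qeRing n) (qeRing n) :=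
  Derivation.mk'
    { toFun := fun f => presentation n (polyDerivation n (lift f))
      map_add' := fun f g => by
        rw [← map_add, ← map_add]
        exact presentation_polyDerivation_congr (by simp only [map_add, presentation_lift])
      map_smul' := fun a f => by
        rw [RingHom.id_apply, ← map_smul, ← Derivation.map_smul]
        exact presentation_polyDerivation_congr (by simp only [map_smul, presentation_lift]) }
    fun f g => by
      change presentation n (polyDerivation n (lift (f * g))) =
        f • presentation n (polyDerivation n (lift g)) +
          g • presentation n (polyDerivation n (lift f))
      rw [presentation_polyDerivation_congr (Q := lift f * lift g)
        (by simp only [map_mul, presentation_lift]), Derivation.leibniz, map_add, smul_eq_mul,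
        smul_eq_mul, map_mul, map_mul, presentation_lift, presentation_lift]
      rfl

lemma g2Derivation_presentation (P : MvPolynomial (Gen n) ℂ) :
    g2Derivation n (presentation n P) = presentation n (polyDerivation n P) :=
  presentation_polyDerivation_congr (presentation_lift _)

lemma g2Derivation_genElt (x : Gen n) : g2Derivation n (genElt x) = match x with
    | .z _ => 0
    | .g => 1
    | .e m I => if m = 0 then -2 * zElt I else 0 := by
  have h : genElt x = presentation n (MvPolynomial.X x) := by simp [presentation]
  rw [h, g2Derivation_presentation, polyDerivation, MvPolynomial.mkDerivation_X]
  rcases x with i | _ | ⟨m, I⟩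
  · simp
  · simp
  · rcases m with _ | m
    · simp only [if_true, map_mul, map_neg, map_ofNat, map_sum, presentation, MvPolynomial.aeval_X,
        genElt, zElt]
    · simp

lemma isG2Derivation_g2Derivation (n : ℕ) : IsG2Derivation (g2Derivation n) where
  map_z f i hf := by
    rw [show f = genElt (.z i) from Subtype.ext hf]
    exact g2Derivation_genElt _
  map_g2 f hf := by
    rw [show f = genElt .g from Subtype.ext hf]
    exact g2Derivation_genElt _
  map_e_one f I hI hf := by
    rw [show f = genElt (.e 0 I) from Subtype.ext (by rw [hf, genElt, eElt, dif_pos hI]),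
      g2Derivation_genElt]
    funext p
    change evalElt p (-2 * zElt I) = _
    rw [map_mul, evalElt_zElt, map_neg, map_ofNat]
  map_e f m I hm hI hf := by
    obtain ⟨m, rfl⟩ : ∃ k, m = k + 1 + 1 := ⟨m - 2, by omega⟩
    rw [show f = genElt (.e (m + 1) I) from Subtype.ext (by rw [hf, genElt, eElt, dif_pos hI]),
      g2Derivation_genElt]
    simp

lemma IsG2Derivation.unique {D D' : Derivation ℂ (qeRing n) (qeRing n)} (hD : IsG2Derivation D)
    (hD' : IsG2Derivation D') : D = D' := by
  have hgen : ∀ x : Gen n, D (genElt x) = D' (genElt x) := by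
    rintro (i | _ | ⟨m, I⟩)
    · rw [hD.map_z _ i rfl, hD'.map_z _ i rfl]
    · rw [hD.map_g2 _ rfl, hD'.map_g2 _ rfl]
    · rcases m with _ | m
      · exact (hD.map_eElt_zero I).trans (hD'.map_eElt_zero I).symm
      · exact (hD.map_eElt_succ I m).trans (hD'.map_eElt_succ I m).symm
  ext1 f
  obtain ⟨P, rfl⟩ := presentation_surjective n f
  induction P using MvPolynomial.induction_on with
  | C a =>
    rw [← MvPolynomial.algebraMap_eq, AlgHom.commutes, Derivation.map_algebraMap,
      Derivation.map_algebraMap]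
  | add P Q ih ih' => rw [map_add, map_add, map_add, ih, ih']
  | mul_X P x ih =>
    have h : presentation n (MvPolynomial.X x) = genElt x := by simp [presentation]
    rw [map_mul, Derivation.leibniz, Derivation.leibniz, ih, h, hgen]

end

end EllipticGW

end

theorem mainTheorem6 (n : ℕ) (hn : 1 ≤ n) :
    (∀ m : ℕ, 1 ≤ m → EllipticGW.IsCycleContinuation m (EllipticGW.TGW m)) ∧
    (∃! D : Derivation ℂ (EllipticGW.qeRing n) (EllipticGW.qeRing n),
      EllipticGW.IsG2Derivation D) ∧
    ∃ hT : EllipticGW.tFun n ∈ EllipticGW.qeRing n,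
      ∀ D : Derivation ℂ (EllipticGW.qeRing n) (EllipticGW.qeRing n),
        EllipticGW.IsG2Derivation D →
        ∀ p : EllipticGW.Locus n,
          ((D ⟨EllipticGW.tFun n, hT⟩ : EllipticGW.qeRing n) : EllipticGW.Locus n → ℂ) p =
            -2 * ∑ i : Fin n, ∑ j ∈ Finset.Ioi i, (p.1.1 i + p.1.1 j) *
              EllipticGW.TGW (n - 1) (EllipticGW.mergeTuple p.1.1 i j) p.1.2 :=
  ⟨fun _ hm => EllipticGW.isCycleContinuation_TGW hm,
    ⟨EllipticGW.g2Derivation n, EllipticGW.isG2Derivation_g2Derivation n,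
      fun _ hD => hD.unique (EllipticGW.isG2Derivation_g2Derivation n)⟩,
    EllipticGW.tFun_mem hn, fun _ hD p => hD.apply_tFun hn p⟩
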